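/- **Setting.** Let $T\in\{0,1\}$ be a treatment, $Y_0,Y_1$ real potential outcomes and $X=(U,Z)$ covariates. The full data $(T,Y_0,Y_1,X)$ have law $F$, and one observes $W=(T,Y,X)$ with $Y=TY_1+(1-T)Y_0$. The model consists of all full-data laws such that, for some $\theta\in\Theta\subseteq\mathbb R^d$, $$\mathrm{pr}(T=1\mid Y_0,X)=\pi(Y_0,U;\theta),$$ where $\pi$ is a known function. The law of $X$ and the conditional laws of $Y_0$ given $(X,T=0)$ and of $Y_1$ given $(X,T=1)$ are unrestricted nuisance parameters. The estimand is $\Delta=\mathrm E(Y_1-Y_0\mid T=1)$. Let $F$ be in the model with true parameter $\theta$ in the interior of $\Theta$. Write $\pi(\theta)=\pi(Y_0,U;\theta)$, $\dot\pi(\theta)=\partial\pi(\theta)/\partial\theta$, $p=\mathrm{pr}(T=1)$, $w(x)=\mathrm{pr}(T=1\mid x)$. Let $\mathrm E_0(\cdot\mid x)$, $\mathrm E_0(\cdot\mid x,0)$ and $\mathrm E_1(\cdot\mid x,1)$ be the conditional expectations with respect to the laws of $Y_0$ given $X=x$, of $Y_0$ given $X=x,T=0$, and of $Y_1$ given $X=x,T=1$.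 Put $$A(x)=\mathrm E_0\Big[\frac{\dot\pi(\theta)}{1-\pi(\theta)}\,\Big|\,x\Big],\qquad B(x)=\mathrm E_0\Big[\frac{\pi(\theta)}{1-\pi(\theta)}\,\Big|\,x\Big],$$ $$V(x)=w(x)\mathrm E_1(Y_1\mid x,1)-w(x)\Delta+\{1-w(x)\}\mathrm E_0\Big[\frac{\pi(\theta)^2}{\{1-\pi(\theta)\}^2}Y_0\,\Big|\,x,0\Big],$$ $$M=\mathrm E\{B(X)^{-1}A(X)A(X)^{\mathrm T}\},\quad Q=\mathrm E\Big[Y_0\frac{\dot\pi(\theta)}{1-\pi(\theta)}\Big],\quad D=\mathrm E\{B(X)^{-1}V(X)A(X)\}.$$ **Regularity.** For each $\theta'\in\Theta$, $\pi(\cdot,\cdot;\theta')$ is measurable; there is $c>0$ with $c\le\pi\le 1-c$ on $\Theta$; on the interior of $\Theta$, $\pi$ is differentiable in $\theta'$ with a gradient bounded uniformly in $(y_0,u,\theta')$; $\mathrm E(Y^2)<\infty$; $M$ is invertible. **Definitions.** A regular parametric submodel is a path $s\mapsto(F_s,\theta_s)$ in the model for $s$ near $0$, with $F_0=F$, $\theta_0=\theta$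 and $\theta_s$ differentiable at $0$, whose laws of $W$ are dominated by a common $\sigma$-finite measure and are differentiable in quadratic mean at $s=0$ with a score $S\in L^2$, and with $\mathrm E_{F_s}(Y^2)$ bounded for $s$ near $0$. The tangent space is the $L^2$-closure of the linear span of the scores of all regular submodels; the nuisance tangent space $\Lambda$ is the same for the submodels with $\theta_s=\theta$ near $s=0$. The efficient score $S_{\rm eff}$ for $\theta$ is the componentwise orthogonal projection onto $\Lambda^\perp$ of the score for $\theta$ (the score when $\theta$ moves and the nuisance parameters are fixed). The efficient influence function of $\Delta$ is the mean-zero, square-integrable function $\phi_{\rm eff}(W)$ in the tangent space such that, for every regular submodel, $\Delta(F_s)$ is differentiable at $s=0$ with derivative $\mathrm E(\phi_{\rm eff}S)$. **Proposition.** The efficient influence function of $\Delta$ exists, is unique almost surely, and is $$\phi_{\rm eff}(w;\theta,\Delta)=\phi(w;\theta,\Delta)+H^{\mathrm T}S_{\rm eff}(w;\theta),\qquad \phi\in\Lambda,\quad S_{\rm eff}\in(\Lambda^\perp)^d,$$ where $$S_{\rm eff}(w;\theta)=\frac{t-\pi(\theta)}{1-\pi(\theta)}\,\frac{A(x)}{B(x)}$$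 is the efficient score for $\theta$, $$H=p^{-1}M^{-1}(D-Q),$$ and $$\phi(w;\theta,\Delta)=\frac1p\Big\{\frac{t-\pi(\theta)}{1-\pi(\theta)}\,y-\frac{t-\pi(\theta)}{1-\pi(\theta)}\frac1{B(x)}\Big(w(x)\mathrm E_1(Y_1\mid x,1)+\{1-w(x)\}\mathrm E_0\Big[\frac{\pi(\theta)^2}{\{1-\pi(\theta)\}^2}Y_0\,\Big|\,x,0\Big]\Big)-\Delta\Big(t-\frac{t-\pi(\theta)}{1-\pi(\theta)}\frac{w(x)}{B(x)}\Big)\Big\}.$$ Here $\{t-\pi(\theta)\}/\{1-\pi(\theta)\}$ is evaluated at $y_0=y$ if $t=0$, and equals $1$ if $t=1$. -/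

import Mathlib

open MeasureTheory ProbabilityTheory Filter
open scoped Topology NNReal ENNReal

noncomputable section

namespace ATT

/-! ### Full data, observed data, the model and the estimand -/

/-- Full data `(T, Y₀, Y₁, (U, Z))`: treatment, the two potential outcomes and the covariates
`X = (U, Z)`, of which `Z` is the shadow variable. -/
abbrev FullData (𝒰 𝒵 : Type*) := Bool × ℝ × ℝ × (𝒰 × 𝒵)

/-- Observed data `W = (T, Y, X)`, with `X = (U, Z)`. -/
abbrev ObsData (𝒰 𝒵 : Type*) := Bool × ℝ × (𝒰 × 𝒵)

/-- The number `0` or `1` of a treatment arm. -/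
def tval (t : Bool) : ℝ := if t then 1 else 0

section

variable {𝒰 𝒵 : Type*}

/-- The treatment in the full data. -/
def trt (ω : FullData 𝒰 𝒵) : Bool := ω.1

/-- The untreated potential outcome `Y₀`. -/
def y0 (ω : FullData 𝒰 𝒵) : ℝ := ω.2.1

/-- The treated potential outcome `Y₁`. -/
def y1 (ω : FullData 𝒰 𝒵) : ℝ := ω.2.2.1

/-- The covariates `X = (U, Z)`. -/
def cov (ω : FullData 𝒰 𝒵) : 𝒰 × 𝒵 := ω.2.2.2

/-- The observed data `(T, Y, X)` with `Y = T Y₁ + (1 - T) Y₀`. -/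
def obs (ω : FullData 𝒰 𝒵) : ObsData 𝒰 𝒵 :=
  (trt ω, tval (trt ω) * y1 ω + (1 - tval (trt ω)) * y0 ω, cov ω)

variable [MeasurableSpace 𝒰] [MeasurableSpace 𝒵] {d : ℕ}

/-- The law of the observed data when the full data have law `F`. -/
def obsLaw (F : Measure (FullData 𝒰 𝒵)) : Measure (ObsData 𝒰 𝒵) := F.map obs

/-- The semiparametric model: `F` is the law of full data with
`pr(T = 1 | Y₀, X) = π(Y₀, U; θ)` for the parameter `θ ∈ Θ`; nothing else is restricted. -/
def InModel (π : ℝ → 𝒰 → EuclideanSpace ℝ (Fin d) → ℝ) (Θ : Set (EuclideanSpace ℝ (Fin d)))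
    (F : Measure (FullData 𝒰 𝒵)) (θ : EuclideanSpace ℝ (Fin d)) : Prop :=
  IsProbabilityMeasure F ∧ θ ∈ Θ ∧
    F[fun ω => tval (trt ω) | MeasurableSpace.comap (fun ω => (y0 ω, cov ω)) inferInstance]
      =ᵐ[F] fun ω => π (y0 ω) (cov ω).1 θ

/-- The average treatment effect on the treated, `Δ = E(Y₁ - Y₀ | T = 1)`. -/
def att (F : Measure (FullData 𝒰 𝒵)) : ℝ :=
  ∫ ω, (y1 ω - y0 ω) ∂(F[|{ω | trt ω = true}])

/-! ### Regular parametric submodels, tangent spaces, efficient scores, influence functions -/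

/-- The path `P` of laws is differentiable in quadratic mean at `0` with score `S`: the root
densities with respect to a common `σ`-finite dominating measure have the derivative
`S √p₀ / 2` in `L²`. -/
def HasScore (P : ℝ → Measure (ObsData 𝒰 𝒵)) (S : ObsData 𝒰 𝒵 → ℝ) : Prop :=
  ∃ ν : Measure (ObsData 𝒰 𝒵), SigmaFinite ν ∧ (∀ᶠ s in 𝓝 (0 : ℝ), P s ≪ ν) ∧
    Tendsto (fun s : ℝ => eLpNorm (fun o =>
        (√((P s).rnDeriv ν o).toReal - √((P 0).rnDeriv ν o).toReal) / s
          - S o * √((P 0).rnDeriv ν o).toReal / 2) 2 ν)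
      (𝓝[≠] 0) (𝓝 0)

/-- A regular one-dimensional parametric submodel through the law `F` with parameter `θ₀`: a path
of laws in the model, with a differentiable parameter, whose observed-data laws are
differentiable in quadratic mean and have locally bounded second moments of the outcome. -/
structure RegularSubmodel (π : ℝ → 𝒰 → EuclideanSpace ℝ (Fin d) → ℝ)
    (Θ : Set (EuclideanSpace ℝ (Fin d))) (F : Measure (FullData 𝒰 𝒵))
    (θ₀ : EuclideanSpace ℝ (Fin d)) where
  /-- the full-data laws -/
  law : ℝ → Measure (FullData 𝒰 𝒵)
  /-- the parameter of the treatment model -/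
  par : ℝ → EuclideanSpace ℝ (Fin d)
  /-- the derivative of the parameter -/
  dir : EuclideanSpace ℝ (Fin d)
  /-- the score of the observed data -/
  score : ObsData 𝒰 𝒵 → ℝ
  law_zero : law 0 = F
  par_zero : par 0 = θ₀
  mem_model : ∀ᶠ s in 𝓝 (0 : ℝ), InModel π Θ (law s) (par s)
  par_deriv : HasDerivAt par dir 0
  score_memLp : MemLp score 2 (obsLaw F)
  has_score : HasScore (fun s => obsLaw (law s)) score
  moment : ∃ C : ℝ≥0, ∀ᶠ s in 𝓝 (0 : ℝ), ∫⁻ o, ‖o.2.1‖ₑ ^ 2 ∂(obsLaw (law s)) ≤ C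

/-- The tangent space: the mean-square closure of the linear span of the scores of all regular
parametric submodels. -/
def tangentSpace (π : ℝ → 𝒰 → EuclideanSpace ℝ (Fin d) → ℝ)
    (Θ : Set (EuclideanSpace ℝ (Fin d))) (F : Measure (FullData 𝒰 𝒵))
    (θ₀ : EuclideanSpace ℝ (Fin d)) : Submodule ℝ (Lp ℝ 2 (obsLaw F)) :=
  (Submodule.span ℝ {S | ∃ m : RegularSubmodel π Θ F θ₀,
    S = m.score_memLp.toLp m.score}).topologicalClosure

/-- The nuisance tangent space: the same, for the submodels in which `θ` is held fixed. -/
def nuisanceTangentSpace (π : ℝ → 𝒰 → EuclideanSpace ℝ (Fin d) → ℝ)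
    (Θ : Set (EuclideanSpace ℝ (Fin d))) (F : Measure (FullData 𝒰 𝒵))
    (θ₀ : EuclideanSpace ℝ (Fin d)) : Submodule ℝ (Lp ℝ 2 (obsLaw F)) :=
  (Submodule.span ℝ {S | ∃ m : RegularSubmodel π Θ F θ₀,
    (∀ᶠ s in 𝓝 (0 : ℝ), m.par s = θ₀) ∧ S = m.score_memLp.toLp m.score}).topologicalClosure

/-- The observed-data laws `P` and `P'` have the same nuisance parts: the same law of `X` and the
same conditional laws of `Y` given `X` and `T = t`, `t = 0, 1`. The latter says that the density
of `P'` with respect to `P` depends on `(t, x)` only. -/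
def SameNuisance (P P' : Measure (ObsData 𝒰 𝒵)) : Prop :=
  P'.map (fun o => o.2.2) = P.map (fun o => o.2.2) ∧
    ∃ r : Bool × (𝒰 × 𝒵) → ℝ≥0∞, Measurable r ∧ P' = P.withDensity fun o => r (o.1, o.2.2)

/-- `ℓ` is the score for `θ`: for each direction `v`, the submodel that moves `θ` along
`θ₀ + s v` and holds the nuisance parts fixed is regular and has the score `vᵀ ℓ`. -/
def IsThetaScore (π : ℝ → 𝒰 → EuclideanSpace ℝ (Fin d) → ℝ)
    (Θ : Set (EuclideanSpace ℝ (Fin d))) (F : Measure (FullData 𝒰 𝒵))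
    (θ₀ : EuclideanSpace ℝ (Fin d)) (ℓ : ObsData 𝒰 𝒵 → EuclideanSpace ℝ (Fin d)) : Prop :=
  ∀ v : EuclideanSpace ℝ (Fin d), ∃ m : RegularSubmodel π Θ F θ₀,
    (∀ᶠ s in 𝓝 (0 : ℝ), m.par s = θ₀ + s • v ∧ SameNuisance (obsLaw F) (obsLaw (m.law s))) ∧
    m.score =ᵐ[obsLaw F] fun o => inner ℝ v (ℓ o)

/-- `S` is the efficient score for `θ`: componentwise the orthogonal projection of the score for
`θ` onto the orthogonal complement of the nuisance tangent space. -/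
def IsEfficientScore (π : ℝ → 𝒰 → EuclideanSpace ℝ (Fin d) → ℝ)
    (Θ : Set (EuclideanSpace ℝ (Fin d))) (F : Measure (FullData 𝒰 𝒵))
    (θ₀ : EuclideanSpace ℝ (Fin d)) (S : ObsData 𝒰 𝒵 → EuclideanSpace ℝ (Fin d)) : Prop :=
  ∃ ℓ : ObsData 𝒰 𝒵 → EuclideanSpace ℝ (Fin d), IsThetaScore π Θ F θ₀ ℓ ∧
    ∀ j : Fin d, ∃ (hℓ : MemLp (fun o => ℓ o j) 2 (obsLaw F))
      (hS : MemLp (fun o => S o j) 2 (obsLaw F)),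
      hS.toLp _ ∈ (nuisanceTangentSpace π Θ F θ₀)ᗮ ∧
      hℓ.toLp _ - hS.toLp _ ∈ nuisanceTangentSpace π Θ F θ₀

/-- `ψ` is the efficient influence function of `Δ`: it has mean zero and finite variance, it lies
in the tangent space, and along every regular parametric submodel the derivative of `Δ` is the
covariance of `ψ` and the score. -/
def IsEIF (π : ℝ → 𝒰 → EuclideanSpace ℝ (Fin d) → ℝ)
    (Θ : Set (EuclideanSpace ℝ (Fin d))) (F : Measure (FullData 𝒰 𝒵))
    (θ₀ : EuclideanSpace ℝ (Fin d)) (ψ : ObsData 𝒰 𝒵 → ℝ) : Prop :=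
  ∫ o, ψ o ∂(obsLaw F) = 0 ∧
    (∃ hψ : MemLp ψ 2 (obsLaw F), hψ.toLp ψ ∈ tangentSpace π Θ F θ₀) ∧
    ∀ m : RegularSubmodel π Θ F θ₀,
      HasDerivAt (fun s => att (m.law s)) (∫ o, ψ o * m.score o ∂(obsLaw F)) 0

/-! ### The explicit quantities -/

/-- `E₀{h(Y₀) | x}`, the conditional expectation given `X = x`. -/
def E0 {E : Type*} [NormedAddCommGroup E] [NormedSpace ℝ E] (F : Measure (FullData 𝒰 𝒵))
    [IsFiniteMeasure F] (h : ℝ → E) (x : 𝒰 × 𝒵) : E :=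
  ∫ y, h y ∂(condDistrib y0 cov F x)

/-- `E₀{h(Y₀) | x, 0}`, the conditional expectation given `X = x` and `T = 0`. -/
def E0untreated (F : Measure (FullData 𝒰 𝒵)) (h : ℝ → ℝ) (x : 𝒰 × 𝒵) : ℝ :=
  ∫ y, h y ∂(condDistrib y0 cov (F[|{ω | trt ω = false}]) x)

/-- `E₁{h(Y₁) | x, 1}`, the conditional expectation given `X = x` and `T = 1`. -/
def E1treated (F : Measure (FullData 𝒰 𝒵)) (h : ℝ → ℝ) (x : 𝒰 × 𝒵) : ℝ :=
  ∫ y, h y ∂(condDistrib y1 cov (F[|{ω | trt ω = true}]) x)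

/-- `p = pr(T = 1)`. -/
def pTreat (F : Measure (FullData 𝒰 𝒵)) : ℝ := F.real {ω | trt ω = true}

/-- `w(x) = pr(T = 1 | x)`. -/
def wfun (F : Measure (FullData 𝒰 𝒵)) [IsFiniteMeasure F] (x : 𝒰 × 𝒵) : ℝ :=
  (condDistrib trt cov F x).real {true}

variable (π : ℝ → 𝒰 → EuclideanSpace ℝ (Fin d) → ℝ) (θ : EuclideanSpace ℝ (Fin d))
  (F : Measure (FullData 𝒰 𝒵))

/-- `∂π(y₀, u; θ)/∂θ`. -/
def piDot (y : ℝ) (u : 𝒰) : EuclideanSpace ℝ (Fin d) := gradient (π y u) θ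

/-- `{t - π(θ)} / {1 - π(θ)}` as a function of the observed data. The observed outcome stands for
`y₀`: it is `y₀` if `t = 0`, and if `t = 1` then the ratio is `1` whatever `y₀` is. -/
def ratio (o : ObsData 𝒰 𝒵) : ℝ :=
  (tval o.1 - π o.2.1 o.2.2.1 θ) / (1 - π o.2.1 o.2.2.1 θ)

/-- `A(x) = E₀[{1 - π(θ)}⁻¹ ∂π(θ)/∂θ | x]`. -/
def Afun [IsFiniteMeasure F] (x : 𝒰 × 𝒵) : EuclideanSpace ℝ (Fin d) :=
  E0 F (fun y => (1 - π y x.1 θ)⁻¹ • piDot π θ y x.1) x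

/-- `B(x) = E₀[{1 - π(θ)}⁻¹ π(θ) | x]`. -/
def Bfun [IsFiniteMeasure F] (x : 𝒰 × 𝒵) : ℝ :=
  E0 F (fun y => (1 - π y x.1 θ)⁻¹ * π y x.1 θ) x

/-- `w(x) E₁(Y₁ | x, 1) + {1 - w(x)} E₀[π(θ)² {1 - π(θ)}⁻² Y₀ | x, 0]`. -/
def outcomePart [IsFiniteMeasure F] (x : 𝒰 × 𝒵) : ℝ :=
  wfun F x * E1treated F (fun y => y) x
    + (1 - wfun F x) * E0untreated F (fun y => π y x.1 θ ^ 2 / (1 - π y x.1 θ) ^ 2 * y) x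

/-- `V(x) = w(x) E₁(Y₁ | x, 1) - w(x) Δ + {1 - w(x)} E₀[π(θ)² {1 - π(θ)}⁻² Y₀ | x, 0]`. -/
def Vfun [IsFiniteMeasure F] (x : 𝒰 × 𝒵) : ℝ :=
  outcomePart π θ F x - wfun F x * att F

/-- `M = E{B(X)⁻¹ A(X) A(X)ᵀ}`. -/
def Mmat [IsFiniteMeasure F] : Matrix (Fin d) (Fin d) ℝ :=
  Matrix.of fun i j => ∫ ω, (Bfun π θ F (cov ω))⁻¹ *
    (Afun π θ F (cov ω) i * Afun π θ F (cov ω) j) ∂F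

/-- `Q = E[Y₀ {1 - π(θ)}⁻¹ ∂π(θ)/∂θ]`. -/
def Qvec : EuclideanSpace ℝ (Fin d) :=
  ∫ ω, (y0 ω * (1 - π (y0 ω) (cov ω).1 θ)⁻¹) • piDot π θ (y0 ω) (cov ω).1 ∂F

/-- `D = E{B(X)⁻¹ V(X) A(X)}`. -/
def Dvec [IsFiniteMeasure F] : EuclideanSpace ℝ (Fin d) :=
  ∫ ω, ((Bfun π θ F (cov ω))⁻¹ * Vfun π θ F (cov ω)) • Afun π θ F (cov ω) ∂F

/-- `H = p⁻¹ M⁻¹ (D - Q)`. -/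
def Hvec [IsFiniteMeasure F] : EuclideanSpace ℝ (Fin d) :=
  (pTreat F)⁻¹ • WithLp.toLp 2 ((Mmat π θ F)⁻¹.mulVec (Dvec π θ F - Qvec π θ F).ofLp)

/-- `S_eff(w; θ) = {t - π(θ)} / {1 - π(θ)} · A(x) / B(x)`. -/
def Seff [IsFiniteMeasure F] (o : ObsData 𝒰 𝒵) : EuclideanSpace ℝ (Fin d) :=
  (ratio π θ o * (Bfun π θ F o.2.2)⁻¹) • Afun π θ F o.2.2

/-- The function `φ(w; θ, Δ)`. -/
def phi [IsFiniteMeasure F] (o : ObsData 𝒰 𝒵) : ℝ :=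
  (pTreat F)⁻¹ *
    (ratio π θ o * o.2.1
      - ratio π θ o * (1 / Bfun π θ F o.2.2) * outcomePart π θ F o.2.2
      - att F * (tval o.1 - ratio π θ o * (wfun F o.2.2 / Bfun π θ F o.2.2)))

end

end ATT

end

/-! The estimand and the scores involve the observed data only, and the model for the observed data
is a conditional moment restriction. Put `ρ = {T - π(θ)} / {1 - π(θ)} = T - (1 - T) π / (1 - π)`.
Weighting the untreated by `1 / (1 - π)` turns means over `(Y₀, X)` into means of observed data, so
the propensity condition implies `E(ρ | X) = 0`, and `Δ = E(ρ Y) / E(T)`. Conversely, every observed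
law with `E(ρ | X) = 0` comes from full data in the model (`exists_full_law`): the missing `Y₀` of
the treated is drawn from the odds-weighted outcome law of the untreated. Submodels can therefore be
built directly from densities of `W`.

Along a regular submodel with score `S` and direction `v`, the derivative of `E(ρ g(X)) = 0` is
zero, which gives `E(ρ S | X) = vᵀ A(X)` (`condExp_ratio_mul_score`). The derivative of `E(ρ Y) /
E(T)` is `p⁻¹ {E(ρ Y S) - vᵀ Q - Δ E(T S)}` (`hasDerivAt_att`). Both rest on differentiating means
under quadratic-mean differentiability when second moments are only locally bounded
(`HasScore.hasDerivAt_integral`, `HasScore.tendsto_integral_sub`).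

The nuisance tangent space is characterised by `E(S) = 0` and `E(ρ S | X) = 0`. Bounded functions of
this kind are scores of the linear paths with density `1 + s S`. A function orthogonal to all of
these is a constant plus `ρ k(X)`, so a double orthogonal complement yields every square-integrable
one (`toLp_mem_nuisanceTangentSpace`).

Since `E(ρ² | X) = B`, the function `ρ A / B` satisfies `E(ρ · ρ vᵀA / B | X) = vᵀ A`. Subtracting
`vᵀ S_eff` from a score of direction `v` thus leaves an element of `Λ`, whereas `vᵀ S_eff`, being
`ρ` times a function of `X`, is orthogonal to `Λ`. The submodel moving `θ` alone has density ratios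
computed from the conditional odds of treatment given `X` (`exists_theta_submodel`). It supplies the
score for `θ` and puts `vᵀ S_eff` in the tangent space.

Finally `φ = p⁻¹ (ρ Y - Δ T - ρ V / B)`. The identity `E(ρ² Y - Δ T | X) = V` places it in `Λ`. Its
covariance with `S` differs from the derivative of `Δ` only in having `D` where `Q` is required, and
`Hᵀ S_eff` with `M H = p⁻¹ (D - Q)` repairs exactly that. -/

namespace ATT

/-! ### The residual ratio, and identification from the observed data -/

section Observed

variable {𝒰 𝒵 : Type*}

/-- The odds `q / (1 - q)` of a propensity `q`. -/
noncomputable def odds (q : ℝ → 𝒰 → ℝ) (y : ℝ) (u : 𝒰) : ℝ := q y u / (1 - q y u)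

/-- `(t - q) / (1 - q)` as a function of the observed data. -/
noncomputable def resid (q : ℝ → 𝒰 → ℝ) (o : ObsData 𝒰 𝒵) : ℝ :=
  (tval o.1 - q o.2.1 o.2.2.1) / (1 - q o.2.1 o.2.2.1)

@[simp] lemma tval_true : tval true = 1 := rfl
@[simp] lemma tval_false : tval false = 0 := rfl

lemma tval_nonneg (t : Bool) : 0 ≤ tval t := by cases t <;> simp
lemma tval_le_one (t : Bool) : tval t ≤ 1 := by cases t <;> simp

@[simp] lemma obs_fst (ω : FullData 𝒰 𝒵) : (obs ω).1 = trt ω := rfl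
@[simp] lemma obs_cov (ω : FullData 𝒰 𝒵) : (obs ω).2.2 = cov ω := rfl

lemma obs_outcome_of_true {ω : FullData 𝒰 𝒵} (h : trt ω = true) : (obs ω).2.1 = y1 ω := by
  simp [obs, h]

lemma obs_outcome_of_false {ω : FullData 𝒰 𝒵} (h : trt ω = false) : (obs ω).2.1 = y0 ω := by
  simp [obs, h]

lemma one_sub_tval_mul_obs (h : ℝ → 𝒰 × 𝒵 → ℝ) (ω : FullData 𝒰 𝒵) :
    (1 - tval (obs ω).1) * h (obs ω).2.1 (obs ω).2.2 = (1 - tval (trt ω)) * h (y0 ω) (cov ω) := by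
  cases ht : trt ω
  · simp [ht, obs_outcome_of_false ht]
  · simp [ht]

lemma tval_mul_obs (ω : FullData 𝒰 𝒵) :
    tval (obs ω).1 * (obs ω).2.1 = tval (trt ω) * y1 ω := by
  cases ht : trt ω
  · simp [ht]
  · simp [ht, obs_outcome_of_true ht]

variable [MeasurableSpace 𝒰] [MeasurableSpace 𝒵]

@[fun_prop] lemma measurable_tval : Measurable tval := Measurable.of_discrete
@[fun_prop] lemma measurable_trt : Measurable (trt : FullData 𝒰 𝒵 → Bool) := measurable_fst
@[fun_prop] lemma measurable_y0 : Measurable (y0 : FullData 𝒰 𝒵 → ℝ) := by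
  unfold y0; fun_prop
@[fun_prop] lemma measurable_y1 : Measurable (y1 : FullData 𝒰 𝒵 → ℝ) := by
  unfold y1; fun_prop
@[fun_prop] lemma measurable_cov : Measurable (cov : FullData 𝒰 𝒵 → 𝒰 × 𝒵) := by
  unfold cov; fun_prop
@[fun_prop] lemma measurable_obs : Measurable (obs : FullData 𝒰 𝒵 → ObsData 𝒰 𝒵) := by
  unfold obs; fun_prop

/-- A measurable propensity bounded away from `0` and `1`. -/
structure IsPropensity (q : ℝ → 𝒰 → ℝ) (c : ℝ) : Prop where
  pos : 0 < c
  meas : Measurable fun z : ℝ × 𝒰 => q z.1 z.2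
  lower : ∀ y u, c ≤ q y u
  upper : ∀ y u, q y u ≤ 1 - c

namespace IsPropensity

variable {q : ℝ → 𝒰 → ℝ} {c : ℝ} (hq : IsPropensity q c)
include hq

lemma pos' (y u) : 0 < q y u := hq.pos.trans_le (hq.lower y u)
lemma one_sub_ge (y u) : c ≤ 1 - q y u := by linarith [hq.upper y u]
lemma one_sub_pos (y u) : 0 < 1 - q y u := hq.pos.trans_le (hq.one_sub_ge y u)
lemma one_sub_ne (y u) : 1 - q y u ≠ 0 := (hq.one_sub_pos y u).ne'
lemma le_one (y u) : q y u ≤ 1 := by linarith [hq.one_sub_pos y u]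

lemma inv_le (y u) : (1 - q y u)⁻¹ ≤ c⁻¹ := inv_anti₀ hq.pos (hq.one_sub_ge y u)
lemma inv_pos (y u) : 0 < (1 - q y u)⁻¹ := _root_.inv_pos.2 (hq.one_sub_pos y u)
lemma abs_inv_le (y u) : |(1 - q y u)⁻¹| ≤ c⁻¹ := by
  rw [abs_of_pos (hq.inv_pos y u)]; exact hq.inv_le y u

lemma odds_pos (y u) : 0 < odds q y u := div_pos (hq.pos' y u) (hq.one_sub_pos y u)

lemma odds_le (y u) : odds q y u ≤ c⁻¹ := by
  rw [odds, div_eq_mul_inv]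
  exact (mul_le_of_le_one_left (hq.inv_pos y u).le (hq.le_one y u)).trans (hq.inv_le y u)

/-- Dividing by `1 - q ≤ 1` can only increase `q`. This bound keeps `B` and the conditional odds
given the covariates away from zero. -/
lemma le_odds (y u) : c ≤ odds q y u := by
  refine (hq.lower y u).trans ?_
  rw [odds, le_div_iff₀ (hq.one_sub_pos y u)]
  nlinarith [hq.pos' y u]

lemma abs_odds_le (y u) : |odds q y u| ≤ c⁻¹ := by
  rw [abs_of_pos (hq.odds_pos y u)]; exact hq.odds_le y u

lemma measurable_q : Measurable fun z : ℝ × (𝒰 × 𝒵) => q z.1 z.2.1 :=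
  hq.meas.comp (measurable_fst.prodMk (measurable_fst.comp measurable_snd))

lemma measurable_odds : Measurable fun z : ℝ × (𝒰 × 𝒵) => odds q z.1 z.2.1 := by
  have := hq.measurable_q (𝒵 := 𝒵)
  exact this.div (measurable_const.sub this)

lemma measurable_inv : Measurable fun z : ℝ × (𝒰 × 𝒵) => (1 - q z.1 z.2.1)⁻¹ := by
  exact (measurable_const.sub hq.measurable_q).inv

omit [MeasurableSpace 𝒵] in
lemma resid_eq (o : ObsData 𝒰 𝒵) :
    resid q o = tval o.1 - (1 - tval o.1) * odds q o.2.1 o.2.2.1 := by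
  rcases o with ⟨t, y, x⟩
  have := hq.one_sub_ne y x.1
  cases t
  · simp [resid, odds, neg_div]
  · simp [resid, this]

lemma measurable_resid : Measurable (resid q : ObsData 𝒰 𝒵 → ℝ) := by
  have : Measurable fun o : ObsData 𝒰 𝒵 => q o.2.1 o.2.2.1 :=
    hq.measurable_q.comp measurable_snd
  exact ((measurable_tval.comp measurable_fst).sub this).div (measurable_const.sub this)

omit [MeasurableSpace 𝒵] in
lemma abs_resid_le (o : ObsData 𝒰 𝒵) : |resid q o| ≤ c⁻¹ := by
  rw [hq.resid_eq]
  rcases o with ⟨t, y, x⟩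
  cases t
  · simpa using hq.abs_odds_le y x.1
  -- For the treated the ratio is `1`, and overlap itself forces `c ≤ 1`.
  · have h1 := hq.one_sub_ge y x.1
    have h2 := hq.pos' y x.1
    simpa using (one_le_inv₀ hq.pos).2 (by linarith)

end IsPropensity

/-- `q` is the conditional probability of treatment given `(Y₀, X)` under `F`. -/
def HasPropensity (F : Measure (FullData 𝒰 𝒵)) (q : ℝ → 𝒰 → ℝ) : Prop :=
  F[fun ω => tval (trt ω) | MeasurableSpace.comap (fun ω => (y0 ω, cov ω)) inferInstance]
      =ᵐ[F] fun ω => q (y0 ω) (cov ω).1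

instance (F : Measure (FullData 𝒰 𝒵)) [IsProbabilityMeasure F] :
    IsProbabilityMeasure (obsLaw F) :=
  Measure.isProbabilityMeasure_map measurable_obs.aemeasurable

lemma integrable_tval_comp {Ω : Type*} [MeasurableSpace Ω] {μ : Measure Ω} [IsFiniteMeasure μ]
    {f : Ω → Bool} (hf : Measurable f) : Integrable (fun ω => tval (f ω)) μ :=
  Integrable.of_bound (measurable_tval.comp hf).aestronglyMeasurable 1
    (ae_of_all _ fun ω => by
      rw [Real.norm_eq_abs, abs_of_nonneg (tval_nonneg _)]; exact tval_le_one _)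

section Full

variable {F : Measure (FullData 𝒰 𝒵)} [IsProbabilityMeasure F] {q : ℝ → 𝒰 → ℝ} {c : ℝ}

lemma comap_y0_cov_le :
    MeasurableSpace.comap (fun ω : FullData 𝒰 𝒵 => (y0 ω, cov ω)) inferInstance
      ≤ (inferInstance : MeasurableSpace (FullData 𝒰 𝒵)) :=
  (measurable_y0.prodMk measurable_cov).comap_le

/-- Tower property: `h(Y₀, X)` is measurable with respect to the conditioning `σ`-algebra, so it
comes out of the conditional mean of `T`. -/
lemma integral_tval_mul (hF : HasPropensity F q) {h : ℝ × (𝒰 × 𝒵) → ℝ} (hm : Measurable h)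
    (hi : Integrable (fun ω => h (y0 ω, cov ω)) F) :
    ∫ ω, tval (trt ω) * h (y0 ω, cov ω) ∂F = ∫ ω, q (y0 ω) (cov ω).1 * h (y0 ω, cov ω) ∂F := by
  have hle := comap_y0_cov_le (𝒰 := 𝒰) (𝒵 := 𝒵)
  have hT : Integrable (fun ω : FullData 𝒰 𝒵 => tval (trt ω)) F :=
    integrable_tval_comp measurable_trt
  have hTh : Integrable ((fun ω : FullData 𝒰 𝒵 => tval (trt ω)) * fun ω => h (y0 ω, cov ω)) F := by
    refine hi.bdd_mul (c := 1) hT.aestronglyMeasurable (ae_of_all _ fun ω => ?_)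
    rw [Real.norm_eq_abs, abs_of_nonneg (tval_nonneg _)]; exact tval_le_one _
  have hs : StronglyMeasurable[MeasurableSpace.comap (fun ω : FullData 𝒰 𝒵 => (y0 ω, cov ω))
      inferInstance] (fun ω : FullData 𝒰 𝒵 => h (y0 ω, cov ω)) :=
    (hm.comp (comap_measurable _)).stronglyMeasurable
  have h1 := condExp_mul_of_stronglyMeasurable_right hs hTh hT
  have h2 := integral_condExp (μ := F) hle
    (f := (fun ω : FullData 𝒰 𝒵 => tval (trt ω)) * fun ω => h (y0 ω, cov ω))
  rw [show ∫ ω, tval (trt ω) * h (y0 ω, cov ω) ∂F = ∫ ω, ((fun ω : FullData 𝒰 𝒵 => tval (trt ω))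
    * fun ω => h (y0 ω, cov ω)) ω ∂F from rfl, ← h2]
  refine integral_congr_ae ?_
  filter_upwards [h1, hF] with ω e1 e2
  rw [e1, Pi.mul_apply, e2]

/-- Because `1 - q ≥ c`, the law of `(Y₀, X)` is at most `c⁻¹` times its part carried by the
untreated. Integrability where `Y₀` is observed therefore extends to the whole population. -/
lemma integrable_of_untreated (hq : IsPropensity q c) (hF : HasPropensity F q)
    {h : ℝ × (𝒰 × 𝒵) → ℝ} (hm : Measurable h)
    (hi : Integrable (fun ω => (1 - tval (trt ω)) * h (y0 ω, cov ω)) F) :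
    Integrable (fun ω => h (y0 ω, cov ω)) F := by
  have hz : Measurable fun ω : FullData 𝒰 𝒵 => (y0 ω, cov ω) := measurable_y0.prodMk measurable_cov
  have h0 : MeasurableSet {ω : FullData 𝒰 𝒵 | trt ω = false} :=
    measurable_trt (measurableSet_singleton false)
  have hle : F.map (fun ω => (y0 ω, cov ω)) ≤ ENNReal.ofReal c⁻¹ •
      (F.restrict {ω | trt ω = false}).map (fun ω => (y0 ω, cov ω)) := by
    refine Measure.le_iff.2 fun s hs => ?_
    rw [Measure.smul_apply, Measure.map_apply hz hs, Measure.map_apply hz hs,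
      Measure.restrict_apply (hz hs)]
    have e1 := integral_tval_mul hF (h := s.indicator 1) (measurable_one.indicator hs)
      (Integrable.of_bound (C := 1) ((measurable_one.indicator hs).comp hz).aestronglyMeasurable
        (ae_of_all _ fun ω => by by_cases hω : (y0 ω, cov ω) ∈ s <;> simp [hω]))
    have i1 : Integrable (fun ω => s.indicator (1 : ℝ × (𝒰 × 𝒵) → ℝ) (y0 ω, cov ω)) F :=
      Integrable.of_bound (C := 1) ((measurable_one.indicator hs).comp hz).aestronglyMeasurable
        (ae_of_all _ fun ω => by by_cases hω : (y0 ω, cov ω) ∈ s <;> simp [hω])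
    have i2 : Integrable (fun ω => q (y0 ω) (cov ω).1 *
        s.indicator (1 : ℝ × (𝒰 × 𝒵) → ℝ) (y0 ω, cov ω)) F := by
      refine i1.bdd_mul (c := 1) (hq.measurable_q.comp hz).aestronglyMeasurable
        (ae_of_all _ fun ω => ?_)
      rw [Real.norm_eq_abs, abs_of_pos (hq.pos' _ _)]; exact hq.le_one _ _
    have i3 : Integrable (fun ω => tval (trt ω) *
        s.indicator (1 : ℝ × (𝒰 × 𝒵) → ℝ) (y0 ω, cov ω)) F := by
      refine i1.bdd_mul (c := 1) (measurable_tval.comp measurable_trt).aestronglyMeasurable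
        (ae_of_all _ fun ω => ?_)
      rw [Real.norm_eq_abs, abs_of_nonneg (tval_nonneg _)]; exact tval_le_one _
    have e2 : ∫ ω, s.indicator (1 : ℝ × (𝒰 × 𝒵) → ℝ) (y0 ω, cov ω) ∂F
        = F.real ((fun ω => (y0 ω, cov ω)) ⁻¹' s) := by
      rw [← integral_indicator_one (hz hs)]; rfl
    have e3 : ∫ ω, (1 - tval (trt ω)) * s.indicator (1 : ℝ × (𝒰 × 𝒵) → ℝ) (y0 ω, cov ω) ∂F
        = F.real ((fun ω => (y0 ω, cov ω)) ⁻¹' s ∩ {ω | trt ω = false}) := by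
      rw [← integral_indicator_one ((hz hs).inter h0)]
      refine integral_congr_ae (ae_of_all _ fun ω => ?_)
      by_cases hω : (y0 ω, cov ω) ∈ s <;> cases ht : trt ω <;> simp [Set.indicator, hω, ht]
    have e4 : c * F.real ((fun ω => (y0 ω, cov ω)) ⁻¹' s)
        ≤ F.real ((fun ω => (y0 ω, cov ω)) ⁻¹' s ∩ {ω | trt ω = false}) := by
      rw [← e2, ← e3, ← integral_const_mul]
      have : ∫ ω, (1 - tval (trt ω)) * s.indicator (1 : ℝ × (𝒰 × 𝒵) → ℝ) (y0 ω, cov ω) ∂F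
          = ∫ ω, (1 - q (y0 ω) (cov ω).1) * s.indicator (1 : ℝ × (𝒰 × 𝒵) → ℝ) (y0 ω, cov ω) ∂F := by
        simp only [sub_mul, one_mul]
        rw [integral_sub i1 i3, integral_sub i1 i2, e1]
      rw [this]
      refine integral_mono (i1.const_mul c) ((i1.sub i2).congr (ae_of_all _ fun _ => (by simp [sub_mul]))) fun ω => ?_
      exact mul_le_mul_of_nonneg_right (hq.one_sub_ge _ _)
        (Set.indicator_nonneg (fun _ _ => zero_le_one) _)
    have e5 : F.real ((fun ω => (y0 ω, cov ω)) ⁻¹' s)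
        ≤ c⁻¹ * F.real ((fun ω => (y0 ω, cov ω)) ⁻¹' s ∩ {ω | trt ω = false}) := by
      rw [inv_mul_eq_div, le_div_iff₀ hq.pos]; linarith
    rw [smul_eq_mul, ← ofReal_measureReal, ← ofReal_measureReal, ← ENNReal.ofReal_mul
      (inv_nonneg.2 hq.pos.le)]
    exact ENNReal.ofReal_le_ofReal e5
  have hi' : Integrable h ((F.restrict {ω | trt ω = false}).map (fun ω => (y0 ω, cov ω))) := by
    rw [integrable_map_measure hm.aestronglyMeasurable hz.aemeasurable]
    refine (hi.integrableOn (s := {ω | trt ω = false})).congr_fun (fun ω hω => ?_) h0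
    have : trt ω = false := hω
    simp [this]
  have := Integrable.of_measure_le_smul ENNReal.ofReal_ne_top hle hi'
  rwa [integrable_map_measure hm.aestronglyMeasurable hz.aemeasurable] at this

omit [IsProbabilityMeasure F] in
lemma integral_obsLaw {f : ObsData 𝒰 𝒵 → ℝ} (hf : Measurable f) :
    ∫ o, f o ∂(obsLaw F) = ∫ ω, f (obs ω) ∂F :=
  integral_map measurable_obs.aemeasurable hf.aestronglyMeasurable

omit [IsProbabilityMeasure F] in
lemma integrable_obsLaw {f : ObsData 𝒰 𝒵 → ℝ} (hf : Measurable f) :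
    Integrable f (obsLaw F) ↔ Integrable (fun ω => f (obs ω)) F :=
  integrable_map_measure hf.aestronglyMeasurable measurable_obs.aemeasurable

omit [IsProbabilityMeasure F] in
lemma integrable_mul_q (hq : IsPropensity q c) {h : ℝ × (𝒰 × 𝒵) → ℝ}
    (hi : Integrable (fun ω => h (y0 ω, cov ω)) F) :
    Integrable (fun ω => q (y0 ω) (cov ω).1 * h (y0 ω, cov ω)) F := by
  refine hi.bdd_mul (c := 1)
    (hq.measurable_q.comp (measurable_y0.prodMk measurable_cov)).aestronglyMeasurable
    (ae_of_all _ fun ω => ?_)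
  rw [Real.norm_eq_abs, abs_of_pos (hq.pos' _ _)]; exact hq.le_one _ _

omit [IsProbabilityMeasure F] in
lemma integrable_tval_mul {g : FullData 𝒰 𝒵 → ℝ} (hi : Integrable g F) :
    Integrable (fun ω => tval (trt ω) * g ω) F := by
  refine hi.bdd_mul (c := 1) (measurable_tval.comp measurable_trt).aestronglyMeasurable
    (ae_of_all _ fun ω => ?_)
  rw [Real.norm_eq_abs, abs_of_nonneg (tval_nonneg _)]; exact tval_le_one _

lemma integrable_full (hq : IsPropensity q c) (hF : HasPropensity F q)
    {h : ℝ × (𝒰 × 𝒵) → ℝ} (hm : Measurable h)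
    (hi : Integrable (fun o : ObsData 𝒰 𝒵 => (1 - tval o.1) * h o.2) (obsLaw F)) :
    Integrable (fun ω => h (y0 ω, cov ω)) F := by
  refine integrable_of_untreated hq hF hm ?_
  rw [integrable_obsLaw (by fun_prop)] at hi
  refine hi.congr (ae_of_all _ fun ω => ?_)
  exact one_sub_tval_mul_obs (fun y x => h (y, x)) ω

/-- Means of functions of `(Y₀, X)` are means of weighted untreated observations. -/
lemma integral_full (hq : IsPropensity q c) (hF : HasPropensity F q)
    {h : ℝ × (𝒰 × 𝒵) → ℝ} (hm : Measurable h)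
    (hi : Integrable (fun o : ObsData 𝒰 𝒵 => (1 - tval o.1) * h o.2) (obsLaw F)) :
    ∫ ω, h (y0 ω, cov ω) ∂F =
      ∫ o, (1 - tval o.1) * ((1 - q o.2.1 o.2.2.1)⁻¹ * h o.2) ∂(obsLaw F) := by
  have h1 := integrable_full hq hF hm hi
  have hmi := hq.measurable_inv (𝒵 := 𝒵)
  have hz : Measurable fun ω : FullData 𝒰 𝒵 => (y0 ω, cov ω) := measurable_y0.prodMk measurable_cov
  have h2 : Integrable (fun ω => (1 - q (y0 ω) (cov ω).1)⁻¹ * h (y0 ω, cov ω)) F :=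
    h1.bdd_mul (c := c⁻¹) (hmi.comp hz).aestronglyMeasurable
      (ae_of_all _ fun ω => hq.abs_inv_le _ _)
  have hmk : Measurable fun z : ℝ × (𝒰 × 𝒵) => (1 - q z.1 z.2.1)⁻¹ * h z := hmi.mul hm
  have h3 := integral_tval_mul hF hmk h2
  have hmq : Measurable fun o : ObsData 𝒰 𝒵 =>
      (1 - tval o.1) * ((1 - q o.2.1 o.2.2.1)⁻¹ * h o.2) :=
    (by fun_prop : Measurable fun o : ObsData 𝒰 𝒵 => 1 - tval o.1).mul (hmk.comp measurable_snd)
  rw [integral_obsLaw hmq]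
  have h4 : ∀ ω : FullData 𝒰 𝒵, (1 - tval (obs ω).1) * ((1 - q (obs ω).2.1 (obs ω).2.2.1)⁻¹ *
      h (obs ω).2) = (1 - q (y0 ω) (cov ω).1)⁻¹ * h (y0 ω, cov ω)
        - tval (trt ω) * ((1 - q (y0 ω) (cov ω).1)⁻¹ * h (y0 ω, cov ω)) := fun ω => by
    have := one_sub_tval_mul_obs (fun y x => (1 - q y x.1)⁻¹ * h (y, x)) ω
    rw [show h (obs ω).2 = h ((obs ω).2.1, (obs ω).2.2) from rfl, this]; ring
  simp_rw [h4]
  -- With `g = h / (1 - q)`, the untreated mean is `E(g) - E(T g) = E{(1 - q) g}`, and this is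
  -- `E(h)`.
  rw [integral_sub h2 (integrable_tval_mul h2), h3,
    ← integral_sub h2 (integrable_mul_q (h := fun z => (1 - q z.1 z.2.1)⁻¹ * h z) hq h2)]
  refine integral_congr_ae (ae_of_all _ fun ω => ?_)
  have := hq.one_sub_ne (y0 ω) (cov ω).1
  simp only
  field_simp

/-- The mean of `Y₀`-functions over the treated is not observed, but it equals `E(q h)`. Inverse
weighting with `q h` in place of `h` produces the odds. -/
lemma integral_tval_mul_full (hq : IsPropensity q c) (hF : HasPropensity F q)
    {h : ℝ × (𝒰 × 𝒵) → ℝ} (hm : Measurable h)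
    (hi : Integrable (fun o : ObsData 𝒰 𝒵 => (1 - tval o.1) * h o.2) (obsLaw F)) :
    ∫ ω, tval (trt ω) * h (y0 ω, cov ω) ∂F =
      ∫ o, (1 - tval o.1) * (odds q o.2.1 o.2.2.1 * h o.2) ∂(obsLaw F) := by
  rw [integral_tval_mul hF hm (integrable_full hq hF hm hi)]
  have hmq := hq.measurable_q (𝒵 := 𝒵)
  have := integral_full hq hF (h := fun z => q z.1 z.2.1 * h z) (hmq.mul hm) ?_
  · simp only at this
    rw [this]
    refine integral_congr_ae (ae_of_all _ fun o => ?_)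
    simp only [odds]; ring
  · have := hi.bdd_mul (c := 1) (f := fun o : ObsData 𝒰 𝒵 => q o.2.1 o.2.2.1)
      (hmq.comp measurable_snd).aestronglyMeasurable
      (ae_of_all _ fun o => by
        rw [Real.norm_eq_abs, abs_of_pos (hq.pos' _ _)]; exact hq.le_one _ _)
    refine this.congr (ae_of_all _ fun o => ?_)
    simp only; ring

/-- The residual has conditional mean zero given the covariates. -/
lemma integral_resid_mul_indicator (hq : IsPropensity q c) (hF : HasPropensity F q)
    {s : Set (𝒰 × 𝒵)} (hs : MeasurableSet s) :
    ∫ o in (fun o : ObsData 𝒰 𝒵 => o.2.2) ⁻¹' s, resid q o ∂(obsLaw F) = 0 := by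
  have hx : Measurable fun o : ObsData 𝒰 𝒵 => o.2.2 := by fun_prop
  have hind : Measurable fun z : ℝ × (𝒰 × 𝒵) => s.indicator (1 : 𝒰 × 𝒵 → ℝ) z.2 :=
    (measurable_one.indicator hs).comp measurable_snd
  have hb : ∀ x, ‖s.indicator (1 : 𝒰 × 𝒵 → ℝ) x‖ ≤ 1 := fun x => by
    by_cases hx : x ∈ s <;> simp [hx]
  have i0 : Integrable (fun o : ObsData 𝒰 𝒵 => s.indicator (1 : 𝒰 × 𝒵 → ℝ) o.2.2) (obsLaw F) :=
    Integrable.of_bound (hind.comp measurable_snd).aestronglyMeasurable 1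
      (ae_of_all _ fun o => hb _)
  have i1 : Integrable (fun o : ObsData 𝒰 𝒵 => tval o.1 * s.indicator (1 : 𝒰 × 𝒵 → ℝ) o.2.2)
      (obsLaw F) :=
    i0.bdd_mul (c := 1) (by fun_prop : Measurable fun o : ObsData 𝒰 𝒵 =>
      tval o.1).aestronglyMeasurable (ae_of_all _ fun o => by
        rw [Real.norm_eq_abs, abs_of_nonneg (tval_nonneg _)]; exact tval_le_one _)
  have i2 : Integrable (fun o : ObsData 𝒰 𝒵 => (1 - tval o.1) *
      s.indicator (1 : 𝒰 × 𝒵 → ℝ) o.2.2) (obsLaw F) := by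
    exact (i0.sub i1).congr (ae_of_all _ fun _ => by simp [sub_mul])
  have i3 : Integrable (fun o : ObsData 𝒰 𝒵 => (1 - tval o.1) * (odds q o.2.1 o.2.2.1 *
      s.indicator (1 : 𝒰 × 𝒵 → ℝ) o.2.2)) (obsLaw F) := by
    refine (i2.bdd_mul (c := c⁻¹) (f := fun o : ObsData 𝒰 𝒵 => odds q o.2.1 o.2.2.1)
      (hq.measurable_odds.comp measurable_snd).aestronglyMeasurable
      (ae_of_all _ fun o => hq.abs_odds_le _ _)).congr (ae_of_all _ fun o => ?_)
    simp only; ring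
  have e := integral_tval_mul_full hq hF hind i2
  have e1 : ∫ o, tval o.1 * s.indicator (1 : 𝒰 × 𝒵 → ℝ) o.2.2 ∂(obsLaw F) =
      ∫ ω, tval (trt ω) * s.indicator (1 : 𝒰 × 𝒵 → ℝ) (cov ω) ∂F :=
    integral_obsLaw ((measurable_tval.comp measurable_fst).mul (hind.comp measurable_snd))
  rw [← integral_indicator (hx hs)]
  have : ∀ o : ObsData 𝒰 𝒵, ((fun o : ObsData 𝒰 𝒵 => o.2.2) ⁻¹' s).indicator (resid q) o
      = tval o.1 * s.indicator (1 : 𝒰 × 𝒵 → ℝ) o.2.2 - (1 - tval o.1) * (odds q o.2.1 o.2.2.1 *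
      s.indicator (1 : 𝒰 × 𝒵 → ℝ) o.2.2) := fun o => by
    by_cases ho : o.2.2 ∈ s
    · simp [ho, hq.resid_eq]
    · simp [ho]
  simp_rw [this]
  rw [integral_sub i1 i3, e1, e, sub_self]

/-- In `E(T Y₁) - E(T Y₀)` the first term is observed and the second is the odds-weighted mean over
the untreated. Together they form `E(ρ Y)`, so the estimand depends on the full data only through
the observed law and the propensity. -/
lemma integral_resid_mul_outcome (hq : IsPropensity q c) (hF : HasPropensity F q)
    (hY : Integrable (fun o : ObsData 𝒰 𝒵 => o.2.1) (obsLaw F)) :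
    att F = (∫ o, resid q o * o.2.1 ∂(obsLaw F)) / ∫ o, tval o.1 ∂(obsLaw F) := by
  have h1 : MeasurableSet {ω : FullData 𝒰 𝒵 | trt ω = true} :=
    measurable_trt (measurableSet_singleton true)
  have i1 : Integrable (fun o : ObsData 𝒰 𝒵 => tval o.1 * o.2.1) (obsLaw F) :=
    hY.bdd_mul (c := 1) (by fun_prop : Measurable fun o : ObsData 𝒰 𝒵 =>
      tval o.1).aestronglyMeasurable (ae_of_all _ fun o => by
        rw [Real.norm_eq_abs, abs_of_nonneg (tval_nonneg _)]; exact tval_le_one _)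
  have i2 : Integrable (fun o : ObsData 𝒰 𝒵 => (1 - tval o.1) * o.2.1) (obsLaw F) := by
    exact (hY.sub i1).congr (ae_of_all _ fun _ => by simp [sub_mul])
  have i3 : Integrable (fun o : ObsData 𝒰 𝒵 => (1 - tval o.1) * (odds q o.2.1 o.2.2.1 * o.2.1))
      (obsLaw F) := by
    refine (i2.bdd_mul (c := c⁻¹) (f := fun o : ObsData 𝒰 𝒵 => odds q o.2.1 o.2.2.1)
      (hq.measurable_odds.comp measurable_snd).aestronglyMeasurable
      (ae_of_all _ fun o => hq.abs_odds_le _ _)).congr (ae_of_all _ fun o => ?_)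
    simp only; ring
  have e := integral_tval_mul_full hq hF (h := fun z => z.1) measurable_fst i2
  have i0 := integrable_full hq hF (h := fun z => z.1) measurable_fst i2
  simp only at e i0
  have m1 : Measurable fun o : ObsData 𝒰 𝒵 => tval o.1 * o.2.1 := by fun_prop
  have i4 : Integrable (fun ω => tval (trt ω) * y1 ω) F := by
    rw [integrable_obsLaw m1] at i1
    exact i1.congr (ae_of_all _ fun ω => tval_mul_obs ω)
  have e1 : ∫ o, tval o.1 * o.2.1 ∂(obsLaw F) = ∫ ω, tval (trt ω) * y1 ω ∂F := by
    rw [integral_obsLaw m1]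
    exact integral_congr_ae (ae_of_all _ fun ω => tval_mul_obs ω)
  have e2 : ∫ o, tval o.1 ∂(obsLaw F) = F.real {ω | trt ω = true} := by
    rw [integral_obsLaw (by fun_prop), ← integral_indicator_one h1]
    refine integral_congr_ae (ae_of_all _ fun ω => ?_)
    cases ht : trt ω <;> simp [ht, Set.indicator]
  have e3 : ∫ o, resid q o * o.2.1 ∂(obsLaw F) = ∫ ω, tval (trt ω) * y1 ω ∂F
      - ∫ ω, tval (trt ω) * y0 ω ∂F := by
    rw [← e1, e, ← integral_sub i1 i3]
    refine integral_congr_ae (ae_of_all _ fun o => ?_)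
    simp only [hq.resid_eq]; ring
  rw [e2, e3, ← integral_sub i4 (integrable_tval_mul i0), att, ProbabilityTheory.cond,
    integral_smul_measure, ENNReal.toReal_inv, ← measureReal_def, smul_eq_mul, inv_mul_eq_div,
    ← integral_indicator h1]
  congr 1
  refine integral_congr_ae (ae_of_all _ fun ω => ?_)
  cases ht : trt ω <;> simp [ht, Set.indicator]

end Full

end Observed

/-! ### Every observed law satisfying the moment restriction comes from full data -/

section Realization

variable {𝒰 𝒵 : Type*} [MeasurableSpace 𝒰] [MeasurableSpace 𝒵]

/-- The full data with observed part `o` and unobserved potential outcome `h`. -/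
def complete (o : ObsData 𝒰 𝒵) (h : ℝ) : FullData 𝒰 𝒵 :=
  (o.1, if o.1 = true then h else o.2.1, if o.1 = true then o.2.1 else h, o.2.2)

omit [MeasurableSpace 𝒰] [MeasurableSpace 𝒵] in
lemma obs_complete (o : ObsData 𝒰 𝒵) (h : ℝ) : obs (complete o h) = o := by
  rcases o with ⟨t, y, x⟩
  cases t <;> simp [obs, complete, trt, y0, y1, cov]

lemma measurable_complete :
    Measurable fun a : ObsData 𝒰 𝒵 × ℝ => complete a.1 a.2 := by
  have ht : MeasurableSet {a : ObsData 𝒰 𝒵 × ℝ | a.1.1 = true} :=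
    (measurable_fst.comp measurable_fst) (measurableSet_singleton true)
  unfold complete
  refine Measurable.prodMk (by fun_prop) (Measurable.prodMk ?_ (Measurable.prodMk ?_ (by fun_prop)))
  · exact Measurable.ite ht (by fun_prop) (by fun_prop)
  · exact Measurable.ite ht (by fun_prop) (by fun_prop)

lemma integrable_resid {q : ℝ → 𝒰 → ℝ} {c : ℝ} (hq : IsPropensity q c)
    (P : Measure (ObsData 𝒰 𝒵)) [IsFiniteMeasure P] : Integrable (resid q) P :=
  Integrable.of_bound hq.measurable_resid.aestronglyMeasurable c⁻¹
    (ae_of_all _ fun o => hq.abs_resid_le o)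

/-- Every law of observed data whose residual has conditional mean zero given the covariates comes
from a law of full data with the prescribed propensity. -/
lemma exists_full_law {q : ℝ → 𝒰 → ℝ} {c : ℝ} (hq : IsPropensity q c)
    (P : Measure (ObsData 𝒰 𝒵)) [IsProbabilityMeasure P]
    (h0 : ∀ s : Set (𝒰 × 𝒵), MeasurableSet s →
      ∫ o in (fun o : ObsData 𝒰 𝒵 => o.2.2) ⁻¹' s, resid q o ∂P = 0) :
    ∃ F : Measure (FullData 𝒰 𝒵), IsProbabilityMeasure F ∧ HasPropensity F q ∧ obsLaw F = P := by
  have hx : Measurable fun o : ObsData 𝒰 𝒵 => o.2.2 := by fun_prop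
  have hz : Measurable fun o : ObsData 𝒰 𝒵 => (o.2.2, o.2.1) := by fun_prop
  have hA : ∀ b : Bool, MeasurableSet {o : ObsData 𝒰 𝒵 | o.1 = b} := fun b =>
    measurable_fst (measurableSet_singleton b)
  set μ₀ : Measure ((𝒰 × 𝒵) × ℝ) := (P.restrict {o | o.1 = false}).map fun o => (o.2.2, o.2.1)
    with hμ₀
  have hod : Measurable fun z : (𝒰 × 𝒵) × ℝ => odds q z.2 z.1.1 :=
    hq.measurable_odds.comp measurable_swap
  have hoi : Integrable (fun z : (𝒰 × 𝒵) × ℝ => odds q z.2 z.1.1) μ₀ :=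
    Integrable.of_bound hod.aestronglyMeasurable c⁻¹ (ae_of_all _ fun z => hq.abs_odds_le _ _)
  -- `ν` is the intended joint law of `(X, Y₀)` on the treated: by Bayes' rule, the odds times the
  -- law `μ₀` of `(X, Y₀)` on the untreated.
  set ν : Measure ((𝒰 × 𝒵) × ℝ) := μ₀.withDensity fun z => ENNReal.ofReal (odds q z.2 z.1.1) with hν
  have hνreal : ∀ r, MeasurableSet r → ν r = ENNReal.ofReal (∫ z in r, odds q z.2 z.1.1 ∂μ₀) := by
    intro r hr
    rw [hν, withDensity_apply _ hr, ofReal_integral_eq_lintegral_ofReal hoi.integrableOn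
      (ae_of_all _ fun z => (hq.odds_pos _ _).le)]
  have : IsFiniteMeasure ν := ⟨by rw [hνreal _ MeasurableSet.univ]; exact ENNReal.ofReal_lt_top⟩
  -- The moment restriction is exactly the statement that `ν` has the covariate marginal of the
  -- treated, so conditionals of `ν` can be attached to treated units.
  have hfst : ν.fst = (P.restrict {o | o.1 = true}).map fun o => o.2.2 := by
    ext s hs
    rw [Measure.fst_apply hs, hνreal _ (measurable_fst hs), Measure.map_apply hx hs,
      Measure.restrict_apply (hx hs), hμ₀, setIntegral_map (measurable_fst hs)
        hod.aestronglyMeasurable hz.aemeasurable, Measure.restrict_restrict (hz (measurable_fst hs)),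
      ← ofReal_measureReal]
    congr 1
    have h1 := h0 s hs
    rw [← integral_inter_add_sdiff (t := {o | o.1 = true}) (hA true)
      (integrable_resid hq P).integrableOn] at h1
    have e1 : ∫ o in (fun o : ObsData 𝒰 𝒵 => o.2.2) ⁻¹' s ∩ {o | o.1 = true}, resid q o ∂P
        = P.real ((fun o : ObsData 𝒰 𝒵 => o.2.2) ⁻¹' s ∩ {o | o.1 = true}) := by
      rw [setIntegral_congr_fun (g := fun _ => (1 : ℝ)) ((hx hs).inter (hA true))]
      · simp
      · rintro o ⟨_, ho⟩
        have ho : o.1 = true := ho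
        simp [hq.resid_eq, ho]
    have e2 : (fun o : ObsData 𝒰 𝒵 => o.2.2) ⁻¹' s \ {o | o.1 = true} =
        (fun o : ObsData 𝒰 𝒵 => (o.2.2, o.2.1)) ⁻¹' (Prod.fst ⁻¹' s) ∩ {o | o.1 = false} := by
      ext o; simp
    rw [e1, e2] at h1
    have e3 : ∫ o in (fun o : ObsData 𝒰 𝒵 => (o.2.2, o.2.1)) ⁻¹' (Prod.fst ⁻¹' s) ∩
        {o | o.1 = false}, resid q o ∂P = - ∫ o in (fun o : ObsData 𝒰 𝒵 => (o.2.2, o.2.1)) ⁻¹'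
          (Prod.fst ⁻¹' s) ∩ {o | o.1 = false}, odds q o.2.1 o.2.2.1 ∂P := by
      rw [← integral_neg]
      refine setIntegral_congr_fun ((hz (measurable_fst hs)).inter (hA false)) ?_
      rintro o ⟨_, ho⟩
      have ho : o.1 = false := ho
      simp [hq.resid_eq, ho]
    rw [e3] at h1
    linarith
  -- The unobserved outcome is drawn from the conditional law of `ν` given `X`. For the untreated
  -- the same kernel fills in `Y₁`, an arbitrary choice since the model leaves that law free.
  set K : Kernel (ObsData 𝒰 𝒵) ℝ := ν.condKernel.comap (fun o => o.2.2) hx with hK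
  set F : Measure (FullData 𝒰 𝒵) := (P ⊗ₘ K).map fun a => complete a.1 a.2 with hF
  have hg := measurable_complete (𝒰 := 𝒰) (𝒵 := 𝒵)
  have : IsProbabilityMeasure F := Measure.isProbabilityMeasure_map hg.aemeasurable
  have hobs : obsLaw F = P := by
    rw [obsLaw, hF, Measure.map_map measurable_obs hg]
    have : obs ∘ (fun a : ObsData 𝒰 𝒵 × ℝ => complete a.1 a.2) = Prod.fst := by
      ext1 a; exact obs_complete a.1 a.2
    rw [this, ← Measure.fst, Measure.fst_compProd]
  have hZ : Measurable fun ω : FullData 𝒰 𝒵 => (cov ω, y0 ω) := by fun_prop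
  have hS : ∀ b : Bool, MeasurableSet {ω : FullData 𝒰 𝒵 | trt ω = b} := fun b =>
    measurable_trt (measurableSet_singleton b)
  have h1 : ∀ r, MeasurableSet r → F ((fun ω => (cov ω, y0 ω)) ⁻¹' r ∩ {ω | trt ω = true}) = ν r := by
    intro r hr
    rw [hF, Measure.map_apply hg ((hZ hr).inter (hS true)), Measure.compProd_apply
      (hg ((hZ hr).inter (hS true)))]
    conv_rhs => rw [← ν.disintegrate ν.condKernel, Measure.compProd_apply hr, hfst,
      lintegral_map (Kernel.measurable_kernel_prodMk_left hr) hx, ← lintegral_indicator (hA true)]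
    refine lintegral_congr fun o => ?_
    by_cases ho : o.1 = true
    · rw [Set.indicator_of_mem (by exact ho), hK, Kernel.comap_apply]
      congr 1
      ext h
      simp [complete, cov, y0, trt, ho]
    · rw [Set.indicator_of_notMem (by exact ho)]
      convert measure_empty (μ := K o)
      ext h
      simp [complete, trt, ho]
  have h2 : ∀ r, MeasurableSet r →
      F ((fun ω => (cov ω, y0 ω)) ⁻¹' r ∩ {ω | trt ω = false}) = μ₀ r := by
    intro r hr
    rw [hμ₀, Measure.map_apply hz hr, Measure.restrict_apply (hz hr), hF,
      Measure.map_apply hg ((hZ hr).inter (hS false))]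
    conv_rhs => rw [← Measure.fst_compProd P K, Measure.fst_apply ((hz hr).inter (hA false))]
    congr 1
    ext ⟨o, h⟩
    simp only [Set.mem_preimage, Set.mem_inter_iff, Set.mem_ofPred_eq, complete, cov, y0, trt]
    constructor
    · rintro ⟨ha, hb⟩; exact ⟨by simpa [hb] using ha, hb⟩
    · rintro ⟨ha, hb⟩; exact ⟨by simpa [hb] using ha, hb⟩
  have hsplit : F.map (fun ω => (cov ω, y0 ω)) = μ₀ + ν := by
    ext r hr
    rw [Measure.map_apply hZ hr, Measure.add_apply, ← h1 r hr, ← h2 r hr, add_comm,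
      ← measure_inter_add_sdiff _ (hS true)]
    congr 2
    ext ω; simp
  refine ⟨F, inferInstance, ?_, hobs⟩
  have hz' : Measurable fun ω : FullData 𝒰 𝒵 => (y0 ω, cov ω) := by fun_prop
  have hqm : Measurable fun z : (𝒰 × 𝒵) × ℝ => q z.2 z.1.1 := hq.measurable_q.comp measurable_swap
  have hqi : ∀ (m : Measure ((𝒰 × 𝒵) × ℝ)) [IsFiniteMeasure m],
      Integrable (fun z : (𝒰 × 𝒵) × ℝ => q z.2 z.1.1) m := fun m _ =>
    Integrable.of_bound hqm.aestronglyMeasurable 1 (ae_of_all _ fun z => by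
      rw [Real.norm_eq_abs, abs_of_pos (hq.pos' _ _)]; exact hq.le_one _ _)
  have hqF : Integrable (fun ω => q (y0 ω) (cov ω).1) F :=
    (integrable_map_measure hqm.aestronglyMeasurable hZ.aemeasurable).1
      (hqi (F.map fun ω => (cov ω, y0 ω)))
  refine (ae_eq_condExp_of_forall_setIntegral_eq comap_y0_cov_le
    (integrable_tval_comp measurable_trt) (fun s _ _ => hqF.integrableOn) ?_ ?_).symm
  · rintro s ⟨r, hr, rfl⟩ -
    have hr' : MeasurableSet (Prod.swap ⁻¹' r : Set ((𝒰 × 𝒵) × ℝ)) := measurable_swap hr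
    have e1 : ∫ ω in (fun ω : FullData 𝒰 𝒵 => (y0 ω, cov ω)) ⁻¹' r, tval (trt ω) ∂F
        = ν.real (Prod.swap ⁻¹' r) := by
      rw [measureReal_def, ← h1 _ hr', ← measureReal_def, ← integral_indicator_one
        ((hZ hr').inter (hS true)), ← integral_indicator (hz' hr)]
      refine integral_congr_ae (ae_of_all _ fun ω => ?_)
      by_cases h : (y0 ω, cov ω) ∈ r <;> cases ht : trt ω <;> simp [Set.indicator, h, ht]
    have e2 : ∫ ω in (fun ω : FullData 𝒰 𝒵 => (y0 ω, cov ω)) ⁻¹' r, q (y0 ω) (cov ω).1 ∂F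
        = ∫ z in Prod.swap ⁻¹' r, q z.2 z.1.1 ∂(F.map fun ω => (cov ω, y0 ω)) := by
      rw [setIntegral_map hr' hqm.aestronglyMeasurable hZ.aemeasurable]; rfl
    have e3 : ∫ z in Prod.swap ⁻¹' r, q z.2 z.1.1 ∂ν
        = ∫ z in Prod.swap ⁻¹' r, odds q z.2 z.1.1 * q z.2 z.1.1 ∂μ₀ := by
      rw [hν, restrict_withDensity hr', integral_withDensity_eq_integral_toReal_smul
        hod.ennreal_ofReal (ae_of_all _ fun _ => ENNReal.ofReal_lt_top)]
      refine integral_congr_ae (ae_of_all _ fun z => ?_)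
      simp only [smul_eq_mul]
      rw [ENNReal.toReal_ofReal (hq.odds_pos _ _).le]
    have i1 : Integrable (fun z : (𝒰 × 𝒵) × ℝ => odds q z.2 z.1.1 * q z.2 z.1.1) μ₀ :=
      (hqi μ₀).bdd_mul (c := c⁻¹) hod.aestronglyMeasurable (ae_of_all _ fun z => hq.abs_odds_le _ _)
    -- Since `(X, Y₀)` has law `μ₀ + ν` and `ν` has density `q / (1 - q)` with respect to `μ₀`, the
    -- claim reduces to `q + q · q / (1 - q) = q / (1 - q)` under `μ₀`.
    rw [e1, e2, hsplit, Measure.restrict_add, integral_add_measure (hqi μ₀).integrableOn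
      (hqi ν).integrableOn, e3, ← integral_add (hqi μ₀).integrableOn i1.integrableOn, measureReal_def,
      hνreal _ hr', ENNReal.toReal_ofReal (integral_nonneg fun z => (hq.odds_pos _ _).le)]
    refine integral_congr_ae (ae_of_all _ fun z => ?_)
    have := hq.one_sub_ne z.2 z.1.1
    simp only [odds]
    field_simp
    ring
  · exact ((hq.measurable_q.comp (comap_measurable _)).stronglyMeasurable).aestronglyMeasurable

end Realization

/-! ### Square-integrable functions and root densities -/

section MeanSquare

variable {Ω : Type*} [MeasurableSpace Ω]

lemma integrable_mul_of_memLp {μ : Measure Ω} {f g : Ω → ℝ} (hf : MemLp f 2 μ) (hg : MemLp g 2 μ) :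
    Integrable (fun o => f o * g o) μ := hf.integrable_mul hg

lemma abs_integral_mul_le_sqrt {μ : Measure Ω} {f g : Ω → ℝ} (hf : MemLp f 2 μ) (hg : MemLp g 2 μ) :
    |∫ o, f o * g o ∂μ| ≤ √(∫ o, f o ^ 2 ∂μ) * √(∫ o, g o ^ 2 ∂μ) := by
  have key : ∀ {f g : Ω → ℝ} (hf : MemLp f 2 μ) (hg : MemLp g 2 μ),
      inner ℝ (hf.toLp f) (hg.toLp g) = ∫ o, f o * g o ∂μ := fun {f g} hf hg => by
    rw [L2.inner_def]
    refine integral_congr_ae ?_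
    filter_upwards [hf.coeFn_toLp, hg.coeFn_toLp] with o h1 h2
    simp [h1, h2, mul_comm]
  have nrm : ∀ {f : Ω → ℝ} (hf : MemLp f 2 μ), ‖hf.toLp f‖ = √(∫ o, f o ^ 2 ∂μ) := fun {f} hf => by
    rw [← Real.sqrt_sq (norm_nonneg (hf.toLp f)), ← real_inner_self_eq_norm_sq, key]
    simp_rw [sq]
  rw [← key hf hg, ← nrm hf, ← nrm hg]
  exact abs_real_inner_le_norm _ _

lemma tendsto_integral_sq_of_tendsto_eLpNorm {ι : Type*} {l : Filter ι} {μ : Measure Ω}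
    {f : ι → Ω → ℝ} (hm : ∀ᶠ i in l, AEStronglyMeasurable (f i) μ)
    (h : Tendsto (fun i => eLpNorm (f i) 2 μ) l (𝓝 0)) :
    Tendsto (fun i => ∫ o, f i o ^ 2 ∂μ) l (𝓝 0) := by
  have h1 : Tendsto (fun i => (eLpNorm (f i) 2 μ ^ 2).toReal) l (𝓝 0) := by
    have := (ENNReal.tendsto_toReal ENNReal.zero_ne_top).comp h
    have := this.pow 2
    simpa [Function.comp_def, ENNReal.toReal_pow] using this
  refine squeeze_zero' (Eventually.of_forall fun i => integral_nonneg fun o => sq_nonneg _) ?_ h1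
  filter_upwards [hm] with i hm
  by_cases hi : MemLp (f i) 2 μ
  · have e : eLpNorm (f i) 2 μ ^ 2 = ∫⁻ o, ENNReal.ofReal (f i o ^ 2) ∂μ := by
      rw [eLpNorm_eq_lintegral_rpow_enorm_toReal (by norm_num) (by norm_num)]
      simp only [ENNReal.toReal_ofNat, ENNReal.rpow_ofNat, one_div]
      rw [← ENNReal.rpow_natCast, ← ENNReal.rpow_mul]
      norm_num
      refine lintegral_congr fun o => ?_
      rw [← sq_abs, ENNReal.ofReal_pow (abs_nonneg _), ← Real.enorm_eq_ofReal_abs]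
    rw [e, integral_eq_lintegral_of_nonneg_ae (ae_of_all _ fun o => sq_nonneg _)
      (hi.1.pow 2)]
  -- Outside `L²` the integral of the square takes its default value zero.
  · rw [integral_undef (fun hc => hi ((memLp_two_iff_integrable_sq hm).2 hc))]
    exact ENNReal.toReal_nonneg

/-- The root density. -/
noncomputable def rootDensity (P ν : Measure Ω) (o : Ω) : ℝ := √(P.rnDeriv ν o).toReal

section Root

variable {P ν : Measure Ω} [IsProbabilityMeasure P] [SigmaFinite ν]

omit [IsProbabilityMeasure P] [SigmaFinite ν] in
lemma measurable_rootDensity : Measurable (rootDensity P ν) :=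
  (Measure.measurable_rnDeriv P ν).ennreal_toReal.sqrt

omit [IsProbabilityMeasure P] [SigmaFinite ν] in
lemma rootDensity_sq (o : Ω) : rootDensity P ν o ^ 2 = (P.rnDeriv ν o).toReal :=
  Real.sq_sqrt ENNReal.toReal_nonneg

lemma memLp_mul_rootDensity (h : P ≪ ν) {f : Ω → ℝ} (hm : Measurable f) (hf : MemLp f 2 P) :
    MemLp (fun o => f o * rootDensity P ν o) 2 ν := by
  refine (memLp_two_iff_integrable_sq (hm.mul measurable_rootDensity).aestronglyMeasurable).2 ?_
  have := (integrable_rnDeriv_smul_iff h).2 hf.integrable_sq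
  refine this.congr (ae_of_all _ fun o => ?_)
  simp only [smul_eq_mul, ← rootDensity_sq, Pi.mul_apply]; ring

lemma integral_mul_rootDensity_sq (h : P ≪ ν) {f : Ω → ℝ} :
    ∫ o, (f o * rootDensity P ν o) ^ 2 ∂ν = ∫ o, f o ^ 2 ∂P := by
  rw [← integral_rnDeriv_smul h]
  refine integral_congr_ae (ae_of_all _ fun o => ?_)
  simp only [smul_eq_mul, mul_pow, rootDensity_sq]; ring

lemma integral_eq_rootDensity (h : P ≪ ν) (f : Ω → ℝ) :
    ∫ o, f o ∂P = ∫ o, rootDensity P ν o * (f o * rootDensity P ν o) ∂ν := by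
  rw [← integral_rnDeriv_smul h]
  refine integral_congr_ae (ae_of_all _ fun o => ?_)
  simp only [smul_eq_mul, ← rootDensity_sq]; ring

lemma memLp_rootDensity (h : P ≪ ν) : MemLp (rootDensity P ν) 2 ν := by
  simpa using memLp_mul_rootDensity h (f := fun _ => 1) measurable_const (memLp_const 1)

end Root

end MeanSquare

/-! ### Differentiating means along paths differentiable in quadratic mean -/

section Score

/-- `f` has second moments that are locally bounded along the path `P`. -/
def LocBddSq {Ω : Type*} [MeasurableSpace Ω] (P : ℝ → Measure Ω) (f : Ω → ℝ) : Prop :=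
  ∃ C : ℝ, ∀ᶠ s in 𝓝 (0 : ℝ), MemLp f 2 (P s) ∧ ∫ o, f o ^ 2 ∂(P s) ≤ C

variable {𝒰 𝒵 : Type*} [MeasurableSpace 𝒰] [MeasurableSpace 𝒵]
  {P : ℝ → Measure (ObsData 𝒰 𝒵)} {S : ObsData 𝒰 𝒵 → ℝ}

/-- A version of differentiability in quadratic mean with integrals of squares and a measurable
score. -/
lemma HasScore.exists_root (h : HasScore P S) (hP : ∀ᶠ s in 𝓝 (0 : ℝ), IsProbabilityMeasure (P s))
    (hS : MemLp S 2 (P 0)) :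
    ∃ (ν : Measure (ObsData 𝒰 𝒵)) (G : ObsData 𝒰 𝒵 → ℝ), SigmaFinite ν ∧
      (∀ᶠ s in 𝓝 (0 : ℝ), P s ≪ ν) ∧ Measurable G ∧ MemLp G 2 ν ∧
      (∀ f : ObsData 𝒰 𝒵 → ℝ, 2 * ∫ o, G o * (f o * rootDensity (P 0) ν o) ∂ν =
        ∫ o, f o * S o ∂(P 0)) ∧
      Tendsto (fun s : ℝ => ∫ o, ((rootDensity (P s) ν o - rootDensity (P 0) ν o) / s
        - G o) ^ 2 ∂ν) (𝓝[≠] 0) (𝓝 0) ∧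
      Tendsto (fun s : ℝ => ∫ o, (rootDensity (P s) ν o - rootDensity (P 0) ν o) ^ 2 ∂ν)
        (𝓝[≠] 0) (𝓝 0) := by
  obtain ⟨ν, hν, hac, ht⟩ := h
  have := hP.self_of_nhds
  have hac0 := hac.self_of_nhds
  set S' := hS.1.mk S with hS'
  have hSm : Measurable S' := hS.1.stronglyMeasurable_mk.measurable
  have hS2 : MemLp S' 2 (P 0) := hS.ae_eq hS.1.ae_eq_mk
  have hG : MemLp (fun o => S' o * rootDensity (P 0) ν o) 2 ν :=
    memLp_mul_rootDensity hac0 hSm hS2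
  -- The two versions of the score agree only almost everywhere under `P 0`. The root density
  -- vanishes where `P 0` puts no mass, so the products agree `ν`-almost everywhere.
  have hSS : ∀ᵐ o ∂ν, S o * rootDensity (P 0) ν o = S' o * rootDensity (P 0) ν o := by
    have h1 : ∀ᵐ o ∂(P 0), S o = S' o := hS.1.ae_eq_mk
    rw [← Measure.withDensity_rnDeriv_eq _ _ hac0] at h1
    have h1 := (ae_withDensity_iff (Measure.measurable_rnDeriv _ _)).1 h1
    filter_upwards [h1] with o ho
    by_cases h0 : (P 0).rnDeriv ν o = 0
    · simp [rootDensity, h0]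
    · rw [ho h0]
  have hGm : Measurable fun o => S' o * rootDensity (P 0) ν o / 2 :=
    (hSm.mul measurable_rootDensity).div_const 2
  have hG' : MemLp (fun o => S' o * rootDensity (P 0) ν o / 2) 2 ν := by
    simpa [div_eq_inv_mul] using hG.const_mul (2⁻¹ : ℝ)
  have hlim : Tendsto (fun s : ℝ => ∫ o, ((rootDensity (P s) ν o - rootDensity (P 0) ν o) / s
        - S' o * rootDensity (P 0) ν o / 2) ^ 2 ∂ν) (𝓝[≠] 0) (𝓝 0) := by
    refine tendsto_integral_sq_of_tendsto_eLpNorm (Eventually.of_forall fun s =>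
      (((measurable_rootDensity.sub measurable_rootDensity).div_const s).sub
        hGm).aestronglyMeasurable) (ht.congr fun s => ?_)
    refine eLpNorm_congr_ae ?_
    filter_upwards [hSS] with o ho
    rw [← ho]; rfl
  refine ⟨ν, fun o => S' o * rootDensity (P 0) ν o / 2, hν, hac, hGm, hG', ?_, hlim, ?_⟩
  · intro f
    rw [← integral_const_mul, show ∫ o, f o * S o ∂(P 0) = ∫ o, f o * S' o ∂(P 0) from
      integral_congr_ae (by filter_upwards [hS.1.ae_eq_mk] with o ho; rw [ho]),
      integral_eq_rootDensity hac0]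
    exact integral_congr_ae (ae_of_all _ fun o => by ring)
  · set G : ObsData 𝒰 𝒵 → ℝ := fun o => S' o * rootDensity (P 0) ν o / 2 with hGdef
    have hs0 : Tendsto (fun s : ℝ => s) (𝓝[≠] 0) (𝓝 0) := tendsto_nhdsWithin_of_tendsto_nhds
      tendsto_id
    -- The increment of the root density is `s` times `(quotient - G) + G`, and `(a + b)² ≤ 2 (a² +
    -- b²)`.
    have hbd : Tendsto (fun s : ℝ => 2 * s ^ 2 * ((∫ o, ((rootDensity (P s) ν o -
        rootDensity (P 0) ν o) / s - G o) ^ 2 ∂ν) + ∫ o, G o ^ 2 ∂ν)) (𝓝[≠] 0) (𝓝 0) := by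
      have := ((hs0.pow 2).const_mul 2).mul (hlim.add_const (∫ o, G o ^ 2 ∂ν))
      simpa using this
    refine squeeze_zero' (Eventually.of_forall fun s => integral_nonneg fun o => sq_nonneg _) ?_ hbd
    filter_upwards [hP.filter_mono nhdsWithin_le_nhds, hac.filter_mono nhdsWithin_le_nhds,
      self_mem_nhdsWithin] with s hPs hacs hs
    have hs : s ≠ 0 := hs
    have hd := (memLp_rootDensity hacs).sub (memLp_rootDensity hac0)
    have hdd : MemLp (fun o => (rootDensity (P s) ν o - rootDensity (P 0) ν o) / s - G o) 2 ν := by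
      refine MemLp.sub ?_ hG'
      simpa [div_eq_inv_mul] using hd.const_mul s⁻¹
    rw [← integral_add hdd.integrable_sq hG'.integrable_sq, ← integral_const_mul]
    refine integral_mono hd.integrable_sq ((hdd.integrable_sq.add hG'.integrable_sq).const_mul _)
      fun o => ?_
    have e : rootDensity (P s) ν o - rootDensity (P 0) ν o =
      s * ((rootDensity (P s) ν o - rootDensity (P 0) ν o) / s - G o + G o) := by
      field_simp; ring
    rw [e, mul_pow, mul_comm 2, mul_assoc, ← e]
    refine mul_le_mul_of_nonneg_left ?_ (sq_nonneg s)
    nlinarith [sq_nonneg ((rootDensity (P s) ν o - rootDensity (P 0) ν o) / s - G o - G o)]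

/-- Means of functions with locally bounded second moments are differentiable along a path that is
differentiable in quadratic mean. -/
theorem HasScore.hasDerivAt_integral (h : HasScore P S)
    (hP : ∀ᶠ s in 𝓝 (0 : ℝ), IsProbabilityMeasure (P s)) (hS : MemLp S 2 (P 0))
    {f : ObsData 𝒰 𝒵 → ℝ} (hf : Measurable f) (hb : LocBddSq P f) :
    HasDerivAt (fun s => ∫ o, f o ∂(P s)) (∫ o, f o * S o ∂(P 0)) 0 := by
  obtain ⟨ν, G, hν, hac, hGm, hG, hGS, ht, ht'⟩ := h.exists_root hP hS
  obtain ⟨C, hC⟩ := hb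
  have := hP.self_of_nhds
  have hac0 := hac.self_of_nhds
  obtain ⟨hf0, hC0⟩ := hC.self_of_nhds
  set q : ℝ → ObsData 𝒰 𝒵 → ℝ := fun s => rootDensity (P s) ν with hq
  set D : ℝ → ObsData 𝒰 𝒵 → ℝ := fun s o => (q s o - q 0 o) / s with hD
  have hq0 : MemLp (q 0) 2 ν := memLp_rootDensity hac0
  have hfq0 : MemLp (fun o => f o * q 0 o) 2 ν := memLp_mul_rootDensity hac0 hf hf0
  -- the weak convergence of `f √p_s`
  have hweak : Tendsto (fun s => ∫ o, G o * (f o * q s o) ∂ν - ∫ o, G o * (f o * q 0 o) ∂ν)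
      (𝓝[≠] 0) (𝓝 0) := by
    have hA : ∀ n : ℕ, MeasurableSet {o | (n : ℝ) < |f o|} := fun n =>
      measurableSet_lt measurable_const hf.abs
    have hGn : ∀ n : ℕ, MemLp ({o | (n : ℝ) < |f o|}.indicator G) 2 ν := fun n => hG.indicator (hA n)
    have htail : Tendsto (fun n : ℕ => ∫ o, ({o | (n : ℝ) < |f o|}.indicator G o) ^ 2 ∂ν)
        atTop (𝓝 0) := by
      have := tendsto_integral_of_dominated_convergence (μ := ν)
        (F := fun (n : ℕ) o => ({o | (n : ℝ) < |f o|}.indicator G o) ^ 2) (f := fun _ => 0)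
        (fun o => G o ^ 2) (fun n => ((hGm.indicator (hA n)).pow_const 2).aestronglyMeasurable)
        hG.integrable_sq (fun n => ae_of_all _ fun o => ?_) (ae_of_all _ fun o => ?_)
      · simpa using this
      · by_cases ho : o ∈ {o | (n : ℝ) < |f o|}
        · rw [Set.indicator_of_mem ho, Real.norm_eq_abs, abs_of_nonneg (sq_nonneg _)]
        · rw [Set.indicator_of_notMem ho]; simp [sq_nonneg]
      · obtain ⟨n, hn⟩ := exists_nat_ge |f o|
        refine tendsto_const_nhds.congr' ?_
        filter_upwards [eventually_ge_atTop n] with m hm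
        have : o ∉ {o | (m : ℝ) < |f o|} := by
          simp only [Set.mem_ofPred_eq, not_lt]
          exact hn.trans (by exact_mod_cast hm)
        rw [Set.indicator_of_notMem this]; simp
    -- `f` may be unbounded, so `G` is cut where `|f| > n`. On that set Cauchy–Schwarz uses the
    -- uniform bound `√C` on the norms of `f √p_s`, and the tail of `G` is small whatever `s` is. On
    -- the rest `|f| ≤ n` and `√p_s → √p₀` in mean square. Choosing `n` before `s` gives the limit.
    have hbound : ∀ n : ℕ, ∀ᶠ s in 𝓝[≠] (0 : ℝ),
        |∫ o, G o * (f o * q s o) ∂ν - ∫ o, G o * (f o * q 0 o) ∂ν| ≤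
          √(∫ o, ({o | (n : ℝ) < |f o|}.indicator G o) ^ 2 ∂ν) * √C +
          √(∫ o, ({o | (n : ℝ) < |f o|}.indicator G o) ^ 2 ∂ν) * √C +
          n * √(∫ o, G o ^ 2 ∂ν) * √(∫ o, (q s o - q 0 o) ^ 2 ∂ν) := by
      intro n
      filter_upwards [hP.filter_mono nhdsWithin_le_nhds, hac.filter_mono nhdsWithin_le_nhds,
        hC.filter_mono nhdsWithin_le_nhds] with s hPs hacs hCs
      have hqs : MemLp (q s) 2 ν := memLp_rootDensity hacs
      have hfqs : MemLp (fun o => f o * q s o) 2 ν := memLp_mul_rootDensity hacs hf hCs.1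
      set Gn := {o | (n : ℝ) < |f o|}.indicator G with hGndef
      have hcut : ∀ o, |(G o - Gn o) * f o| ≤ n * |G o| := fun o => by
        by_cases ho : o ∈ {o | (n : ℝ) < |f o|}
        · rw [hGndef, Set.indicator_of_mem ho]; simp; positivity
        · rw [hGndef, Set.indicator_of_notMem ho, sub_zero, abs_mul, mul_comm]
          exact mul_le_mul_of_nonneg_right (not_lt.1 ho) (abs_nonneg _)
      have hcutm : MemLp (fun o => (G o - Gn o) * f o) 2 ν := by
        refine (hG.const_mul (n : ℝ)).mono (((hGm.sub (hGm.indicator (hA n))).mul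
          hf).aestronglyMeasurable) (ae_of_all _ fun o => ?_)
        rw [Real.norm_eq_abs, Real.norm_eq_abs, abs_mul (n : ℝ), Nat.abs_cast]; exact hcut o
      have hdq : MemLp (fun o => q s o - q 0 o) 2 ν := hqs.sub hq0
      have j12 : Integrable (fun o => Gn o * (f o * q s o) - Gn o * (f o * q 0 o)) ν :=
        (integrable_mul_of_memLp (hGn n) hfqs).sub (integrable_mul_of_memLp (hGn n) hfq0)
      have e : ∫ o, G o * (f o * q s o) ∂ν - ∫ o, G o * (f o * q 0 o) ∂ν =
          ∫ o, Gn o * (f o * q s o) ∂ν - ∫ o, Gn o * (f o * q 0 o) ∂ν +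
            ∫ o, ((G o - Gn o) * f o) * (q s o - q 0 o) ∂ν := by
        rw [← integral_sub (integrable_mul_of_memLp hG hfqs) (integrable_mul_of_memLp hG hfq0),
          ← integral_sub (integrable_mul_of_memLp (hGn n) hfqs) (integrable_mul_of_memLp (hGn n) hfq0),
          ← integral_add j12
            (integrable_mul_of_memLp hcutm hdq)]
        exact integral_congr_ae (ae_of_all _ fun o => by ring)
      rw [e]
      refine (abs_add_le _ _).trans (add_le_add ((abs_sub _ _).trans (add_le_add ?_ ?_)) ?_)
      · refine (abs_integral_mul_le_sqrt (hGn n) hfqs).trans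
          (mul_le_mul_of_nonneg_left (Real.sqrt_le_sqrt ?_) (Real.sqrt_nonneg _))
        rw [integral_mul_rootDensity_sq hacs]; exact hCs.2
      · refine (abs_integral_mul_le_sqrt (hGn n) hfq0).trans
          (mul_le_mul_of_nonneg_left (Real.sqrt_le_sqrt ?_) (Real.sqrt_nonneg _))
        rw [integral_mul_rootDensity_sq hac0]; exact hC0
      · refine (abs_integral_mul_le_sqrt hcutm hdq).trans
          (mul_le_mul_of_nonneg_right ?_ (Real.sqrt_nonneg _))
        rw [← Real.sqrt_sq (Nat.cast_nonneg (α := ℝ) n), ← Real.sqrt_mul (sq_nonneg _),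
          ← integral_const_mul]
        refine Real.sqrt_le_sqrt (integral_mono hcutm.integrable_sq
          (hG.integrable_sq.const_mul _) fun o => ?_)
        rw [← mul_pow]
        exact sq_le_sq.2 (by rw [abs_mul (n : ℝ), Nat.abs_cast]; exact hcut o)
    rw [Metric.tendsto_nhds]
    intro ε hε
    have h1 : Tendsto (fun n : ℕ => √(∫ o, ({o | (n : ℝ) < |f o|}.indicator G o) ^ 2 ∂ν) * √C +
          √(∫ o, ({o | (n : ℝ) < |f o|}.indicator G o) ^ 2 ∂ν) * √C) atTop (𝓝 0) := by
      have h2 : Tendsto (fun n : ℕ => √(∫ o, ({o | (n : ℝ) < |f o|}.indicator G o) ^ 2 ∂ν) * √C)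
          atTop (𝓝 0) := by
        have := ((Real.continuous_sqrt.tendsto 0).comp htail).mul_const √C
        simpa using this
      simpa using h2.add h2
    obtain ⟨n, hn⟩ := (h1.eventually (gt_mem_nhds (half_pos hε))).exists
    have h3 : Tendsto (fun s => n * √(∫ o, G o ^ 2 ∂ν) * √(∫ o, (q s o - q 0 o) ^ 2 ∂ν))
        (𝓝[≠] 0) (𝓝 0) := by
      have := ((Real.continuous_sqrt.tendsto 0).comp ht').const_mul (n * √(∫ o, G o ^ 2 ∂ν))
      simpa using this
    filter_upwards [hbound n, h3.eventually (gt_mem_nhds (half_pos hε))] with s hs1 hs2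
    rw [Real.dist_eq, sub_zero]
    linarith
  rw [hasDerivAt_iff_tendsto_slope_zero, ← tendsto_sub_nhds_zero_iff]
  -- From `p_s - p₀ = (√p_s - √p₀)(√p_s + √p₀)`, the slope minus its limit is `∫ D f (√p_s + √p₀) -
  -- 2 ∫ G f √p₀`. The three terms are this expression regrouped around `G`. The first two vanish by
  -- Cauchy–Schwarz, the third by the weak convergence.
  have hmain : Tendsto (fun s => ∫ o, (D s o - G o) * (f o * q s o) ∂ν +
      ∫ o, (D s o - G o) * (f o * q 0 o) ∂ν + (∫ o, G o * (f o * q s o) ∂ν -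
        ∫ o, G o * (f o * q 0 o) ∂ν)) (𝓝[≠] 0) (𝓝 0) := by
    have hz : Tendsto (fun s => √(∫ o, (D s o - G o) ^ 2 ∂ν) * √C) (𝓝[≠] 0) (𝓝 0) := by
      have := ((Real.continuous_sqrt.tendsto 0).comp ht).mul_const √C
      simpa using this
    have hz1 : Tendsto (fun s => ∫ o, (D s o - G o) * (f o * q s o) ∂ν) (𝓝[≠] 0) (𝓝 0) := by
      refine squeeze_zero_norm' ?_ hz
      filter_upwards [hP.filter_mono nhdsWithin_le_nhds, hac.filter_mono nhdsWithin_le_nhds,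
        hC.filter_mono nhdsWithin_le_nhds] with s hPs hacs hCs
      have hDs : MemLp (D s) 2 ν := by
        simpa [hD, div_eq_inv_mul] using ((memLp_rootDensity hacs).sub hq0).const_mul s⁻¹
      refine (abs_integral_mul_le_sqrt (hDs.sub hG)
        (memLp_mul_rootDensity hacs hf hCs.1)).trans
          (mul_le_mul_of_nonneg_left (Real.sqrt_le_sqrt ?_) (Real.sqrt_nonneg _))
      rw [integral_mul_rootDensity_sq hacs]; exact hCs.2
    have hz2 : Tendsto (fun s => ∫ o, (D s o - G o) * (f o * q 0 o) ∂ν) (𝓝[≠] 0) (𝓝 0) := by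
      refine squeeze_zero_norm' ?_ hz
      filter_upwards [hP.filter_mono nhdsWithin_le_nhds, hac.filter_mono nhdsWithin_le_nhds]
        with s hPs hacs
      have hDs : MemLp (D s) 2 ν := by
        simpa [hD, div_eq_inv_mul] using ((memLp_rootDensity hacs).sub hq0).const_mul s⁻¹
      refine (abs_integral_mul_le_sqrt (hDs.sub hG) hfq0).trans
          (mul_le_mul_of_nonneg_left (Real.sqrt_le_sqrt ?_) (Real.sqrt_nonneg _))
      rw [integral_mul_rootDensity_sq hac0]; exact hC0
    simpa using (hz1.add hz2).add hweak
  refine hmain.congr' ?_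
  filter_upwards [hP.filter_mono nhdsWithin_le_nhds, hac.filter_mono nhdsWithin_le_nhds,
    hC.filter_mono nhdsWithin_le_nhds, self_mem_nhdsWithin] with s hPs hacs hCs hs
  have hs : s ≠ 0 := hs
  have hqs : MemLp (q s) 2 ν := memLp_rootDensity hacs
  have hDs : MemLp (D s) 2 ν := by
    simpa [hD, div_eq_inv_mul] using (hqs.sub hq0).const_mul s⁻¹
  have hfqs : MemLp (fun o => f o * q s o) 2 ν := memLp_mul_rootDensity hacs hf hCs.1
  have i1 : Integrable (fun o => (D s o - G o) * (f o * q s o)) ν :=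
    (hDs.sub hG).integrable_mul hfqs
  have i2 : Integrable (fun o => (D s o - G o) * (f o * q 0 o)) ν :=
    (hDs.sub hG).integrable_mul hfq0
  have i3 : Integrable (fun o => G o * (f o * q s o)) ν := hG.integrable_mul hfqs
  have i4 : Integrable (fun o => G o * (f o * q 0 o)) ν := hG.integrable_mul hfq0
  have i5 : Integrable (fun o => q s o * (f o * q s o)) ν := hqs.integrable_mul hfqs
  have i6 : Integrable (fun o => q 0 o * (f o * q 0 o)) ν := hq0.integrable_mul hfq0
  have i12 : Integrable (fun o => (D s o - G o) * (f o * q s o) +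
      (D s o - G o) * (f o * q 0 o)) ν := i1.add i2
  have i34 : Integrable (fun o => G o * (f o * q s o) - G o * (f o * q 0 o)) ν := i3.sub i4
  have i56 : Integrable (fun o => q s o * (f o * q s o) - q 0 o * (f o * q 0 o)) ν := i5.sub i6
  rw [zero_add, ← hGS f, integral_eq_rootDensity hacs, integral_eq_rootDensity hac0,
    ← integral_sub i3 i4, ← integral_add i1 i2, ← integral_add i12 i34,
    ← integral_sub i5 i6, smul_eq_mul, ← integral_const_mul, ← integral_const_mul,
    ← integral_sub (i56.const_mul _) (i4.const_mul _)]
  refine integral_congr_ae (ae_of_all _ fun o => ?_)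
  simp only [hD, hq]
  field_simp
  ring

/-- Means of uniformly dominated functions change continuously along a path that is differentiable
in quadratic mean. -/
theorem HasScore.tendsto_integral_sub (h : HasScore P S)
    (hP : ∀ᶠ s in 𝓝 (0 : ℝ), IsProbabilityMeasure (P s)) (hS : MemLp S 2 (P 0))
    {f : ObsData 𝒰 𝒵 → ℝ} (hb : LocBddSq P f) {g : ℝ → ObsData 𝒰 𝒵 → ℝ}
    (hg : ∀ᶠ s in 𝓝[≠] (0 : ℝ), Measurable (g s) ∧ ∀ o, |g s o| ≤ |f o|) :
    Tendsto (fun s => ∫ o, g s o ∂(P s) - ∫ o, g s o ∂(P 0)) (𝓝[≠] 0) (𝓝 0) := by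
  obtain ⟨ν, G, hν, hac, hGm, hG, hGS, ht, ht'⟩ := h.exists_root hP hS
  obtain ⟨C, hC⟩ := hb
  have := hP.self_of_nhds
  have hac0 := hac.self_of_nhds
  obtain ⟨hf0, hC0⟩ := hC.self_of_nhds
  set q : ℝ → ObsData 𝒰 𝒵 → ℝ := fun s => rootDensity (P s) ν with hq
  have hq0 : MemLp (q 0) 2 ν := memLp_rootDensity hac0
  have hz : Tendsto (fun s => √(∫ o, (q s o - q 0 o) ^ 2 ∂ν) * √C +
      √(∫ o, (q s o - q 0 o) ^ 2 ∂ν) * √C) (𝓝[≠] 0) (𝓝 0) := by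
    have := ((Real.continuous_sqrt.tendsto 0).comp ht').mul_const √C
    simpa using this.add this
  refine squeeze_zero_norm' ?_ hz
  filter_upwards [hP.filter_mono nhdsWithin_le_nhds, hac.filter_mono nhdsWithin_le_nhds,
    hC.filter_mono nhdsWithin_le_nhds, hg] with s hPs hacs hCs hgs
  have hqs : MemLp (q s) 2 ν := memLp_rootDensity hacs
  have hgm : ∀ {m : Measure (ObsData 𝒰 𝒵)}, MemLp f 2 m → ∫ o, f o ^ 2 ∂m ≤ C →
      MemLp (g s) 2 m ∧ ∫ o, g s o ^ 2 ∂m ≤ C := fun {m} h1 h2 => by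
    have h3 : MemLp (g s) 2 m := h1.mono hgs.1.aestronglyMeasurable (ae_of_all _ hgs.2)
    exact ⟨h3, (integral_mono h3.integrable_sq h1.integrable_sq fun o => sq_le_sq.2
      (hgs.2 o)).trans h2⟩
  obtain ⟨a1, a2⟩ := hgm hCs.1 hCs.2
  obtain ⟨b1, b2⟩ := hgm hf0 hC0
  have a3 : MemLp (fun o => g s o * q s o) 2 ν := memLp_mul_rootDensity hacs hgs.1 a1
  have b3 : MemLp (fun o => g s o * q 0 o) 2 ν := memLp_mul_rootDensity hac0 hgs.1 b1
  have hdq : MemLp (fun o => q s o - q 0 o) 2 ν := hqs.sub hq0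
  -- The same difference of squares; domination by `f` bounds both `g √p_s` and `g √p₀` in mean
  -- square by `√C`.
  have e : ∫ o, g s o ∂(P s) - ∫ o, g s o ∂(P 0) = ∫ o, (q s o - q 0 o) * (g s o * q s o) ∂ν +
      ∫ o, (q s o - q 0 o) * (g s o * q 0 o) ∂ν := by
    rw [integral_eq_rootDensity hacs, integral_eq_rootDensity hac0,
      ← integral_sub (integrable_mul_of_memLp hqs a3) (integrable_mul_of_memLp hq0 b3),
      ← integral_add (integrable_mul_of_memLp hdq a3) (integrable_mul_of_memLp hdq b3)]
    exact integral_congr_ae (ae_of_all _ fun o => by simp only [hq]; ring)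
  rw [e]
  refine (abs_add_le _ _).trans (add_le_add ?_ ?_)
  · refine (abs_integral_mul_le_sqrt hdq a3).trans
      (mul_le_mul_of_nonneg_left (Real.sqrt_le_sqrt ?_) (Real.sqrt_nonneg _))
    rw [integral_mul_rootDensity_sq hacs]; exact a2
  · refine (abs_integral_mul_le_sqrt hdq b3).trans
      (mul_le_mul_of_nonneg_left (Real.sqrt_le_sqrt ?_) (Real.sqrt_nonneg _))
    rw [integral_mul_rootDensity_sq hac0]; exact b2

end Score

/-! ### Constructing regular submodels from paths of observed laws -/

section Paths

variable {𝒰 𝒵 : Type*} [MeasurableSpace 𝒰] [MeasurableSpace 𝒵]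

lemma HasScore.congr_path {P P' : ℝ → Measure (ObsData 𝒰 𝒵)} {S : ObsData 𝒰 𝒵 → ℝ}
    (h : HasScore P S) (he : ∀ᶠ s in 𝓝 (0 : ℝ), P' s = P s) : HasScore P' S := by
  obtain ⟨ν, hν, hac, ht⟩ := h
  refine ⟨ν, hν, ?_, ?_⟩
  · filter_upwards [hac, he] with s h1 h2
    rwa [h2]
  · refine ht.congr' ?_
    filter_upwards [he.filter_mono nhdsWithin_le_nhds] with s hs
    rw [hs, he.self_of_nhds]

/-- In `r - 1 = (√r - 1)(√r + 1)` the last factor is at least one. A Lipschitz bound on densities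
therefore passes to their roots. -/
lemma abs_sqrt_sub_one_le {r : ℝ} (hr : 0 ≤ r) : |√r - 1| ≤ |r - 1| := by
  have h1 : r - 1 = (√r - 1) * (√r + 1) := by
    nlinarith [Real.sq_sqrt hr]
  rw [h1, abs_mul]
  refine le_mul_of_one_le_right (abs_nonneg _) ?_
  rw [abs_of_nonneg (by positivity)]
  linarith [Real.sqrt_nonneg r]

/-- A path of densities that is pointwise differentiable and uniformly Lipschitz at `0` is
differentiable in quadratic mean. -/
theorem hasScore_of_density {P : ℝ → Measure (ObsData 𝒰 𝒵)} {μ : Measure (ObsData 𝒰 𝒵)}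
    [IsFiniteMeasure μ] {r : ℝ → ObsData 𝒰 𝒵 → ℝ} {S : ObsData 𝒰 𝒵 → ℝ} {C : ℝ}
    (hP : ∀ᶠ s in 𝓝 (0 : ℝ), P s = μ.withDensity fun o => ENNReal.ofReal (r s o))
    (hm : ∀ᶠ s in 𝓝 (0 : ℝ), Measurable (r s)) (hS : Measurable S)
    (hr0 : ∀ o, r 0 o = 1) (hpos : ∀ᶠ s in 𝓝 (0 : ℝ), ∀ o, 0 ≤ r s o)
    (hC : ∀ᶠ s in 𝓝 (0 : ℝ), ∀ o, |r s o - 1| ≤ C * |s|)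
    (hd : ∀ o, HasDerivAt (fun s => r s o) (S o) 0) : HasScore P S := by
  refine ⟨μ, inferInstance, ?_, ?_⟩
  · filter_upwards [hP] with s hs
    rw [hs]; exact withDensity_absolutelyContinuous _ _
  have hroot : ∀ᶠ s in 𝓝 (0 : ℝ), ∀ᵐ o ∂μ, √((P s).rnDeriv μ o).toReal = √(r s o) := by
    filter_upwards [hP, hm, hpos] with s h1 h2 h3
    rw [h1]
    filter_upwards [Measure.rnDeriv_withDensity μ h2.ennreal_ofReal] with o ho
    rw [ho, ENNReal.toReal_ofReal (h3 o)]
  set f : ℝ → ObsData 𝒰 𝒵 → ℝ := fun s o => (√(r s o) - 1) / s - S o / 2 with hf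
  have hcongr : (fun s => eLpNorm (f s) 2 μ) =ᶠ[𝓝[≠] 0] fun s : ℝ => eLpNorm (fun o =>
        (√((P s).rnDeriv μ o).toReal - √((P 0).rnDeriv μ o).toReal) / s
          - S o * √((P 0).rnDeriv μ o).toReal / 2) 2 μ := by
    filter_upwards [hroot.filter_mono nhdsWithin_le_nhds] with s hs
    refine eLpNorm_congr_ae ?_
    filter_upwards [hs, hroot.self_of_nhds] with o h1 h2
    rw [h1, h2, hr0, Real.sqrt_one, mul_one]
  refine Tendsto.congr' hcongr ?_
  -- The score is a limit of difference quotients, so it inherits the Lipschitz constant.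
  have hSC : ∀ o, |S o| ≤ C := fun o => by
    have h1 := (hasDerivAt_iff_tendsto_slope_zero.1 (hd o)).abs
    refine le_of_tendsto h1 ?_
    filter_upwards [hC.filter_mono nhdsWithin_le_nhds, self_mem_nhdsWithin] with s hs hs0
    have hs0 : s ≠ 0 := hs0
    rw [zero_add, hr0, smul_eq_mul, abs_mul, abs_inv, inv_mul_le_iff₀ (abs_pos.2 hs0), mul_comm]
    exact hs o
  have hfb : ∀ᶠ s in 𝓝[≠] (0 : ℝ), ∀ o, ‖f s o‖ ≤ 2 * C := by
    filter_upwards [hC.filter_mono nhdsWithin_le_nhds, hpos.filter_mono nhdsWithin_le_nhds,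
      self_mem_nhdsWithin] with s hs hp hs0 o
    have hs0 : s ≠ 0 := hs0
    have h1 : |(√(r s o) - 1) / s| ≤ C := by
      rw [abs_div, div_le_iff₀ (abs_pos.2 hs0)]
      exact (abs_sqrt_sub_one_le (hp o)).trans (hs o)
    have h2 : |S o / 2| ≤ C := by
      rw [abs_div, abs_two]; linarith [hSC o, abs_nonneg (S o)]
    rw [Real.norm_eq_abs]
    exact (abs_sub _ _).trans (by linarith)
  have hlim : ∀ o, Tendsto (fun s => f s o) (𝓝[≠] 0) (𝓝 0) := fun o => by
    have h1 : HasDerivAt (fun s => √(r s o)) (S o / 2) 0 := by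
      have := (hd o).sqrt (by rw [hr0]; exact one_ne_zero)
      simpa [hr0] using this
    have h2 := (hasDerivAt_iff_tendsto_slope_zero.1 h1).sub_const (S o / 2)
    rw [sub_self] at h2
    refine h2.congr fun s => ?_
    rw [zero_add, hr0, Real.sqrt_one, smul_eq_mul, inv_mul_eq_div]
  -- Dominated convergence with the constant `(2C)²`, integrable because `μ` is finite.
  have hL : Tendsto (fun s => ∫⁻ o, ‖f s o‖ₑ ^ 2 ∂μ) (𝓝[≠] 0) (𝓝 0) := by
    have := tendsto_lintegral_filter_of_dominated_convergence (μ := μ) (l := 𝓝[≠] (0 : ℝ))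
      (F := fun s o => ‖f s o‖ₑ ^ 2) (f := fun _ => 0) (fun _ => ENNReal.ofReal (2 * C) ^ 2)
      ?_ ?_ ?_ (ae_of_all _ fun o => ?_)
    · simpa using this
    · filter_upwards [hm.filter_mono nhdsWithin_le_nhds] with s hs
      exact (((hs.sqrt.sub_const 1).div_const s).sub (hS.div_const 2)).enorm.pow_const 2
    · filter_upwards [hfb] with s hs
      refine ae_of_all _ fun o => ?_
      gcongr
      rw [← ofReal_norm]
      exact ENNReal.ofReal_le_ofReal (hs o)
    · rw [lintegral_const]
      exact ENNReal.mul_ne_top (ENNReal.pow_ne_top ENNReal.ofReal_ne_top) (measure_ne_top _ _)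
    · have := ((ENNReal.continuous_pow 2).tendsto _).comp
        ((continuous_enorm.tendsto (0 : ℝ)).comp (hlim o))
      simpa [Function.comp_def] using this
  have he : ∀ s, eLpNorm (f s) 2 μ = (∫⁻ o, ‖f s o‖ₑ ^ 2 ∂μ) ^ (1 / 2 : ℝ) := fun s => by
    rw [eLpNorm_eq_lintegral_rpow_enorm_toReal (by norm_num) (by norm_num)]
    simp
  simp_rw [he]
  have := ((ENNReal.continuous_rpow_const (y := (1 / 2 : ℝ))).tendsto 0).comp hL
  simpa [Function.comp_def] using this

variable {d : ℕ}

/-- The residual of the propensity `q` has conditional mean zero given the covariates. -/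
def ResidMeanZero (q : ℝ → 𝒰 → ℝ) (P : Measure (ObsData 𝒰 𝒵)) : Prop :=
  ∀ s : Set (𝒰 × 𝒵), MeasurableSet s →
    ∫ o in (fun o : ObsData 𝒰 𝒵 => o.2.2) ⁻¹' s, resid q o ∂P = 0

/-- A path of observed-data laws that satisfies the conditional moment restriction is the path of a
regular submodel. -/
theorem exists_regularSubmodel {π : ℝ → 𝒰 → EuclideanSpace ℝ (Fin d) → ℝ}
    {Θ : Set (EuclideanSpace ℝ (Fin d))} {F : Measure (FullData 𝒰 𝒵)}
    {θ₀ : EuclideanSpace ℝ (Fin d)} {c : ℝ}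
    (hπ : ∀ θ ∈ Θ, IsPropensity (fun y u => π y u θ) c) (hF : InModel π Θ F θ₀)
    {P : ℝ → Measure (ObsData 𝒰 𝒵)} {par : ℝ → EuclideanSpace ℝ (Fin d)}
    {dir : EuclideanSpace ℝ (Fin d)} {S : ObsData 𝒰 𝒵 → ℝ}
    (hP0 : P 0 = obsLaw F) (hP : ∀ᶠ s in 𝓝 (0 : ℝ), IsProbabilityMeasure (P s))
    (hpar0 : par 0 = θ₀) (hpar : ∀ᶠ s in 𝓝 (0 : ℝ), par s ∈ Θ) (hder : HasDerivAt par dir 0)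
    (hres : ∀ᶠ s in 𝓝 (0 : ℝ), ResidMeanZero (fun y u => π y u (par s)) (P s))
    (hS : MemLp S 2 (obsLaw F)) (hsc : HasScore P S)
    (hmom : ∃ C : ℝ≥0, ∀ᶠ s in 𝓝 (0 : ℝ), ∫⁻ o, ‖o.2.1‖ₑ ^ 2 ∂(P s) ≤ C) :
    ∃ m : RegularSubmodel π Θ F θ₀, m.par = par ∧ m.score = S ∧
      ∀ᶠ s in 𝓝 (0 : ℝ), obsLaw (m.law s) = P s := by
  classical
  let Good (s : ℝ) (G : Measure (FullData 𝒰 𝒵)) : Prop := InModel π Θ G (par s) ∧ obsLaw G = P s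
  have hex : ∀ᶠ s in 𝓝 (0 : ℝ), ∃ G, Good s G := by
    filter_upwards [hP, hpar, hres] with s h1 h2 h3
    obtain ⟨G, g1, g2, g3⟩ := exists_full_law (hπ _ h2) (P s) h3
    exact ⟨G, ⟨g1, h2, g2⟩, g3⟩
  -- The full-data laws are chosen separately for each `s`. No regularity in `s` is lost, since
  -- regularity concerns the observed laws only. At `s = 0` the choice must be `F` itself; elsewhere
  -- `F` is a default that is irrelevant near zero.
  let law : ℝ → Measure (FullData 𝒰 𝒵) := fun s =>
    if s = 0 then F else if h : ∃ G, Good s G then h.choose else F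
  have hlaw0 : law 0 = F := by simp [law]
  have hlaw : ∀ᶠ s in 𝓝 (0 : ℝ), Good s (law s) := by
    filter_upwards [hex] with s hs
    by_cases h0 : s = 0
    · subst h0
      rw [hlaw0]
      exact ⟨by rwa [hpar0], hP0.symm⟩
    · simp only [law, h0, hs, if_false, dif_pos]
      exact hs.choose_spec
  have hobs : ∀ᶠ s in 𝓝 (0 : ℝ), obsLaw (law s) = P s := hlaw.mono fun s h => h.2
  refine ⟨⟨law, par, dir, S, hlaw0, hpar0, hlaw.mono fun s h => h.1, hder, hS,
    hsc.congr_path hobs, ?_⟩, rfl, rfl, hobs⟩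
  obtain ⟨C, hC⟩ := hmom
  refine ⟨C, ?_⟩
  filter_upwards [hC, hobs] with s h1 h2
  rwa [h2]

end Paths

/-! ### Smoothness of the treatment model, and derivatives of moments of the residual -/

section Smooth

variable {𝒰 𝒵 : Type*} [MeasurableSpace 𝒰] [MeasurableSpace 𝒵] {d : ℕ}

/-- The regularity conditions on the treatment model. -/
structure SmoothModel (π : ℝ → 𝒰 → EuclideanSpace ℝ (Fin d) → ℝ)
    (Θ : Set (EuclideanSpace ℝ (Fin d))) (θ₀ : EuclideanSpace ℝ (Fin d)) (c K : ℝ) : Prop where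
  mem : θ₀ ∈ interior Θ
  prop : ∀ θ ∈ Θ, IsPropensity (fun y u => π y u θ) c
  nonneg : 0 ≤ K
  diff : ∀ θ ∈ interior Θ, ∀ y u, DifferentiableAt ℝ (π y u) θ ∧ ‖gradient (π y u) θ‖ ≤ K

/-- The derivative of the odds of treatment at `θ` in the direction `v`. -/
noncomputable def oddsDeriv (π : ℝ → 𝒰 → EuclideanSpace ℝ (Fin d) → ℝ)
    (θ v : EuclideanSpace ℝ (Fin d)) (y : ℝ) (u : 𝒰) : ℝ :=
  (1 - π y u θ)⁻¹ * ((1 - π y u θ)⁻¹ * inner ℝ v (piDot π θ y u))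

namespace SmoothModel

variable {π : ℝ → 𝒰 → EuclideanSpace ℝ (Fin d) → ℝ} {Θ : Set (EuclideanSpace ℝ (Fin d))}
  {θ₀ : EuclideanSpace ℝ (Fin d)} {c K : ℝ} (H : SmoothModel π Θ θ₀ c K)
include H

lemma mem' : θ₀ ∈ Θ := interior_subset H.mem

lemma prop₀ : IsPropensity (fun y u => π y u θ₀) c := H.prop _ H.mem'

lemma norm_piDot_le (y : ℝ) (u : 𝒰) : ‖piDot π θ₀ y u‖ ≤ K := (H.diff θ₀ H.mem y u).2

lemma abs_inner_piDot_le (v : EuclideanSpace ℝ (Fin d)) (y : ℝ) (u : 𝒰) :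
    |inner ℝ v (piDot π θ₀ y u)| ≤ ‖v‖ * K :=
  (abs_real_inner_le_norm _ _).trans
    (mul_le_mul_of_nonneg_left (H.norm_piDot_le y u) (norm_nonneg _))

lemma abs_oddsDeriv_le (v : EuclideanSpace ℝ (Fin d)) (y : ℝ) (u : 𝒰) :
    |oddsDeriv π θ₀ v y u| ≤ c⁻¹ * (c⁻¹ * (‖v‖ * K)) := by
  have hc : 0 ≤ c⁻¹ := inv_nonneg.2 H.prop₀.pos.le
  rw [oddsDeriv, abs_mul, abs_mul]
  have h1 := H.prop₀.abs_inv_le y u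
  have h2 := H.abs_inner_piDot_le v y u
  gcongr

/-- Mean value inequality on a ball inside the interior of `Θ`. The gradient bound does not depend
on `(y, u)`, so neither does the Lipschitz constant. -/
lemma exists_ball : ∃ ε > 0, Metric.ball θ₀ ε ⊆ Θ ∧ ∀ θ ∈ Metric.ball θ₀ ε, ∀ y u,
    |π y u θ - π y u θ₀| ≤ K * ‖θ - θ₀‖ := by
  obtain ⟨ε, hε, hb⟩ := Metric.isOpen_iff.1 isOpen_interior θ₀ H.mem
  refine ⟨ε, hε, hb.trans interior_subset, fun θ hθ y u => ?_⟩
  refine Convex.norm_image_sub_le_of_norm_fderiv_le (𝕜 := ℝ) (s := Metric.ball θ₀ ε)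
    (fun x hx => (H.diff x (hb hx) y u).1) (fun x hx => ?_) (convex_ball θ₀ ε)
    (Metric.mem_ball_self hε) hθ
  have := (H.diff x (hb hx) y u).2
  rwa [gradient, LinearIsometryEquiv.norm_map] at this

/-- Differentiability gives `‖par s - θ₀‖ ≤ (‖v‖ + 1) |s|` for small `s`. The odds differ by the
difference of the propensities divided by `(1 - π)(1 - π₀)`, hence the two factors `c⁻¹`. Uniformity
in `(y, u)` supplies the dominating constants below. -/
lemma eventually_path {par : ℝ → EuclideanSpace ℝ (Fin d)} {v : EuclideanSpace ℝ (Fin d)}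
    (h0 : par 0 = θ₀) (hv : HasDerivAt par v 0) :
    ∀ᶠ s in 𝓝 (0 : ℝ), par s ∈ Θ ∧ ∀ y u,
      |odds (fun y u => π y u (par s)) y u - odds (fun y u => π y u θ₀) y u|
        ≤ c⁻¹ * (c⁻¹ * (K * (‖v‖ + 1))) * |s| := by
  obtain ⟨ε, hε, hb, hl⟩ := H.exists_ball
  have hcont : ∀ᶠ s in 𝓝 (0 : ℝ), par s ∈ Metric.ball θ₀ ε :=
    hv.continuousAt.eventually_mem (by rw [h0]; exact Metric.ball_mem_nhds _ hε)
  have hbd := (hasDerivAt_iff_isLittleO.1 hv).def zero_lt_one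
  filter_upwards [hcont, hbd] with s hs1 hs2
  refine ⟨hb hs1, fun y u => ?_⟩
  have hp := H.prop _ (hb hs1)
  have hp0 := H.prop₀
  have h1 : ‖par s - θ₀‖ ≤ (‖v‖ + 1) * |s| := by
    rw [sub_zero, one_mul, h0, Real.norm_eq_abs] at hs2
    have := norm_add_le (par s - θ₀ - s • v) (s • v)
    rw [sub_add_cancel, norm_smul, Real.norm_eq_abs] at this
    linarith
  have h2 : |π y u (par s) - π y u θ₀| ≤ K * ((‖v‖ + 1) * |s|) :=
    (hl _ hs1 y u).trans (mul_le_mul_of_nonneg_left h1 H.nonneg)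
  have e : odds (fun y u => π y u (par s)) y u - odds (fun y u => π y u θ₀) y u
      = (1 - π y u (par s))⁻¹ * ((1 - π y u θ₀)⁻¹ * (π y u (par s) - π y u θ₀)) := by
    have a1 := hp.one_sub_ne y u
    have a2 := hp0.one_sub_ne y u
    simp only [odds]
    field_simp
    ring
  have hc : 0 ≤ c⁻¹ := inv_nonneg.2 hp0.pos.le
  have a1 := hp.abs_inv_le y u
  have a2 := hp0.abs_inv_le y u
  rw [e, abs_mul, abs_mul]
  calc _ ≤ c⁻¹ * (c⁻¹ * (K * ((‖v‖ + 1) * |s|))) := by gcongr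
    _ = _ := by ring

lemma hasDerivAt_pi {par : ℝ → EuclideanSpace ℝ (Fin d)} {v : EuclideanSpace ℝ (Fin d)}
    (h0 : par 0 = θ₀) (hv : HasDerivAt par v 0) (y : ℝ) (u : 𝒰) :
    HasDerivAt (fun s => π y u (par s)) (inner ℝ v (piDot π θ₀ y u)) 0 := by
  have h1 := (H.diff θ₀ H.mem y u).1.hasGradientAt
  have h2 : HasFDerivAt (π y u) ((InnerProductSpace.toDual ℝ _) (gradient (π y u) θ₀)) (par 0) := by
    rw [h0]; exact h1.hasFDerivAt
  have h3 := h2.comp_hasDerivAt (0 : ℝ) hv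
  rw [InnerProductSpace.toDual_apply_apply, real_inner_comm] at h3
  exact h3

lemma hasDerivAt_odds {par : ℝ → EuclideanSpace ℝ (Fin d)} {v : EuclideanSpace ℝ (Fin d)}
    (h0 : par 0 = θ₀) (hv : HasDerivAt par v 0) (y : ℝ) (u : 𝒰) :
    HasDerivAt (fun s => odds (fun y u => π y u (par s)) y u) (oddsDeriv π θ₀ v y u) 0 := by
  have h1 := H.hasDerivAt_pi h0 hv y u
  have hne := H.prop₀.one_sub_ne y u
  have h2 := h1.div (h1.const_sub 1) (by rw [h0]; exact hne)
  refine h2.congr_deriv ?_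
  rw [h0, oddsDeriv]
  field_simp
  ring

/-- Measurability of the gradient is not a hypothesis: it follows because each directional
derivative is a pointwise limit of measurable difference quotients. -/
lemma measurable_inner_piDot (v : EuclideanSpace ℝ (Fin d)) :
    Measurable fun z : ℝ × 𝒰 => inner ℝ v (piDot π θ₀ z.1 z.2) := by
  have hv : HasDerivAt (fun s : ℝ => θ₀ + s • v) v 0 := by
    simpa using ((hasDerivAt_id (0 : ℝ)).smul_const v).const_add θ₀
  have h0 : (fun s : ℝ => θ₀ + s • v) 0 = θ₀ := by simp
  obtain ⟨δ, hδ, hb⟩ := Metric.eventually_nhds_iff.1 (H.eventually_path h0 hv)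
  -- Steps that tend to zero and stay below `δ`, so that `θ₀ + t n • v` lies in `Θ`, where
  -- measurability of the propensity is assumed.
  set t : ℕ → ℝ := fun n => δ / 2 * (1 / ((n : ℝ) + 1)) with ht
  have htpos : ∀ n, 0 < t n := fun n => by positivity
  have htlt : ∀ n, t n < δ := fun n => by
    have : (1 : ℝ) / ((n : ℝ) + 1) ≤ 1 := by
      rw [div_le_one (by positivity)]; linarith [Nat.cast_nonneg (α := ℝ) n]
    calc t n ≤ δ / 2 * 1 := mul_le_mul_of_nonneg_left this (by positivity)
      _ < δ := by linarith
  have htlim : Tendsto t atTop (𝓝[≠] 0) := by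
    refine tendsto_nhdsWithin_iff.2 ⟨?_, Eventually.of_forall fun n => (htpos n).ne'⟩
    simpa [ht] using (tendsto_one_div_add_atTop_nhds_zero_nat (𝕜 := ℝ)).const_mul (δ / 2)
  refine measurable_of_tendsto_metrizable (f := fun n (z : ℝ × 𝒰) =>
    (t n)⁻¹ * (π z.1 z.2 (θ₀ + t n • v) - π z.1 z.2 θ₀)) (fun n => ?_) (tendsto_pi_nhds.2 fun z => ?_)
  · have hm : θ₀ + t n • v ∈ Θ := (hb (y := t n) (by
      rw [Real.dist_eq, sub_zero, abs_of_pos (htpos n)]; exact htlt n)).1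
    exact ((H.prop _ hm).meas.sub H.prop₀.meas).const_mul _
  · have := (hasDerivAt_iff_tendsto_slope_zero.1 (H.hasDerivAt_pi h0 hv z.1 z.2)).comp htlim
    simpa [Function.comp_def] using this

lemma measurable_piDot : Measurable fun z : ℝ × 𝒰 => piDot π θ₀ z.1 z.2 := by
  have : (fun z : ℝ × 𝒰 => piDot π θ₀ z.1 z.2) =
      fun z => WithLp.toLp 2 fun j => piDot π θ₀ z.1 z.2 j := rfl
  rw [this]
  refine (WithLp.measurable_toLp 2 _).comp (measurable_pi_iff.2 fun j => ?_)
  have := H.measurable_inner_piDot (EuclideanSpace.single j 1)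
  simpa [EuclideanSpace.inner_single_left] using this

lemma measurable_oddsDeriv (v : EuclideanSpace ℝ (Fin d)) :
    Measurable fun z : ℝ × (𝒰 × 𝒵) => oddsDeriv π θ₀ v z.1 z.2.1 := by
  have h2 := H.measurable_inner_piDot v
  have h1 : Measurable fun z : ℝ × 𝒰 => (1 - π z.1 z.2 θ₀)⁻¹ :=
    (measurable_const.sub H.prop₀.meas).inv
  have h3 : Measurable fun z : ℝ × 𝒰 => oddsDeriv π θ₀ v z.1 z.2 := h1.mul (h1.mul h2)
  have h4 : Measurable fun z : ℝ × (𝒰 × 𝒵) => (z.1, z.2.1) :=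
    measurable_fst.prodMk (measurable_fst.comp measurable_snd)
  exact h3.comp h4

end SmoothModel

lemma LocBddSq.mul_bdd {P : ℝ → Measure (ObsData 𝒰 𝒵)} {f g : ObsData 𝒰 𝒵 → ℝ} {L : ℝ}
    (hf : LocBddSq P f) (hm : Measurable g) (hgm : ∀ o, |g o| ≤ L * |f o|) :
    LocBddSq P g := by
  obtain ⟨C, hC⟩ := hf
  refine ⟨L ^ 2 * C, ?_⟩
  filter_upwards [hC] with s hs
  have h1 : MemLp (fun o => L * f o) 2 (P s) := hs.1.const_mul L
  have hle : ∀ o, |g o| ≤ |L * f o| := fun o => by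
    rw [abs_mul]
    exact (hgm o).trans (mul_le_mul_of_nonneg_right (le_abs_self L) (abs_nonneg _))
  have h2 : MemLp g 2 (P s) := h1.mono hm.aestronglyMeasurable (ae_of_all _ hle)
  refine ⟨h2, ?_⟩
  calc ∫ o, g o ^ 2 ∂(P s) ≤ ∫ o, (L * f o) ^ 2 ∂(P s) :=
        integral_mono h2.integrable_sq h1.integrable_sq fun o => sq_le_sq.2 (hle o)
    _ = L ^ 2 * ∫ o, f o ^ 2 ∂(P s) := by
        rw [← integral_const_mul]; simp_rw [mul_pow]
    _ ≤ L ^ 2 * C := mul_le_mul_of_nonneg_left hs.2 (sq_nonneg L)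

namespace RegularSubmodel

variable {π : ℝ → 𝒰 → EuclideanSpace ℝ (Fin d) → ℝ} {Θ : Set (EuclideanSpace ℝ (Fin d))}
  {F : Measure (FullData 𝒰 𝒵)} {θ₀ : EuclideanSpace ℝ (Fin d)} {c K : ℝ}
  (m : RegularSubmodel π Θ F θ₀)

lemma eventually_prob : ∀ᶠ s in 𝓝 (0 : ℝ), IsProbabilityMeasure (obsLaw (m.law s)) := by
  filter_upwards [m.mem_model] with s hs
  have := hs.1
  infer_instance

lemma locBddSq_outcome : LocBddSq (fun s => obsLaw (m.law s)) fun o => o.2.1 := by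
  obtain ⟨C, hC⟩ := m.moment
  refine ⟨C, ?_⟩
  filter_upwards [hC] with s hs
  have hY : Measurable fun o : ObsData 𝒰 𝒵 => o.2.1 := by fun_prop
  have e : ∀ o : ObsData 𝒰 𝒵, ENNReal.ofReal (o.2.1 ^ 2) = ‖o.2.1‖ₑ ^ 2 := fun o => by
    rw [← sq_abs, ENNReal.ofReal_pow (abs_nonneg _), ← Real.enorm_eq_ofReal_abs]
  have hlt : ∫⁻ o, ENNReal.ofReal (o.2.1 ^ 2) ∂(obsLaw (m.law s)) ≤ C := by
    simp_rw [e]; exact hs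
  have hi : Integrable (fun o : ObsData 𝒰 𝒵 => o.2.1 ^ 2) (obsLaw (m.law s)) := by
    refine ⟨(hY.pow_const 2).aestronglyMeasurable, ?_⟩
    rw [hasFiniteIntegral_iff_ofReal (ae_of_all _ fun o => sq_nonneg _)]
    exact hlt.trans_lt ENNReal.coe_lt_top
  refine ⟨(memLp_two_iff_integrable_sq hY.aestronglyMeasurable).2 hi, ?_⟩
  rw [integral_eq_lintegral_of_nonneg_ae (ae_of_all _ fun o => sq_nonneg _) hi.1]
  exact ENNReal.toReal_le_coe_of_le_coe hlt

lemma locBddSq_one : LocBddSq (fun s => obsLaw (m.law s)) fun _ => 1 := by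
  refine ⟨1, ?_⟩
  filter_upwards [m.eventually_prob] with s hs
  exact ⟨memLp_const 1, by simp⟩

/-- The derivative of the mean of `resid · g` along a regular submodel: `g` does not depend on the
submodel, and the propensity in the residual does. -/
theorem hasDerivAt_integral_resid_mul (H : SmoothModel π Θ θ₀ c K) {g : ObsData 𝒰 𝒵 → ℝ}
    (hg : Measurable g) (hb : LocBddSq (fun s => obsLaw (m.law s)) g) :
    HasDerivAt (fun s => ∫ o, resid (fun y u => π y u (m.par s)) o * g o ∂(obsLaw (m.law s)))
      (∫ o, resid (fun y u => π y u θ₀) o * g o * m.score o ∂(obsLaw F)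
        - ∫ o, (1 - tval o.1) * oddsDeriv π θ₀ m.dir o.2.1 o.2.2.1 * g o ∂(obsLaw F)) 0 := by
  have hP := m.eventually_prob
  have hS : MemLp m.score 2 (obsLaw (m.law 0)) := by rw [m.law_zero]; exact m.score_memLp
  have hq0 := H.prop₀
  set L := c⁻¹ * (c⁻¹ * (K * (‖m.dir‖ + 1))) with hL
  have h1 : HasDerivAt (fun s => ∫ o, resid (fun y u => π y u θ₀) o * g o ∂(obsLaw (m.law s)))
      (∫ o, resid (fun y u => π y u θ₀) o * g o * m.score o ∂(obsLaw F)) 0 := by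
    have := m.has_score.hasDerivAt_integral hP hS (f := fun o => resid (fun y u => π y u θ₀) o * g o)
      (hq0.measurable_resid.mul hg) (hb.mul_bdd (L := c⁻¹) (hq0.measurable_resid.mul hg) fun o => by
        rw [abs_mul]; exact mul_le_mul_of_nonneg_right (hq0.abs_resid_le o) (abs_nonneg _))
    rwa [m.law_zero] at this
  -- The slope splits in two: the law moves with the residual frozen at `θ₀`, plus the mean under `P
  -- s` of the quotient `h s`. In the latter `P s` may be replaced by `P 0`, and dominated
  -- convergence applies. The minus sign arises because the odds enter the residual as `-(1 - T) π /
  -- (1 - π)`.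
  set h : ℝ → ObsData 𝒰 𝒵 → ℝ := fun s o => s⁻¹ * (resid (fun y u => π y u (m.par s)) o -
    resid (fun y u => π y u θ₀) o) * g o with hh
  have hpath := H.eventually_path m.par_zero m.par_deriv
  have hh' : ∀ᶠ s in 𝓝[≠] (0 : ℝ), ∀ o, h s o = - ((1 - tval o.1) * (s⁻¹ *
      (odds (fun y u => π y u (m.par s)) o.2.1 o.2.2.1 -
        odds (fun y u => π y u θ₀) o.2.1 o.2.2.1)) * g o) := by
    filter_upwards [hpath.filter_mono nhdsWithin_le_nhds] with s hs o
    simp only [hh]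
    rw [(H.prop _ hs.1).resid_eq, hq0.resid_eq]; ring
  have hdom : ∀ᶠ s in 𝓝[≠] (0 : ℝ), Measurable (h s) ∧ ∀ o, |h s o| ≤ |L * g o| := by
    filter_upwards [hpath.filter_mono nhdsWithin_le_nhds, hh', self_mem_nhdsWithin]
      with s hs hs' hs0
    have hs0 : s ≠ 0 := hs0
    refine ⟨((((H.prop _ hs.1).measurable_resid.sub hq0.measurable_resid).const_mul _).mul hg),
      fun o => ?_⟩
    rw [hs' o, abs_neg, abs_mul, abs_mul, abs_mul L]
    refine mul_le_mul_of_nonneg_right ?_ (abs_nonneg _)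
    have a1 : |1 - tval o.1| ≤ 1 := abs_le.2 ⟨by linarith [tval_le_one o.1],
      by linarith [tval_nonneg o.1]⟩
    have a2 : |s⁻¹ * (odds (fun y u => π y u (m.par s)) o.2.1 o.2.2.1 -
        odds (fun y u => π y u θ₀) o.2.1 o.2.2.1)| ≤ L := by
      rw [abs_mul, abs_inv, inv_mul_le_iff₀ (abs_pos.2 hs0), mul_comm]
      exact hs.2 _ _
    calc _ ≤ 1 * L := mul_le_mul a1 a2 (abs_nonneg _) zero_le_one
      _ ≤ |L| := by rw [one_mul]; exact le_abs_self L
  have h2 : Tendsto (fun s => ∫ o, h s o ∂(obsLaw (m.law s)) - ∫ o, h s o ∂(obsLaw (m.law 0)))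
      (𝓝[≠] 0) (𝓝 0) :=
    m.has_score.tendsto_integral_sub hP hS (f := fun o => L * g o)
      (hb.mul_bdd (L := |L|) (hg.const_mul L) fun o => (abs_mul _ _).le) hdom
  have hgi : Integrable (fun o => L * g o) (obsLaw F) := by
    obtain ⟨C, hC⟩ := hb
    have h3 := hC.self_of_nhds.1
    have h4 := hP.self_of_nhds
    simp only [m.law_zero] at h3 h4
    exact (h3.integrable one_le_two).const_mul L
  have h3 : Tendsto (fun s => ∫ o, h s o ∂(obsLaw F)) (𝓝[≠] 0)
      (𝓝 (- ∫ o, (1 - tval o.1) * oddsDeriv π θ₀ m.dir o.2.1 o.2.2.1 * g o ∂(obsLaw F))) := by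
    rw [← integral_neg]
    refine tendsto_integral_filter_of_dominated_convergence (fun o => |L * g o|)
      (hdom.mono fun s hs => hs.1.aestronglyMeasurable)
      (hdom.mono fun s hs => ae_of_all _ hs.2) hgi.abs (ae_of_all _ fun o => ?_)
    have := (hasDerivAt_iff_tendsto_slope_zero.1
      (H.hasDerivAt_odds m.par_zero m.par_deriv o.2.1 o.2.2.1))
    refine ((this.const_mul (1 - tval o.1)).mul_const (g o)).neg.congr' ?_
    filter_upwards [hh'] with s hs
    rw [hs o, zero_add, smul_eq_mul, m.par_zero]
  rw [hasDerivAt_iff_tendsto_slope_zero] at h1 ⊢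
  have h4 := h1.add (h2.add h3)
  rw [zero_add, ← sub_eq_add_neg] at h4
  refine h4.congr' ?_
  obtain ⟨C, hC⟩ := hb
  filter_upwards [hpath.filter_mono nhdsWithin_le_nhds, hP.filter_mono nhdsWithin_le_nhds,
    hC.filter_mono nhdsWithin_le_nhds, self_mem_nhdsWithin] with s hs hPs hCs hs0
  have hs0 : s ≠ 0 := hs0
  have hgs : Integrable g (obsLaw (m.law s)) := hCs.1.integrable one_le_two
  have i1 : Integrable (fun o => resid (fun y u => π y u θ₀) o * g o) (obsLaw (m.law s)) :=
    hgs.bdd_mul (c := c⁻¹) hq0.measurable_resid.aestronglyMeasurable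
      (ae_of_all _ fun o => hq0.abs_resid_le o)
  have i2 : Integrable (fun o => resid (fun y u => π y u (m.par s)) o * g o) (obsLaw (m.law s)) :=
    hgs.bdd_mul (c := c⁻¹) (H.prop _ hs.1).measurable_resid.aestronglyMeasurable
      (ae_of_all _ fun o => (H.prop _ hs.1).abs_resid_le o)
  have e : ∫ o, h s o ∂(obsLaw (m.law s)) = s⁻¹ * (∫ o, resid (fun y u => π y u (m.par s)) o * g o
      ∂(obsLaw (m.law s)) - ∫ o, resid (fun y u => π y u θ₀) o * g o ∂(obsLaw (m.law s))) := by
    rw [← integral_sub i2 i1, ← integral_const_mul]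
    exact integral_congr_ae (ae_of_all _ fun o => by simp only [hh]; ring)
  rw [e, zero_add, m.law_zero, m.par_zero, smul_eq_mul, smul_eq_mul]
  ring

end RegularSubmodel

end Smooth

/-! ### Conditional distributions within an event -/

section General

variable {Ω β : Type*} [MeasurableSpace Ω] [MeasurableSpace β] {μ : Measure Ω} [IsFiniteMeasure μ]

omit [IsFiniteMeasure μ] in
lemma setIntegral_cond {A S : Set Ω} (hS : MeasurableSet S)
    (f : Ω → ℝ) : ∫ ω in S, f ω ∂(μ[|A]) = (μ.real A)⁻¹ * ∫ ω in S ∩ A, f ω ∂μ := by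
  rw [ProbabilityTheory.cond, Measure.restrict_smul, integral_smul_measure,
    Measure.restrict_restrict hS, ENNReal.toReal_inv, ← measureReal_def, smul_eq_mul]

lemma integrable_cond_iff {A : Set Ω} (h0 : μ A ≠ 0) (f : Ω → ℝ) :
    Integrable f (μ[|A]) ↔ IntegrableOn f A μ := by
  rw [ProbabilityTheory.cond, integrable_smul_measure (by simp) (by simpa using h0), IntegrableOn]

/-- Conditional means within the event `A` are integrals of the conditional distribution. -/
lemma setIntegral_condDistrib_cond {X : Ω → β} {Y : Ω → ℝ} (hX : Measurable X) (hY : Measurable Y)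
    {A : Set Ω} {h : β × ℝ → ℝ} (hm : Measurable h)
    (hi : IntegrableOn (fun ω => h (X ω, Y ω)) A μ) :
    IntegrableOn (fun ω => ∫ y, h (X ω, y) ∂(condDistrib Y X (μ[|A]) (X ω))) A μ ∧
    ∀ s, MeasurableSet s →
      ∫ ω in X ⁻¹' s ∩ A, ∫ y, h (X ω, y) ∂(condDistrib Y X (μ[|A]) (X ω)) ∂μ =
        ∫ ω in X ⁻¹' s ∩ A, h (X ω, Y ω) ∂μ := by
  -- For a null event the conditioned measure is zero, and both sides vanish because they are
  -- integrals over subsets of `A`. Otherwise the normalising factor cancels.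
  by_cases h0 : μ A = 0
  · have hz : ∀ B : Set Ω, μ.restrict (B ∩ A) = 0 := fun B =>
      Measure.restrict_eq_zero.2 (measure_mono_null Set.inter_subset_right h0)
    have hz' : μ.restrict A = 0 := Measure.restrict_eq_zero.2 h0
    refine ⟨by rw [IntegrableOn, hz']; exact integrable_zero_measure, fun s hs => ?_⟩
    rw [hz]; simp
  have hi' := (integrable_cond_iff h0 _).2 hi
  have hi'' : Integrable h ((μ[|A]).map fun a => (X a, Y a)) :=
    (integrable_map_measure hm.aestronglyMeasurable (hX.prodMk hY).aemeasurable).2 hi'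
  have key := condExp_prod_ae_eq_integral_condDistrib' hX hY.aemeasurable hi''
  have hint : Integrable (fun ω => ∫ y, h (X ω, y) ∂(condDistrib Y X (μ[|A]) (X ω))) (μ[|A]) :=
    integrable_condExp.congr key
  refine ⟨(integrable_cond_iff h0 _).1 hint, fun s hs => ?_⟩
  have e := setIntegral_condExp (μ := μ[|A]) hX.comap_le hi' (s := X ⁻¹' s) ⟨s, hs, rfl⟩
  rw [setIntegral_congr_ae (g := fun ω => ∫ y, h (X ω, y) ∂(condDistrib Y X (μ[|A]) (X ω))) (hX hs)
    (key.mono fun _ h _ => h), setIntegral_cond (hX hs), setIntegral_cond (hX hs)] at e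
  have hne : (μ.real A)⁻¹ ≠ 0 := inv_ne_zero ((measureReal_ne_zero_iff).2 h0)
  exact mul_left_cancel₀ hne e

end General

/-! ### The explicit conditional quantities as conditional expectations of observed data -/

section CondExp

variable {𝒰 𝒵 : Type*} [m𝒰 : MeasurableSpace 𝒰] [m𝒵 : MeasurableSpace 𝒵]

/-- The `σ`-algebra generated by the covariates. -/
abbrev covSigma (𝒰 𝒵 : Type*) [MeasurableSpace 𝒰] [MeasurableSpace 𝒵] :
    MeasurableSpace (ObsData 𝒰 𝒵) :=
  MeasurableSpace.comap (fun o => o.2.2) inferInstance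

lemma covSigma_le : covSigma 𝒰 𝒵 ≤ (inferInstance : MeasurableSpace (ObsData 𝒰 𝒵)) :=
  (by fun_prop : Measurable fun o : ObsData 𝒰 𝒵 => o.2.2).comap_le

lemma stronglyMeasurable_comp_cov {k : 𝒰 × 𝒵 → ℝ} (hk : Measurable k) :
    StronglyMeasurable[covSigma 𝒰 𝒵] fun o : ObsData 𝒰 𝒵 => k o.2.2 :=
  (hk.comp (comap_measurable _)).stronglyMeasurable

section Abstract

variable {P : Measure (ObsData 𝒰 𝒵)} [IsFiniteMeasure P]

lemma condExp_eq_of_setIntegral {f : ObsData 𝒰 𝒵 → ℝ} {k : 𝒰 × 𝒵 → ℝ} (hf : Integrable f P)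
    (hk : Measurable k) (hki : Integrable (fun o : ObsData 𝒰 𝒵 => k o.2.2) P)
    (h : ∀ s, MeasurableSet s → ∫ o in (fun o : ObsData 𝒰 𝒵 => o.2.2) ⁻¹' s, k o.2.2 ∂P
      = ∫ o in (fun o : ObsData 𝒰 𝒵 => o.2.2) ⁻¹' s, f o ∂P) :
    P[f | covSigma 𝒰 𝒵] =ᵐ[P] fun o => k o.2.2 := by
  refine (ae_eq_condExp_of_forall_setIntegral_eq covSigma_le hf (fun _ _ _ => hki.integrableOn) ?_
    (stronglyMeasurable_comp_cov hk).aestronglyMeasurable).symm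
  rintro _ ⟨s, hs, rfl⟩ -
  exact h s hs

omit [IsFiniteMeasure P] in
lemma condExp_mul_cov {f : ObsData 𝒰 𝒵 → ℝ} {k g : 𝒰 × 𝒵 → ℝ} (hf : Integrable f P)
    (hfk : P[f | covSigma 𝒰 𝒵] =ᵐ[P] fun o => k o.2.2) (hg : Measurable g)
    (hfg : Integrable (fun o => f o * g o.2.2) P) :
    P[fun o => f o * g o.2.2 | covSigma 𝒰 𝒵] =ᵐ[P] fun o => k o.2.2 * g o.2.2 := by
  have := condExp_mul_of_stronglyMeasurable_right (stronglyMeasurable_comp_cov hg) hfg hf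
  filter_upwards [this, hfk] with o h1 h2
  rw [← h2]; exact h1

/-- Functions of the covariates can be integrated against conditional means. -/
lemma integral_mul_cov {f : ObsData 𝒰 𝒵 → ℝ} {k g : 𝒰 × 𝒵 → ℝ} (hf : Integrable f P)
    (hfk : P[f | covSigma 𝒰 𝒵] =ᵐ[P] fun o => k o.2.2) (hg : Measurable g)
    (hfg : Integrable (fun o => f o * g o.2.2) P) :
    Integrable (fun o : ObsData 𝒰 𝒵 => k o.2.2 * g o.2.2) P ∧
      ∫ o, f o * g o.2.2 ∂P = ∫ o, k o.2.2 * g o.2.2 ∂P := by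
  have h := condExp_mul_cov hf hfk hg hfg
  refine ⟨integrable_condExp.congr h, ?_⟩
  rw [← integral_condExp covSigma_le]
  exact integral_congr_ae h

end Abstract

variable {F : Measure (FullData 𝒰 𝒵)} [IsProbabilityMeasure F]

omit [IsProbabilityMeasure F] in
lemma setIntegral_obsLaw {f : ObsData 𝒰 𝒵 → ℝ} (hf : Measurable f) {s : Set (𝒰 × 𝒵)}
    (hs : MeasurableSet s) :
    ∫ o in (fun o : ObsData 𝒰 𝒵 => o.2.2) ⁻¹' s, f o ∂(obsLaw F) =
      ∫ ω in cov ⁻¹' s, f (obs ω) ∂F :=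
  setIntegral_map ((by fun_prop : Measurable fun o : ObsData 𝒰 𝒵 => o.2.2) hs)
    hf.aestronglyMeasurable measurable_obs.aemeasurable

lemma measurable_wfun : Measurable (wfun F) :=
  (Kernel.measurable_coe _ (measurableSet_singleton true)).ennreal_toReal

lemma measurable_E0 {h : (𝒰 × 𝒵) × ℝ → ℝ} (hm : Measurable h) :
    Measurable fun x => E0 F (fun y => h (x, y)) x :=
  (StronglyMeasurable.integral_kernel_prod_right' (κ := condDistrib y0 cov F)
    hm.stronglyMeasurable).measurable

omit [IsProbabilityMeasure F] in
lemma measurable_E0untreated {h : (𝒰 × 𝒵) × ℝ → ℝ} (hm : Measurable h) :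
    Measurable fun x => E0untreated F (fun y => h (x, y)) x :=
  (StronglyMeasurable.integral_kernel_prod_right' (κ := condDistrib y0 cov _)
    hm.stronglyMeasurable).measurable

omit [IsProbabilityMeasure F] in
lemma measurable_E1treated {h : (𝒰 × 𝒵) × ℝ → ℝ} (hm : Measurable h) :
    Measurable fun x => E1treated F (fun y => h (x, y)) x :=
  (StronglyMeasurable.integral_kernel_prod_right' (κ := condDistrib y1 cov _)
    hm.stronglyMeasurable).measurable

lemma wfun_nonneg (x : 𝒰 × 𝒵) : 0 ≤ wfun F x := measureReal_nonneg
lemma wfun_le_one (x : 𝒰 × 𝒵) : wfun F x ≤ 1 := measureReal_le_one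

lemma measurable_tval_fst : Measurable fun o : ObsData 𝒰 𝒵 => tval o.1 :=
  measurable_tval.comp measurable_fst

lemma integrable_tval_obs : Integrable (fun o : ObsData 𝒰 𝒵 => tval o.1) (obsLaw F) :=
  integrable_tval_comp measurable_fst

/-- `pr(T = 1 | X) = w(X)`. -/
lemma condExp_tval : (obsLaw F)[fun o => tval o.1 | covSigma 𝒰 𝒵]
    =ᵐ[obsLaw F] fun o => wfun F o.2.2 := by
  have hw : Integrable (fun o : ObsData 𝒰 𝒵 => wfun F o.2.2) (obsLaw F) :=
    Integrable.of_bound (measurable_wfun.comp (by fun_prop)).aestronglyMeasurable 1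
      (ae_of_all _ fun o => by
        rw [Real.norm_eq_abs, abs_of_nonneg (wfun_nonneg _)]; exact wfun_le_one _)
  refine condExp_eq_of_setIntegral integrable_tval_obs measurable_wfun hw fun s hs => ?_
  rw [setIntegral_obsLaw (f := fun o => wfun F o.2.2) (measurable_wfun.comp (by fun_prop)) hs,
    setIntegral_obsLaw measurable_tval_fst hs]
  have key := condDistrib_ae_eq_condExp (μ := F) (measurable_cov (𝒰 := 𝒰) (𝒵 := 𝒵)) measurable_trt
    (measurableSet_singleton true)
  have hi : Integrable ((trt ⁻¹' {true}).indicator fun _ : FullData 𝒰 𝒵 => (1 : ℝ)) F :=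
    (integrable_const 1).indicator (measurable_trt (measurableSet_singleton true))
  have e := setIntegral_condExp (μ := F) (measurable_cov (𝒰 := 𝒰) (𝒵 := 𝒵)).comap_le hi
    (s := cov ⁻¹' s) ⟨s, hs, rfl⟩
  rw [setIntegral_congr_ae (g := fun ω => wfun F (obs ω).2.2) (measurable_cov hs)
    (key.symm.mono fun _ h _ => h)] at e
  rw [e]
  refine integral_congr_ae (ae_of_all _ fun ω => ?_)
  cases ht : trt ω <;> simp [ht, Set.indicator]

lemma condExp_one_sub_tval : (obsLaw F)[fun o => 1 - tval o.1 | covSigma 𝒰 𝒵]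
    =ᵐ[obsLaw F] fun o => 1 - wfun F o.2.2 := by
  have h1 := condExp_sub (μ := obsLaw F) (integrable_const (1 : ℝ)) (integrable_tval_obs (F := F))
    (covSigma 𝒰 𝒵)
  filter_upwards [h1, condExp_tval (F := F)] with o e1 e2
  rw [show (fun o : ObsData 𝒰 𝒵 => 1 - tval o.1) = (fun _ => (1 : ℝ)) - fun o => tval o.1 from rfl,
    e1, Pi.sub_apply, e2, condExp_const covSigma_le]

/-- Conditional means of functions of the outcome of the untreated. -/
lemma condExp_untreated {h : (𝒰 × 𝒵) × ℝ → ℝ} (hm : Measurable h)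
    (hi : Integrable (fun o : ObsData 𝒰 𝒵 => (1 - tval o.1) * h (o.2.2, o.2.1)) (obsLaw F)) :
    (obsLaw F)[fun o => (1 - tval o.1) * h (o.2.2, o.2.1) | covSigma 𝒰 𝒵] =ᵐ[obsLaw F]
      fun o => (1 - wfun F o.2.2) * E0untreated F (fun y => h (o.2.2, y)) o.2.2 := by
  set A : Set (FullData 𝒰 𝒵) := {ω | trt ω = false} with hAdef
  have hA : MeasurableSet A := measurable_trt (measurableSet_singleton false)
  have hAt : ∀ f : FullData 𝒰 𝒵 → ℝ, A.indicator f = fun ω => (1 - tval (trt ω)) * f ω := by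
    intro f; ext ω
    cases ht : trt ω <;> simp [hAdef, Set.indicator, ht]
  have m1 : Measurable fun o : ObsData 𝒰 𝒵 => (1 - tval o.1) * h (o.2.2, o.2.1) := by
    have := measurable_tval_fst (𝒰 := 𝒰) (𝒵 := 𝒵)
    fun_prop
  set k : 𝒰 × 𝒵 → ℝ := fun x => E0untreated F (fun y => h (x, y)) x with hk
  have hkm : Measurable k := measurable_E0untreated hm
  have m2 : Measurable fun o : ObsData 𝒰 𝒵 => (1 - tval o.1) * k o.2.2 := by
    have := measurable_tval_fst (𝒰 := 𝒰) (𝒵 := 𝒵)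
    fun_prop
  have eh : ∀ ω : FullData 𝒰 𝒵, (1 - tval (obs ω).1) * h ((obs ω).2.2, (obs ω).2.1) =
      A.indicator (fun ω => h (cov ω, y0 ω)) ω := fun ω => by
    rw [hAt]; exact one_sub_tval_mul_obs (fun y x => h (x, y)) ω
  have ek : ∀ ω : FullData 𝒰 𝒵, (1 - tval (obs ω).1) * k (obs ω).2.2 =
      A.indicator (fun ω => k (cov ω)) ω := fun ω => by
    rw [hAt]; rfl
  have hi' : IntegrableOn (fun ω => h (cov ω, y0 ω)) A F := by
    rw [← integrable_indicator_iff hA]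
    rw [integrable_obsLaw m1] at hi
    exact hi.congr (ae_of_all _ eh)
  obtain ⟨k1, k2⟩ := setIntegral_condDistrib_cond (μ := F) measurable_cov measurable_y0 hm hi'
  have hki : Integrable (fun o : ObsData 𝒰 𝒵 => (1 - tval o.1) * k o.2.2) (obsLaw F) := by
    rw [integrable_obsLaw m2]
    exact ((integrable_indicator_iff hA).2 k1).congr (ae_of_all _ fun ω => (ek ω).symm)
  have hset : ∀ s, MeasurableSet s →
      ∫ o in (fun o : ObsData 𝒰 𝒵 => o.2.2) ⁻¹' s, (1 - tval o.1) * k o.2.2 ∂(obsLaw F) =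
      ∫ o in (fun o : ObsData 𝒰 𝒵 => o.2.2) ⁻¹' s, (1 - tval o.1) * h (o.2.2, o.2.1)
        ∂(obsLaw F) := fun s hs => by
    rw [setIntegral_obsLaw m1 hs, setIntegral_obsLaw m2 hs]
    simp_rw [eh, ek]
    rw [setIntegral_indicator hA, setIntegral_indicator hA]
    exact k2 s hs
  -- On the untreated, `h` may be replaced by its conditional mean `k(X)` without changing integrals
  -- over covariate events. After that, `k(X)` comes out and leaves `E(1 - T | X) = 1 - w`.
  have h1 : (obsLaw F)[fun o => (1 - tval o.1) * k o.2.2 | covSigma 𝒰 𝒵] =ᵐ[obsLaw F]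
      (obsLaw F)[fun o => (1 - tval o.1) * h (o.2.2, o.2.1) | covSigma 𝒰 𝒵] := by
    refine ae_eq_condExp_of_forall_setIntegral_eq covSigma_le hi
      (fun _ _ _ => integrable_condExp.integrableOn) ?_
      stronglyMeasurable_condExp.aestronglyMeasurable
    rintro _ ⟨s, hs, rfl⟩ -
    rw [setIntegral_condExp covSigma_le hki ⟨s, hs, rfl⟩]
    exact hset s hs
  have h2 := condExp_mul_cov (P := obsLaw F) (f := fun o => 1 - tval o.1) (g := k)
    (k := fun x => 1 - wfun F x) ((integrable_const _).sub integrable_tval_obs)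
    condExp_one_sub_tval hkm hki
  exact h1.symm.trans h2

/-- The conditional mean of the outcome of the treated. -/
lemma condExp_treated
    (hi : Integrable (fun o : ObsData 𝒰 𝒵 => tval o.1 * o.2.1) (obsLaw F)) :
    (obsLaw F)[fun o => tval o.1 * o.2.1 | covSigma 𝒰 𝒵] =ᵐ[obsLaw F]
      fun o => wfun F o.2.2 * E1treated F (fun y => y) o.2.2 := by
  set A : Set (FullData 𝒰 𝒵) := {ω | trt ω = true} with hAdef
  have hA : MeasurableSet A := measurable_trt (measurableSet_singleton true)
  have hAt : ∀ f : FullData 𝒰 𝒵 → ℝ, A.indicator f = fun ω => tval (trt ω) * f ω := by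
    intro f; ext ω
    cases ht : trt ω <;> simp [hAdef, Set.indicator, ht]
  have m1 : Measurable fun o : ObsData 𝒰 𝒵 => tval o.1 * o.2.1 := by
    have := measurable_tval_fst (𝒰 := 𝒰) (𝒵 := 𝒵)
    fun_prop
  set k : 𝒰 × 𝒵 → ℝ := fun x => E1treated F (fun y => y) x with hk
  have hkm : Measurable k := measurable_E1treated (h := fun z => z.2) measurable_snd
  have m2 : Measurable fun o : ObsData 𝒰 𝒵 => tval o.1 * k o.2.2 := by
    have := measurable_tval_fst (𝒰 := 𝒰) (𝒵 := 𝒵)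
    fun_prop
  have eh : ∀ ω : FullData 𝒰 𝒵, tval (obs ω).1 * (obs ω).2.1 =
      A.indicator (fun ω => y1 ω) ω := fun ω => by
    rw [hAt]; exact tval_mul_obs ω
  have ek : ∀ ω : FullData 𝒰 𝒵, tval (obs ω).1 * k (obs ω).2.2 =
      A.indicator (fun ω => k (cov ω)) ω := fun ω => by
    rw [hAt]; rfl
  have hi' : IntegrableOn (fun ω => y1 ω) A F := by
    rw [← integrable_indicator_iff hA]
    rw [integrable_obsLaw m1] at hi
    exact hi.congr (ae_of_all _ eh)
  obtain ⟨k1, k2⟩ := setIntegral_condDistrib_cond (μ := F) measurable_cov measurable_y1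
    (h := fun z => z.2) measurable_snd hi'
  have hki : Integrable (fun o : ObsData 𝒰 𝒵 => tval o.1 * k o.2.2) (obsLaw F) := by
    rw [integrable_obsLaw m2]
    exact ((integrable_indicator_iff hA).2 k1).congr (ae_of_all _ fun ω => (ek ω).symm)
  have hset : ∀ s, MeasurableSet s →
      ∫ o in (fun o : ObsData 𝒰 𝒵 => o.2.2) ⁻¹' s, tval o.1 * k o.2.2 ∂(obsLaw F) =
      ∫ o in (fun o : ObsData 𝒰 𝒵 => o.2.2) ⁻¹' s, tval o.1 * o.2.1 ∂(obsLaw F) := fun s hs => by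
    rw [setIntegral_obsLaw m1 hs, setIntegral_obsLaw m2 hs]
    simp_rw [eh, ek]
    rw [setIntegral_indicator hA, setIntegral_indicator hA]
    exact k2 s hs
  -- The same replacement by the conditional mean, within the treated arm.
  have h1 : (obsLaw F)[fun o => tval o.1 * k o.2.2 | covSigma 𝒰 𝒵] =ᵐ[obsLaw F]
      (obsLaw F)[fun o => tval o.1 * o.2.1 | covSigma 𝒰 𝒵] := by
    refine ae_eq_condExp_of_forall_setIntegral_eq covSigma_le hi
      (fun _ _ _ => integrable_condExp.integrableOn) ?_
      stronglyMeasurable_condExp.aestronglyMeasurable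
    rintro _ ⟨s, hs, rfl⟩ -
    rw [setIntegral_condExp covSigma_le hki ⟨s, hs, rfl⟩]
    exact hset s hs
  have h2 := condExp_mul_cov (P := obsLaw F) (f := fun o => tval o.1) (g := k)
    (k := fun x => wfun F x) integrable_tval_obs condExp_tval hkm hki
  exact h1.symm.trans h2

/-- Conditional means of functions of `(Y₀, X)` as conditional means of observed data. -/
lemma condExp_inverse_weighted {q : ℝ → 𝒰 → ℝ} {c : ℝ} (hq : IsPropensity q c)
    (hF : HasPropensity F q) {h : (𝒰 × 𝒵) × ℝ → ℝ} (hm : Measurable h) {L : ℝ}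
    (hL : ∀ z, |h z| ≤ L) :
    (obsLaw F)[fun o => (1 - tval o.1) * ((1 - q o.2.1 o.2.2.1)⁻¹ * h (o.2.2, o.2.1))
        | covSigma 𝒰 𝒵] =ᵐ[obsLaw F] fun o => E0 F (fun y => h (o.2.2, y)) o.2.2 := by
  have hkm := measurable_E0 (F := F) hm
  have hc : 0 ≤ c⁻¹ := inv_nonneg.2 hq.pos.le
  have m1 : Measurable fun o : ObsData 𝒰 𝒵 =>
      (1 - tval o.1) * ((1 - q o.2.1 o.2.2.1)⁻¹ * h (o.2.2, o.2.1)) :=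
    (measurable_const.sub measurable_tval_fst).mul
      ((hq.measurable_inv.comp measurable_snd).mul (hm.comp (by fun_prop)))
  have i1 : Integrable (fun o : ObsData 𝒰 𝒵 =>
      (1 - tval o.1) * ((1 - q o.2.1 o.2.2.1)⁻¹ * h (o.2.2, o.2.1))) (obsLaw F) := by
    refine Integrable.of_bound m1.aestronglyMeasurable (1 * (c⁻¹ * L)) (ae_of_all _ fun o => ?_)
    rw [Real.norm_eq_abs, abs_mul, abs_mul]
    have a1 : |1 - tval o.1| ≤ 1 := abs_le.2 ⟨by linarith [tval_le_one o.1],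
      by linarith [tval_nonneg o.1]⟩
    have a2 := hq.abs_inv_le o.2.1 o.2.2.1
    have a3 := hL (o.2.2, o.2.1)
    gcongr
  have hbd : ∀ x : 𝒰 × 𝒵, ‖E0 F (fun y => h (x, y)) x‖ ≤ L := fun x => by
    refine (norm_integral_le_of_norm_le_const (C := L) (ae_of_all _ fun y => hL (x, y))).trans ?_
    simp
  have i2 : Integrable (fun o : ObsData 𝒰 𝒵 => E0 F (fun y => h (o.2.2, y)) o.2.2) (obsLaw F) :=
    Integrable.of_bound (hkm.comp (by fun_prop : Measurable fun o : ObsData 𝒰 𝒵 =>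
      o.2.2)).aestronglyMeasurable L (ae_of_all _ fun o => hbd _)
  refine condExp_eq_of_setIntegral i1 hkm i2 fun s hs => ?_
  rw [setIntegral_obsLaw (f := fun o => E0 F (fun y => h (o.2.2, y)) o.2.2)
    (hkm.comp (by fun_prop)) hs]
  have hz : Measurable fun ω : FullData 𝒰 𝒵 => (cov ω, y0 ω) := by fun_prop
  have hint : Integrable h (F.map fun ω => (cov ω, y0 ω)) :=
    Integrable.of_bound hm.aestronglyMeasurable L (ae_of_all _ hL)
  have key := condExp_prod_ae_eq_integral_condDistrib' (μ := F) measurable_cov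
    measurable_y0.aemeasurable hint
  have hint' : Integrable (fun ω => h (cov ω, y0 ω)) F :=
    (integrable_map_measure hm.aestronglyMeasurable hz.aemeasurable).1 hint
  have e := setIntegral_condExp (μ := F) (measurable_cov (𝒰 := 𝒰) (𝒵 := 𝒵)).comap_le hint'
    (s := cov ⁻¹' s) ⟨s, hs, rfl⟩
  rw [setIntegral_congr_ae (measurable_cov hs) (key.mono fun _ h _ => h)] at e
  refine Eq.trans e ?_
  -- The identity for means over `(Y₀, X)` is applied to `h` times the indicator of a covariate
  -- event, which localises it to a conditional mean.
  have hms : Measurable fun z : ℝ × (𝒰 × 𝒵) => s.indicator 1 z.2 * h (z.2, z.1) :=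
    ((measurable_one.indicator hs).comp measurable_snd).mul (hm.comp measurable_swap)
  have e2 := integral_full hq hF hms ?_
  · rw [← integral_indicator (measurable_cov hs),
      ← integral_indicator ((by fun_prop : Measurable fun o : ObsData 𝒰 𝒵 => o.2.2) hs)]
    refine Eq.trans ?_ (e2.trans ?_)
    · refine integral_congr_ae (ae_of_all _ fun ω => ?_)
      by_cases hω : cov ω ∈ s <;> simp [Set.indicator, hω]
    · refine integral_congr_ae (ae_of_all _ fun o => ?_)
      by_cases hω : o.2.2 ∈ s <;> simp [Set.indicator, hω]
  · refine Integrable.of_bound ((measurable_const.sub measurable_tval_fst).mul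
      (hms.comp measurable_snd)).aestronglyMeasurable (1 * (1 * L)) (ae_of_all _ fun o => ?_)
    rw [Real.norm_eq_abs, abs_mul, abs_mul]
    have a1 : |1 - tval o.1| ≤ 1 := abs_le.2 ⟨by linarith [tval_le_one o.1],
      by linarith [tval_nonneg o.1]⟩
    have a2 : |s.indicator (1 : 𝒰 × 𝒵 → ℝ) o.2.2| ≤ 1 := by
      by_cases hω : o.2.2 ∈ s <;> simp [hω]
    have a3 := hL (o.2.2, o.2.1)
    gcongr

end CondExp

/-! ### Conditional moments of the residual ratio, and the quantities `A`, `B`, `V`, `M`, `Q`, `D`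
-/

section Quantities

variable {𝒰 𝒵 : Type*} [MeasurableSpace 𝒰] [MeasurableSpace 𝒵] {d : ℕ}
  {π : ℝ → 𝒰 → EuclideanSpace ℝ (Fin d) → ℝ} {Θ : Set (EuclideanSpace ℝ (Fin d))}
  {θ₀ : EuclideanSpace ℝ (Fin d)} {c K : ℝ}
  {F : Measure (FullData 𝒰 𝒵)} [IsProbabilityMeasure F]

lemma measurable_obs_cov : Measurable fun o : ObsData 𝒰 𝒵 => o.2.2 := by fun_prop

lemma measurable_outcome : Measurable fun o : ObsData 𝒰 𝒵 => o.2.1 := by fun_prop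

omit [MeasurableSpace 𝒰] [MeasurableSpace 𝒵] in
lemma abs_one_sub_tval_le (t : Bool) : |1 - tval t| ≤ 1 :=
  abs_le.2 ⟨by linarith [tval_le_one t], by linarith [tval_nonneg t]⟩

omit [IsProbabilityMeasure F] in
lemma integral_cov {g : 𝒰 × 𝒵 → ℝ} (hg : Measurable g) :
    ∫ ω, g (cov ω) ∂F = ∫ o, g o.2.2 ∂(obsLaw F) :=
  (integral_obsLaw (f := fun o => g o.2.2) (hg.comp measurable_obs_cov)).symm

omit [IsProbabilityMeasure F] in
lemma pTreat_eq : pTreat F = ∫ o, tval o.1 ∂(obsLaw F) := by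
  have hA : MeasurableSet {ω : FullData 𝒰 𝒵 | trt ω = true} :=
    measurable_trt (measurableSet_singleton true)
  rw [integral_obsLaw measurable_tval_fst, pTreat, ← integral_indicator_one hA]
  refine integral_congr_ae (ae_of_all _ fun ω => ?_)
  cases ht : trt ω <;> simp [ht, Set.indicator]

namespace SmoothModel

variable (H : SmoothModel π Θ θ₀ c K)
include H

lemma measurable_ratio : Measurable (ratio π θ₀ : ObsData 𝒰 𝒵 → ℝ) := H.prop₀.measurable_resid

omit [MeasurableSpace 𝒵] in
lemma abs_ratio_le (o : ObsData 𝒰 𝒵) : |ratio π θ₀ o| ≤ c⁻¹ := H.prop₀.abs_resid_le o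

omit [MeasurableSpace 𝒵] in
lemma ratio_eq (o : ObsData 𝒰 𝒵) :
    ratio π θ₀ o = tval o.1 - (1 - tval o.1) * odds (fun y u => π y u θ₀) o.2.1 o.2.2.1 :=
  H.prop₀.resid_eq o

lemma memLp_ratio_mul {f : ObsData 𝒰 𝒵 → ℝ} {μ : Measure (ObsData 𝒰 𝒵)} (hf : MemLp f 2 μ) :
    MemLp (fun o => ratio π θ₀ o * f o) 2 μ := by
  refine (hf.const_mul c⁻¹).mono (H.measurable_ratio.aestronglyMeasurable.mul hf.1)
    (ae_of_all _ fun o => ?_)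
  rw [norm_mul, norm_mul]
  refine mul_le_mul_of_nonneg_right ?_ (norm_nonneg _)
  exact (H.abs_ratio_le o).trans (le_abs_self _)

lemma integrable_ratio : Integrable (ratio π θ₀) (obsLaw F) := integrable_resid H.prop₀ _

lemma condExp_ratio (hF : HasPropensity F fun y u => π y u θ₀) :
    (obsLaw F)[ratio π θ₀ | covSigma 𝒰 𝒵] =ᵐ[obsLaw F] fun _ => 0 := by
  refine condExp_eq_of_setIntegral (k := fun _ => 0) H.integrable_ratio measurable_const
    (integrable_zero _ _ _) fun s hs => ?_
  rw [integral_zero]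
  exact (integral_resid_mul_indicator H.prop₀ hF hs).symm

omit H in
lemma Bfun_eq (x : 𝒰 × 𝒵) : Bfun π θ₀ F x = E0 F (fun y => odds (fun y u => π y u θ₀) y x.1) x := by
  unfold Bfun odds
  congr 1
  ext y
  rw [div_eq_inv_mul]

lemma measurable_odds' :
    Measurable fun z : (𝒰 × 𝒵) × ℝ => odds (fun y u => π y u θ₀) z.2 z.1.1 :=
  H.prop₀.measurable_odds.comp measurable_swap

lemma measurable_Bfun : Measurable (Bfun π θ₀ F) := by
  have := measurable_E0 (F := F) H.measurable_odds'
  rwa [show Bfun π θ₀ F = fun x => E0 F (fun y => odds (fun y u => π y u θ₀) y x.1) x from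
    funext fun x => Bfun_eq x]

lemma le_Bfun (x : 𝒰 × 𝒵) : c ≤ Bfun π θ₀ F x := by
  rw [Bfun_eq, E0]
  have hm : Measurable fun y : ℝ => odds (fun y u => π y u θ₀) y x.1 :=
    H.measurable_odds'.comp (measurable_const.prodMk measurable_id : Measurable fun y : ℝ => (x, y))
  have := integral_mono (μ := condDistrib y0 cov F x) (integrable_const c)
    (Integrable.of_bound hm.aestronglyMeasurable c⁻¹
      (ae_of_all _ fun y => H.prop₀.abs_odds_le y x.1)) fun y => H.prop₀.le_odds y x.1
  simpa using this

lemma Bfun_pos (x : 𝒰 × 𝒵) : 0 < Bfun π θ₀ F x := H.prop₀.pos.trans_le (H.le_Bfun x)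

lemma inv_Bfun_le (x : 𝒰 × 𝒵) : |(Bfun π θ₀ F x)⁻¹| ≤ c⁻¹ := by
  rw [abs_of_pos (inv_pos.2 (H.Bfun_pos x))]
  exact inv_anti₀ H.prop₀.pos (H.le_Bfun x)

/-- `E(ρ² | X) = B(X)` for the residual ratio `ρ`. -/
lemma condExp_ratio_sq (hF : HasPropensity F fun y u => π y u θ₀) :
    (obsLaw F)[fun o => ratio π θ₀ o * ratio π θ₀ o | covSigma 𝒰 𝒵] =ᵐ[obsLaw F]
      fun o => Bfun π θ₀ F o.2.2 := by
  have h1 := condExp_inverse_weighted (F := F) H.prop₀ hF (H.measurable_odds' (𝒵 := 𝒵))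
    (fun z => H.prop₀.abs_odds_le z.2 z.1.1)
  have i1 : Integrable (fun o : ObsData 𝒰 𝒵 => (1 - tval o.1) * ((1 - π o.2.1 o.2.2.1 θ₀)⁻¹ *
      odds (fun y u => π y u θ₀) o.2.1 o.2.2.1)) (obsLaw F) := by
    refine Integrable.of_bound ((measurable_const.sub measurable_tval_fst).mul
      ((H.prop₀.measurable_inv.comp measurable_snd).mul
        (H.prop₀.measurable_odds.comp measurable_snd))).aestronglyMeasurable
        (1 * (c⁻¹ * c⁻¹)) (ae_of_all _ fun o => ?_)
    rw [Real.norm_eq_abs, abs_mul, abs_mul]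
    have hc : 0 ≤ c⁻¹ := inv_nonneg.2 H.prop₀.pos.le
    have a1 := abs_one_sub_tval_le o.1
    have a2 := H.prop₀.abs_inv_le o.2.1 o.2.2.1
    have a3 := H.prop₀.abs_odds_le o.2.1 o.2.2.1
    gcongr
  have h2 := condExp_add i1 (H.integrable_ratio (F := F)) (covSigma 𝒰 𝒵)
  -- For the untreated, `odds² = odds / (1 - π) - odds`. Hence `ρ²` is an inverse-weighted term,
  -- with conditional mean `B`, plus `ρ`, with conditional mean zero.
  have e : (fun o => ratio π θ₀ o * ratio π θ₀ o) = (fun o : ObsData 𝒰 𝒵 => (1 - tval o.1) *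
      ((1 - π o.2.1 o.2.2.1 θ₀)⁻¹ * odds (fun y u => π y u θ₀) o.2.1 o.2.2.1)) + ratio π θ₀ := by
    ext ⟨t, y, x⟩
    have := H.prop₀.one_sub_ne y x.1
    simp only [Pi.add_apply, H.ratio_eq, odds]
    cases t
    · simp only [tval_false]
      field_simp
      ring
    · simp
  rw [e]
  filter_upwards [h1, h2, H.condExp_ratio hF] with o e1 e2 e3
  rw [e2, Pi.add_apply, e1, e3, add_zero, Bfun_eq]

omit [MeasurableSpace 𝒵] in
-- `ρ²` is `1` on the treated and the squared odds on the untreated, which explains the weight `π² /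
-- (1 - π)²` in `V`.
lemma outcome_weight_eq (o : ObsData 𝒰 𝒵) :
    ratio π θ₀ o * (ratio π θ₀ o * o.2.1) = tval o.1 * o.2.1 + (1 - tval o.1) *
      (π o.2.1 o.2.2.1 θ₀ ^ 2 / (1 - π o.2.1 o.2.2.1 θ₀) ^ 2 * o.2.1) := by
  rcases o with ⟨t, y, x⟩
  rw [H.ratio_eq]
  cases t
  · have := H.prop₀.one_sub_ne y x.1
    simp only [tval_false, odds]
    field_simp
    ring
  · simp

lemma measurable_weighted_outcome : Measurable fun z : (𝒰 × 𝒵) × ℝ =>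
    π z.2 z.1.1 θ₀ ^ 2 / (1 - π z.2 z.1.1 θ₀) ^ 2 * z.2 := by
  have : Measurable fun z : (𝒰 × 𝒵) × ℝ => π z.2 z.1.1 θ₀ :=
    H.prop₀.measurable_q.comp measurable_swap
  exact ((this.pow_const 2).div ((measurable_const.sub this).pow_const 2)).mul measurable_snd

lemma measurable_outcomePart : Measurable (outcomePart π θ₀ F) := by
  have h1 := measurable_E0untreated (F := F) (H.measurable_weighted_outcome (𝒵 := 𝒵))
  have h2 := measurable_E1treated (F := F) (𝒰 := 𝒰) (𝒵 := 𝒵) (h := fun z => z.2) measurable_snd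
  have h3 := measurable_wfun (F := F)
  exact (h3.mul h2).add ((measurable_const.sub h3).mul h1)

/-- `E(ρ² Y | X)` for the residual ratio `ρ`. -/
lemma condExp_ratio_sq_mul_outcome (hY : MemLp (fun o : ObsData 𝒰 𝒵 => o.2.1) 2 (obsLaw F)) :
    (obsLaw F)[fun o => ratio π θ₀ o * (ratio π θ₀ o * o.2.1) | covSigma 𝒰 𝒵] =ᵐ[obsLaw F]
      fun o => outcomePart π θ₀ F o.2.2 := by
  have hYi := hY.integrable one_le_two
  have i1 : Integrable (fun o : ObsData 𝒰 𝒵 => tval o.1 * o.2.1) (obsLaw F) := by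
    refine hYi.bdd_mul (c := 1) measurable_tval_fst.aestronglyMeasurable (ae_of_all _ fun o => ?_)
    rw [Real.norm_eq_abs, abs_of_nonneg (tval_nonneg _)]; exact tval_le_one _
  have i0 : Integrable (fun o => ratio π θ₀ o * (ratio π θ₀ o * o.2.1)) (obsLaw F) :=
    (H.memLp_ratio_mul (H.memLp_ratio_mul hY)).integrable one_le_two
  have i2 : Integrable (fun o : ObsData 𝒰 𝒵 => (1 - tval o.1) *
      (π o.2.1 o.2.2.1 θ₀ ^ 2 / (1 - π o.2.1 o.2.2.1 θ₀) ^ 2 * o.2.1)) (obsLaw F) := by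
    refine (i0.sub i1).congr (ae_of_all _ fun o => ?_)
    simp only [Pi.sub_apply, H.outcome_weight_eq]; ring
  have h1 := condExp_treated i1
  have h2 := condExp_untreated (F := F) (H.measurable_weighted_outcome (𝒵 := 𝒵)) i2
  have h3 := condExp_add i1 i2 (covSigma 𝒰 𝒵)
  rw [show (fun o => ratio π θ₀ o * (ratio π θ₀ o * o.2.1)) =
    (fun o : ObsData 𝒰 𝒵 => tval o.1 * o.2.1) + fun o : ObsData 𝒰 𝒵 => (1 - tval o.1) *
      (π o.2.1 o.2.2.1 θ₀ ^ 2 / (1 - π o.2.1 o.2.2.1 θ₀) ^ 2 * o.2.1) from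
    funext fun o => H.outcome_weight_eq o]
  filter_upwards [h1, h2, h3] with o e1 e2 e3
  rw [e3, Pi.add_apply, e1, e2, outcomePart]

/-- It is a conditional expectation of `ρ² Y`, with `ρ` bounded and `Y` in `L²`, and conditional
expectation preserves `L²`. -/
lemma memLp_outcomePart (hY : MemLp (fun o : ObsData 𝒰 𝒵 => o.2.1) 2 (obsLaw F)) :
    MemLp (fun o => outcomePart π θ₀ F o.2.2) 2 (obsLaw F) :=
  ((H.memLp_ratio_mul (H.memLp_ratio_mul hY)).condExp one_le_two).ae_eq
    (H.condExp_ratio_sq_mul_outcome hY)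

lemma measurable_Vfun : Measurable (Vfun π θ₀ F) :=
  H.measurable_outcomePart.sub (measurable_wfun.mul_const _)

omit H in
lemma memLp_wfun : MemLp (fun o : ObsData 𝒰 𝒵 => wfun F o.2.2) 2 (obsLaw F) :=
  MemLp.of_bound (measurable_wfun.comp measurable_obs_cov).aestronglyMeasurable 1
    (ae_of_all _ fun o => by
      rw [Real.norm_eq_abs, abs_of_nonneg (wfun_nonneg _)]; exact wfun_le_one _)

lemma memLp_Vfun (hY : MemLp (fun o : ObsData 𝒰 𝒵 => o.2.1) 2 (obsLaw F)) :
    MemLp (fun o => Vfun π θ₀ F o.2.2) 2 (obsLaw F) := by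
  have := (memLp_wfun (F := F)).const_mul (att F)
  refine ((H.memLp_outcomePart hY).sub this).ae_eq (ae_of_all _ fun o => ?_)
  simp only [Pi.sub_apply, Vfun]; ring

lemma measurable_score_inner (v : EuclideanSpace ℝ (Fin d)) : Measurable fun z : (𝒰 × 𝒵) × ℝ =>
    (1 - π z.2 z.1.1 θ₀)⁻¹ * inner ℝ v (piDot π θ₀ z.2 z.1.1) := by
  have h1 : Measurable fun z : ℝ × 𝒰 => (1 - π z.1 z.2 θ₀)⁻¹ * inner ℝ v (piDot π θ₀ z.1 z.2) :=
    (measurable_const.sub H.prop₀.meas).inv.mul (H.measurable_inner_piDot v)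
  exact h1.comp (measurable_snd.prodMk (measurable_fst.comp measurable_fst) :
    Measurable fun z : (𝒰 × 𝒵) × ℝ => (z.2, z.1.1))

lemma abs_score_inner_le (v : EuclideanSpace ℝ (Fin d)) (y : ℝ) (u : 𝒰) :
    |(1 - π y u θ₀)⁻¹ * inner ℝ v (piDot π θ₀ y u)| ≤ c⁻¹ * (‖v‖ * K) := by
  have hc : 0 ≤ c⁻¹ := inv_nonneg.2 H.prop₀.pos.le
  rw [abs_mul]
  have h1 := H.prop₀.abs_inv_le y u
  have h2 := H.abs_inner_piDot_le v y u
  gcongr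

/-- Inner products move inside the Bochner integral. The vector `A` is studied through its scalar
projections, to which the real-valued conditional mean lemmas apply. -/
lemma inner_Afun (v : EuclideanSpace ℝ (Fin d)) (x : 𝒰 × 𝒵) : inner ℝ v (Afun π θ₀ F x) =
    E0 F (fun y => (1 - π y x.1 θ₀)⁻¹ * inner ℝ v (piDot π θ₀ y x.1)) x := by
  have hi : Integrable (fun y => (1 - π y x.1 θ₀)⁻¹ • piDot π θ₀ y x.1)
      (condDistrib y0 cov F x) := by
    have hm : Measurable fun y : ℝ => (1 - π y x.1 θ₀)⁻¹ • piDot π θ₀ y x.1 := by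
      have h1 : Measurable fun z : ℝ × 𝒰 => (1 - π z.1 z.2 θ₀)⁻¹ • piDot π θ₀ z.1 z.2 :=
        (measurable_const.sub H.prop₀.meas).inv.smul H.measurable_piDot
      exact h1.comp (measurable_id.prodMk measurable_const : Measurable fun y : ℝ => (y, x.1))
    refine Integrable.of_bound hm.aestronglyMeasurable (c⁻¹ * K) (ae_of_all _ fun y => ?_)
    rw [norm_smul]
    have hc : 0 ≤ c⁻¹ := inv_nonneg.2 H.prop₀.pos.le
    have h1 := H.prop₀.abs_inv_le y x.1
    have h2 := H.norm_piDot_le y x.1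
    rw [Real.norm_eq_abs]
    gcongr
  rw [Afun, E0, E0, ← integral_inner hi]
  simp_rw [inner_smul_right]

lemma measurable_inner_Afun (v : EuclideanSpace ℝ (Fin d)) :
    Measurable fun x => inner ℝ v (Afun π θ₀ F x) := by
  simp_rw [H.inner_Afun]
  exact measurable_E0 (H.measurable_score_inner v)

lemma abs_inner_Afun_le (v : EuclideanSpace ℝ (Fin d)) (x : 𝒰 × 𝒵) :
    |inner ℝ v (Afun π θ₀ F x)| ≤ c⁻¹ * (‖v‖ * K) := by
  rw [H.inner_Afun]
  refine (norm_integral_le_of_norm_le_const (μ := condDistrib y0 cov F x)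
    (f := fun y => (1 - π y x.1 θ₀)⁻¹ * inner ℝ v (piDot π θ₀ y x.1)) (C := c⁻¹ * (‖v‖ * K))
    (ae_of_all _ fun y => H.abs_score_inner_le v y x.1)).trans ?_
  simp

/-- Of the two factors `(1 - π)⁻¹` in the derivative of the odds, one is the inverse weight of the
untreated and is absorbed by passing to `(Y₀, X)`; the other belongs to `A`. -/
lemma condExp_oddsDeriv (hF : HasPropensity F fun y u => π y u θ₀)
    (v : EuclideanSpace ℝ (Fin d)) :
    (obsLaw F)[fun o => (1 - tval o.1) * oddsDeriv π θ₀ v o.2.1 o.2.2.1 | covSigma 𝒰 𝒵]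
      =ᵐ[obsLaw F] fun o => inner ℝ v (Afun π θ₀ F o.2.2) := by
  have h1 := condExp_inverse_weighted (F := F) H.prop₀ hF (H.measurable_score_inner (𝒵 := 𝒵) v)
    (fun z => H.abs_score_inner_le v z.2 z.1.1)
  refine h1.trans (ae_of_all _ fun o => ?_)
  exact (H.inner_Afun v o.2.2).symm

lemma integrable_oddsDeriv (v : EuclideanSpace ℝ (Fin d)) :
    Integrable (fun o : ObsData 𝒰 𝒵 => (1 - tval o.1) * oddsDeriv π θ₀ v o.2.1 o.2.2.1)
      (obsLaw F) := by
  refine Integrable.of_bound ((measurable_const.sub measurable_tval_fst).mul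
    ((H.measurable_oddsDeriv v).comp measurable_snd)).aestronglyMeasurable
    (1 * (c⁻¹ * (c⁻¹ * (‖v‖ * K)))) (ae_of_all _ fun o => ?_)
  rw [Real.norm_eq_abs, abs_mul]
  exact mul_le_mul (abs_one_sub_tval_le _) (H.abs_oddsDeriv_le v _ _) (abs_nonneg _) zero_le_one

lemma integral_ratio_mul_cov (hF : HasPropensity F fun y u => π y u θ₀) {g : 𝒰 × 𝒵 → ℝ}
    (hg : Measurable g) (hi : Integrable (fun o => ratio π θ₀ o * g o.2.2) (obsLaw F)) :
    ∫ o, ratio π θ₀ o * g o.2.2 ∂(obsLaw F) = 0 := by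
  rw [(integral_mul_cov (k := fun _ => 0) H.integrable_ratio (H.condExp_ratio hF) hg hi).2]
  simp

/-- As the odds are at least `c`, `ρ ≤ T - c (1 - T)`. Taking means, `0 ≤ p - c (1 - p)`, which
excludes `p = 0`. -/
lemma pTreat_pos (hF : HasPropensity F fun y u => π y u θ₀) : 0 < pTreat F := by
  have h0 : ∫ o, ratio π θ₀ o ∂(obsLaw F) = 0 := by
    have := H.integral_ratio_mul_cov hF (g := fun _ => 1) measurable_const
      (by simpa using H.integrable_ratio)
    simpa using this
  have i1 := integrable_tval_obs (F := F)
  have h1 : ∫ o, (tval o.1 - c * (1 - tval o.1)) ∂(obsLaw F) ≥ ∫ o, ratio π θ₀ o ∂(obsLaw F) := by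
    refine integral_mono H.integrable_ratio
      (i1.sub (((integrable_const (1 : ℝ)).sub i1).const_mul c)) fun o => ?_
    simp only [H.ratio_eq]
    have := H.prop₀.le_odds o.2.1 o.2.2.1
    have := tval_le_one o.1
    nlinarith
  have e : ∫ o, (tval o.1 - c * (1 - tval o.1)) ∂(obsLaw F) = pTreat F - c * (1 - pTreat F) := by
    have i2 : Integrable (fun o : ObsData 𝒰 𝒵 => c * (1 - tval o.1)) (obsLaw F) :=
      ((integrable_const (1 : ℝ)).sub i1).const_mul c
    rw [integral_sub i1 i2, integral_const_mul,
      integral_sub (integrable_const 1) i1, ← pTreat_eq]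
    simp
  rw [e, h0] at h1
  nlinarith [H.prop₀.pos]

lemma att_eq (hF : HasPropensity F fun y u => π y u θ₀)
    (hY : MemLp (fun o : ObsData 𝒰 𝒵 => o.2.1) 2 (obsLaw F)) :
    att F = (∫ o, ratio π θ₀ o * o.2.1 ∂(obsLaw F)) / pTreat F := by
  rw [pTreat_eq]
  exact integral_resid_mul_outcome H.prop₀ hF (hY.integrable one_le_two)

/-- Inverse weighting again: it identifies `vᵀ Q` with the term in the derivative of `E(ρ Y)` that
comes from the motion of `θ` inside `ρ`. -/
lemma inner_Qvec (hF : HasPropensity F fun y u => π y u θ₀)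
    (hY : MemLp (fun o : ObsData 𝒰 𝒵 => o.2.1) 2 (obsLaw F)) (v : EuclideanSpace ℝ (Fin d)) :
    inner ℝ v (Qvec π θ₀ F) =
      ∫ o, (1 - tval o.1) * oddsDeriv π θ₀ v o.2.1 o.2.2.1 * o.2.1 ∂(obsLaw F) := by
  have hYi := hY.integrable one_le_two
  have i1 : Integrable (fun o : ObsData 𝒰 𝒵 => (1 - tval o.1) * o.2.1) (obsLaw F) :=
    hYi.bdd_mul (c := 1) (measurable_const.sub measurable_tval_fst).aestronglyMeasurable
      (ae_of_all _ fun o => abs_one_sub_tval_le _)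
  have hy0 : Integrable (fun ω => y0 ω) F :=
    integrable_full H.prop₀ hF (h := fun z => z.1) measurable_fst i1
  have hzm : Measurable fun ω : FullData 𝒰 𝒵 => (y0 ω, (cov ω).1) := by fun_prop
  have hwm : Measurable fun ω : FullData 𝒰 𝒵 =>
      (1 - π (y0 ω) (cov ω).1 θ₀)⁻¹ • piDot π θ₀ (y0 ω) (cov ω).1 :=
    ((measurable_const.sub H.prop₀.meas).inv.smul H.measurable_piDot).comp hzm
  have hi : Integrable (fun ω : FullData 𝒰 𝒵 => (y0 ω * (1 - π (y0 ω) (cov ω).1 θ₀)⁻¹) •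
      piDot π θ₀ (y0 ω) (cov ω).1) F := by
    refine (hy0.norm.mul_const (c⁻¹ * K)).mono' ?_ (ae_of_all _ fun ω => ?_)
    · simp_rw [mul_smul]
      exact (measurable_y0.smul hwm).aestronglyMeasurable
    · rw [mul_smul, norm_smul, norm_smul]
      have hc : 0 ≤ c⁻¹ := inv_nonneg.2 H.prop₀.pos.le
      have h1 := H.prop₀.abs_inv_le (y0 ω) (cov ω).1
      have h2 := H.norm_piDot_le (y0 ω) (cov ω).1
      rw [Real.norm_eq_abs (_⁻¹)]
      gcongr
  rw [Qvec, ← integral_inner hi]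
  have hsm : Measurable fun z : ℝ × (𝒰 × 𝒵) =>
      z.1 * ((1 - π z.1 z.2.1 θ₀)⁻¹ * inner ℝ v (piDot π θ₀ z.1 z.2.1)) :=
    measurable_fst.mul ((H.measurable_score_inner v).comp measurable_swap)
  have := integral_full (F := F) H.prop₀ hF hsm ?_
  · simp only at this
    simp_rw [inner_smul_right, mul_assoc]
    rw [this]
    refine integral_congr_ae (ae_of_all _ fun o => ?_)
    simp only [oddsDeriv]; ring
  · refine (i1.bdd_mul (c := c⁻¹ * (‖v‖ * K)) (f := fun o : ObsData 𝒰 𝒵 =>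
      (1 - π o.2.1 o.2.2.1 θ₀)⁻¹ * inner ℝ v (piDot π θ₀ o.2.1 o.2.2.1))
      ((H.measurable_score_inner v).comp
        (measurable_swap.comp measurable_snd)).aestronglyMeasurable
      (ae_of_all _ fun o => H.abs_score_inner_le v _ _)).congr (ae_of_all _ fun o => ?_)
    simp only; ring

lemma memLp_inner_div (v : EuclideanSpace ℝ (Fin d)) : MemLp (fun o : ObsData 𝒰 𝒵 =>
    (Bfun π θ₀ F o.2.2)⁻¹ * inner ℝ v (Afun π θ₀ F o.2.2)) 2 (obsLaw F) := by
  refine MemLp.of_bound ((H.measurable_Bfun.inv.mul (H.measurable_inner_Afun v)).comp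
    measurable_obs_cov).aestronglyMeasurable (c⁻¹ * (c⁻¹ * (‖v‖ * K))) (ae_of_all _ fun o => ?_)
  have hc : 0 ≤ c⁻¹ := inv_nonneg.2 H.prop₀.pos.le
  rw [Real.norm_eq_abs, abs_mul]
  exact mul_le_mul (H.inv_Bfun_le _) (H.abs_inner_Afun_le v _) (abs_nonneg _) hc

lemma inner_Dvec (hY : MemLp (fun o : ObsData 𝒰 𝒵 => o.2.1) 2 (obsLaw F))
    (v : EuclideanSpace ℝ (Fin d)) :
    inner ℝ v (Dvec π θ₀ F) = ∫ o, inner ℝ v (Afun π θ₀ F o.2.2) *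
      ((Bfun π θ₀ F o.2.2)⁻¹ * Vfun π θ₀ F o.2.2) ∂(obsLaw F) := by
  have hm : ∀ v : EuclideanSpace ℝ (Fin d), Measurable fun x : 𝒰 × 𝒵 =>
      inner ℝ v (Afun π θ₀ F x) * ((Bfun π θ₀ F x)⁻¹ * Vfun π θ₀ F x) := fun v =>
    (H.measurable_inner_Afun v).mul (H.measurable_Bfun.inv.mul H.measurable_Vfun)
  have hi1 : ∀ v : EuclideanSpace ℝ (Fin d), Integrable (fun ω : FullData 𝒰 𝒵 =>
      inner ℝ v (Afun π θ₀ F (cov ω)) * ((Bfun π θ₀ F (cov ω))⁻¹ * Vfun π θ₀ F (cov ω))) F :=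
      fun v => by
    refine (integrable_obsLaw (f := fun o => inner ℝ v (Afun π θ₀ F o.2.2) *
      ((Bfun π θ₀ F o.2.2)⁻¹ * Vfun π θ₀ F o.2.2)) ((hm v).comp measurable_obs_cov)).1 ?_
    refine (integrable_mul_of_memLp (H.memLp_inner_div v) (H.memLp_Vfun hY)).congr
      (ae_of_all _ fun o => ?_)
    simp only; ring
  have hi : Integrable (fun ω : FullData 𝒰 𝒵 => ((Bfun π θ₀ F (cov ω))⁻¹ * Vfun π θ₀ F (cov ω)) •
      Afun π θ₀ F (cov ω)) F := by
    -- Integrability of the vector is obtained from its coordinates, each of which is a product of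
    -- two `L²` functions.
    have : (fun ω : FullData 𝒰 𝒵 => ((Bfun π θ₀ F (cov ω))⁻¹ * Vfun π θ₀ F (cov ω)) •
      Afun π θ₀ F (cov ω)) = fun ω => ∑ j, (inner ℝ (EuclideanSpace.single j (1 : ℝ))
        (Afun π θ₀ F (cov ω)) * ((Bfun π θ₀ F (cov ω))⁻¹ * Vfun π θ₀ F (cov ω))) •
          EuclideanSpace.single j (1 : ℝ) := by
      ext ω j
      simp [EuclideanSpace.inner_single_left, Finset.sum_apply, mul_comm, Pi.single_apply]
    rw [this]
    exact integrable_finsetSum _ fun j _ => (hi1 _).smul_const _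
  rw [Dvec, ← integral_inner hi, ← integral_cov (hm v)]
  refine integral_congr_ae (ae_of_all _ fun ω => ?_)
  simp only [inner_smul_right]; ring

/-- The bilinear form of `M`, written so that it matches the covariance of `uᵀ S_eff` with a score
of direction `v`. -/
lemma inner_Mmat (v u : EuclideanSpace ℝ (Fin d)) :
    inner ℝ v (WithLp.toLp 2 ((Mmat π θ₀ F).mulVec u.ofLp)) =
      ∫ o, inner ℝ v (Afun π θ₀ F o.2.2) * ((Bfun π θ₀ F o.2.2)⁻¹ *
        inner ℝ u (Afun π θ₀ F o.2.2)) ∂(obsLaw F) := by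
  have hA : ∀ j : Fin d, Measurable fun x : 𝒰 × 𝒵 => Afun π θ₀ F x j := fun j => by
    have := H.measurable_inner_Afun (F := F) (EuclideanSpace.single j 1)
    simpa [EuclideanSpace.inner_single_left] using this
  have hi : ∀ i j : Fin d, Integrable (fun o : ObsData 𝒰 𝒵 => (Bfun π θ₀ F o.2.2)⁻¹ *
      (Afun π θ₀ F o.2.2 i * Afun π θ₀ F o.2.2 j)) (obsLaw F) := fun i j => by
    have h1 := H.memLp_inner_div (F := F) (EuclideanSpace.single i 1)
    have h2 : MemLp (fun o : ObsData 𝒰 𝒵 => Afun π θ₀ F o.2.2 j) 2 (obsLaw F) := by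
      refine MemLp.of_bound ((hA j).comp measurable_obs_cov).aestronglyMeasurable
        (c⁻¹ * (‖EuclideanSpace.single j (1 : ℝ)‖ * K)) (ae_of_all _ fun o => ?_)
      have := H.abs_inner_Afun_le (F := F) (EuclideanSpace.single j 1) o.2.2
      simpa [EuclideanSpace.inner_single_left] using this
    refine (integrable_mul_of_memLp h1 h2).congr (ae_of_all _ fun o => ?_)
    simp only [EuclideanSpace.inner_single_left]
    simp; ring
  have hM : ∀ i j, Mmat π θ₀ F i j = ∫ o : ObsData 𝒰 𝒵, (Bfun π θ₀ F o.2.2)⁻¹ *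
      (Afun π θ₀ F o.2.2 i * Afun π θ₀ F o.2.2 j) ∂(obsLaw F) := fun i j => by
    rw [← integral_cov (g := fun x => (Bfun π θ₀ F x)⁻¹ * (Afun π θ₀ F x i * Afun π θ₀ F x j))
      (H.measurable_Bfun.inv.mul ((hA i).mul (hA j)))]
    rfl
  have e : ∀ o : ObsData 𝒰 𝒵, inner ℝ v (Afun π θ₀ F o.2.2) * ((Bfun π θ₀ F o.2.2)⁻¹ *
      inner ℝ u (Afun π θ₀ F o.2.2)) = ∑ i, ∑ j, (Bfun π θ₀ F o.2.2)⁻¹ *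
      (Afun π θ₀ F o.2.2 i * Afun π θ₀ F o.2.2 j) * (u j * v i) := fun o => by
    simp only [PiLp.inner_apply, RCLike.inner_apply, conj_trivial]
    rw [Finset.sum_mul]
    refine Finset.sum_congr rfl fun i _ => ?_
    rw [Finset.mul_sum, Finset.mul_sum]
    exact Finset.sum_congr rfl fun j _ => by ring
  simp_rw [e]
  rw [integral_finsetSum _ fun i _ => integrable_finsetSum _ fun j _ => (hi i j).mul_const _]
  simp only [PiLp.inner_apply, Matrix.mulVec, dotProduct, RCLike.inner_apply, conj_trivial]
  refine Finset.sum_congr rfl fun i _ => ?_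
  rw [integral_finsetSum _ fun j _ => (hi i j).mul_const _, Finset.sum_mul]
  refine Finset.sum_congr rfl fun j _ => ?_
  rw [integral_mul_const, hM]
  ring

end SmoothModel

end Quantities

/-! ### The restriction on scores, the derivative of the estimand, and submodels with prescribed
scores -/

section Scores

variable {𝒰 𝒵 : Type*} [MeasurableSpace 𝒰] [MeasurableSpace 𝒵] {d : ℕ}
  {π : ℝ → 𝒰 → EuclideanSpace ℝ (Fin d) → ℝ} {Θ : Set (EuclideanSpace ℝ (Fin d))}
  {θ₀ : EuclideanSpace ℝ (Fin d)} {c K : ℝ}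
  {F : Measure (FullData 𝒰 𝒵)} [IsProbabilityMeasure F]

namespace RegularSubmodel

variable (m : RegularSubmodel π Θ F θ₀)

omit [IsProbabilityMeasure F] in
/-- Scores have mean zero. -/
lemma integral_score : ∫ o, m.score o ∂(obsLaw F) = 0 := by
  have hS : MemLp m.score 2 (obsLaw (m.law 0)) := by rw [m.law_zero]; exact m.score_memLp
  have h1 := m.has_score.hasDerivAt_integral m.eventually_prob hS measurable_const m.locBddSq_one
  have h2 : HasDerivAt (fun s => ∫ _o, (1 : ℝ) ∂(obsLaw (m.law s))) 0 0 := by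
    refine (hasDerivAt_const (0 : ℝ) (1 : ℝ)).congr_of_eventuallyEq ?_
    filter_upwards [m.eventually_prob] with s hs
    simp
  have := h1.unique h2
  simpa [m.law_zero] using this

omit [IsProbabilityMeasure F] in
lemma hasDerivAt_pTreat :
    HasDerivAt (fun s => pTreat (m.law s)) (∫ o, tval o.1 * m.score o ∂(obsLaw F)) 0 := by
  have hS : MemLp m.score 2 (obsLaw (m.law 0)) := by rw [m.law_zero]; exact m.score_memLp
  have h1 := m.has_score.hasDerivAt_integral m.eventually_prob hS (f := fun o => tval o.1)
    measurable_tval_fst (m.locBddSq_one.mul_bdd (L := 1) measurable_tval_fst fun o => by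
      rw [abs_of_nonneg (tval_nonneg _)]; simpa using tval_le_one _)
  simp_rw [pTreat_eq]
  simpa [m.law_zero] using h1

include m in
omit [IsProbabilityMeasure F] in
lemma memLp_outcome : MemLp (fun o : ObsData 𝒰 𝒵 => o.2.1) 2 (obsLaw F) := by
  obtain ⟨C, hC⟩ := m.locBddSq_outcome
  have := hC.self_of_nhds.1
  simpa only [m.law_zero] using this

include m in
omit [IsProbabilityMeasure F] in
lemma hasPropensity : HasPropensity F fun y u => π y u θ₀ := by
  have := m.mem_model.self_of_nhds
  rw [m.law_zero, m.par_zero] at this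
  exact this.2.2

variable (H : SmoothModel π Θ θ₀ c K)
include H

lemma integrable_ratio_mul_score :
    Integrable (fun o => ratio π θ₀ o * m.score o) (obsLaw F) :=
  (H.memLp_ratio_mul m.score_memLp).integrable one_le_two

/-- The restriction on scores: `E(ρ S | X) = vᵀ A(X)` when `θ` moves in the direction `v`. -/
theorem condExp_ratio_mul_score :
    (obsLaw F)[fun o => ratio π θ₀ o * m.score o | covSigma 𝒰 𝒵] =ᵐ[obsLaw F]
      fun o => inner ℝ m.dir (Afun π θ₀ F o.2.2) := by
  have hF := m.hasPropensity
  have hk := H.condExp_oddsDeriv hF m.dir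
  refine condExp_eq_of_setIntegral (m.integrable_ratio_mul_score H) (H.measurable_inner_Afun m.dir)
    (integrable_condExp.congr hk) fun s hs => ?_
  have hxs : MeasurableSet ((fun o : ObsData 𝒰 𝒵 => o.2.2) ⁻¹' s) := measurable_obs_cov hs
  set g : ObsData 𝒰 𝒵 → ℝ := ((fun o : ObsData 𝒰 𝒵 => o.2.2) ⁻¹' s).indicator 1 with hg
  have hgm : Measurable g := measurable_one.indicator hxs
  have h1 := m.hasDerivAt_integral_resid_mul H hgm (m.locBddSq_one.mul_bdd (L := 1) hgm fun o => by
    by_cases ho : o ∈ (fun o : ObsData 𝒰 𝒵 => o.2.2) ⁻¹' s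
    · rw [hg, Set.indicator_of_mem ho]; simp
    · rw [hg, Set.indicator_of_notMem ho]; simp)
  have hmul : ∀ f : ObsData 𝒰 𝒵 → ℝ, (fun o => f o * g o) =
      ((fun o : ObsData 𝒰 𝒵 => o.2.2) ⁻¹' s).indicator f := fun f => by
    ext o
    by_cases ho : o ∈ (fun o : ObsData 𝒰 𝒵 => o.2.2) ⁻¹' s
    · rw [hg, Set.indicator_of_mem ho, Set.indicator_of_mem ho]; simp
    · rw [hg, Set.indicator_of_notMem ho, Set.indicator_of_notMem ho]; simp
  -- Every law of the submodel satisfies the moment restriction at its own parameter, so this moment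
  -- is identically zero. Its vanishing derivative equates the score term with the term from the
  -- motion of `θ`.
  have h2 : HasDerivAt (fun t => ∫ o, resid (fun y u => π y u (m.par t)) o * g o
      ∂(obsLaw (m.law t))) 0 0 := by
    refine (hasDerivAt_const (0 : ℝ) (0 : ℝ)).congr_of_eventuallyEq ?_
    filter_upwards [m.mem_model] with t ht
    have := ht.1
    rw [hmul, integral_indicator hxs]
    exact integral_resid_mul_indicator (H.prop _ ht.2.1) ht.2.2 hs
  have h3 := h1.unique h2
  have e1 : ∫ o, resid (fun y u => π y u θ₀) o * g o * m.score o ∂(obsLaw F) =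
      ∫ o in (fun o : ObsData 𝒰 𝒵 => o.2.2) ⁻¹' s, ratio π θ₀ o * m.score o ∂(obsLaw F) := by
    rw [← integral_indicator hxs, ← hmul]
    refine integral_congr_ae (ae_of_all _ fun o => ?_)
    simp only [show ratio π θ₀ o = resid (fun y u => π y u θ₀) o from rfl]; ring
  have e2 : ∫ o, (1 - tval o.1) * oddsDeriv π θ₀ m.dir o.2.1 o.2.2.1 * g o ∂(obsLaw F) =
      ∫ o in (fun o : ObsData 𝒰 𝒵 => o.2.2) ⁻¹' s, inner ℝ m.dir (Afun π θ₀ F o.2.2)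
        ∂(obsLaw F) := by
    rw [hmul fun o => (1 - tval o.1) * oddsDeriv π θ₀ m.dir o.2.1 o.2.2.1, integral_indicator hxs,
      ← setIntegral_condExp covSigma_le (H.integrable_oddsDeriv m.dir) ⟨s, hs, rfl⟩]
    exact setIntegral_congr_ae hxs (hk.mono fun _ h _ => h)
  rw [← e1, ← e2]
  linarith

lemma integral_ratio_mul_score_mul_cov {g : 𝒰 × 𝒵 → ℝ} (hg : Measurable g)
    (hg2 : MemLp (fun o : ObsData 𝒰 𝒵 => g o.2.2) 2 (obsLaw F)) :
    ∫ o, ratio π θ₀ o * m.score o * g o.2.2 ∂(obsLaw F) =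
      ∫ o, inner ℝ m.dir (Afun π θ₀ F o.2.2) * g o.2.2 ∂(obsLaw F) :=
  (integral_mul_cov (k := fun x => inner ℝ m.dir (Afun π θ₀ F x)) (m.integrable_ratio_mul_score H)
    (m.condExp_ratio_mul_score H) hg
    (integrable_mul_of_memLp (H.memLp_ratio_mul m.score_memLp) hg2)).2

/-- The derivative of the estimand along a regular submodel. -/
theorem hasDerivAt_att : HasDerivAt (fun s => att (m.law s))
    ((pTreat F)⁻¹ * (∫ o, ratio π θ₀ o * o.2.1 * m.score o ∂(obsLaw F)
      - inner ℝ m.dir (Qvec π θ₀ F) - att F * ∫ o, tval o.1 * m.score o ∂(obsLaw F))) 0 := by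
  have hF := m.hasPropensity
  have hY := m.memLp_outcome
  have hp := H.pTreat_pos hF
  have h1 := m.hasDerivAt_integral_resid_mul H measurable_outcome m.locBddSq_outcome
  rw [← H.inner_Qvec hF hY] at h1
  have h2 := m.hasDerivAt_pTreat
  -- Quotient rule for `E(ρ Y) / E(T)`; the derivative of the denominator contributes `-Δ E(T S) /
  -- p`.
  have h3 := h1.div h2 (by rw [m.law_zero]; exact hp.ne')
  have h4 : (fun s => att (m.law s)) =ᶠ[𝓝 0] fun s => (∫ o, resid (fun y u => π y u (m.par s)) o *
      o.2.1 ∂(obsLaw (m.law s))) / pTreat (m.law s) := by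
    obtain ⟨C, hC⟩ := m.locBddSq_outcome
    filter_upwards [m.mem_model, hC] with s hs hs'
    have := hs.1
    rw [pTreat_eq]
    exact integral_resid_mul_outcome (H.prop _ hs.2.1) hs.2.2 (hs'.1.integrable one_le_two)
  refine (h3.congr_of_eventuallyEq h4).congr_deriv ?_
  rw [m.law_zero, m.par_zero, H.att_eq hF hY]
  simp only [show ∀ o : ObsData 𝒰 𝒵, resid (fun y u => π y u θ₀) o = ratio π θ₀ o from
    fun _ => rfl]
  field_simp

end RegularSubmodel

section Density

variable {μ : Measure (ObsData 𝒰 𝒵)} {r : ObsData 𝒰 𝒵 → ℝ}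

lemma setIntegral_withDensity_ofReal (hr : Measurable r) (h0 : ∀ o, 0 ≤ r o)
    {A : Set (ObsData 𝒰 𝒵)} (hA : MeasurableSet A) (f : ObsData 𝒰 𝒵 → ℝ) :
    ∫ o in A, f o ∂(μ.withDensity fun o => ENNReal.ofReal (r o)) = ∫ o in A, r o * f o ∂μ := by
  rw [restrict_withDensity hA, integral_withDensity_eq_integral_toReal_smul hr.ennreal_ofReal
    (ae_of_all _ fun _ => ENNReal.ofReal_lt_top)]
  refine integral_congr_ae (ae_of_all _ fun o => ?_)
  simp only [smul_eq_mul, ENNReal.toReal_ofReal (h0 o)]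

lemma withDensity_ofReal_apply (h0 : ∀ o, 0 ≤ r o) (hi : Integrable r μ)
    {A : Set (ObsData 𝒰 𝒵)} (hA : MeasurableSet A) :
    μ.withDensity (fun o => ENNReal.ofReal (r o)) A = ENNReal.ofReal (∫ o in A, r o ∂μ) := by
  rw [withDensity_apply _ hA, ofReal_integral_eq_lintegral_ofReal hi.integrableOn (ae_of_all _ h0)]

end Density

/-- A path of bounded densities that satisfies the moment restriction is the path of a regular
submodel. -/
theorem exists_regularSubmodel_of_density (H : SmoothModel π Θ θ₀ c K) (hF : InModel π Θ F θ₀)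
    (hY : MemLp (fun o : ObsData 𝒰 𝒵 => o.2.1) 2 (obsLaw F))
    {par : ℝ → EuclideanSpace ℝ (Fin d)} {dir : EuclideanSpace ℝ (Fin d)}
    (hpar0 : par 0 = θ₀) (hder : HasDerivAt par dir 0)
    {r : ℝ → ObsData 𝒰 𝒵 → ℝ} {S : ObsData 𝒰 𝒵 → ℝ} {C : ℝ}
    (hm : ∀ᶠ s in 𝓝 (0 : ℝ), Measurable (r s)) (hS : Measurable S)
    (hr0 : ∀ o, r 0 o = 1) (hC : ∀ᶠ s in 𝓝 (0 : ℝ), ∀ o, |r s o - 1| ≤ C * |s|)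
    (hd : ∀ o, HasDerivAt (fun s => r s o) (S o) 0)
    (hmass : ∀ᶠ s in 𝓝 (0 : ℝ), ∫ o, r s o ∂(obsLaw F) = 1)
    (hres : ∀ᶠ s in 𝓝 (0 : ℝ), ∀ A : Set (𝒰 × 𝒵), MeasurableSet A →
      ∫ o in (fun o : ObsData 𝒰 𝒵 => o.2.2) ⁻¹' A,
        r s o * resid (fun y u => π y u (par s)) o ∂(obsLaw F) = 0) :
    ∃ m : RegularSubmodel π Θ F θ₀, m.par = par ∧ m.score = S ∧
      ∀ᶠ s in 𝓝 (0 : ℝ), (∀ o, 0 ≤ r s o) ∧ Integrable (r s) (obsLaw F) ∧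
        obsLaw (m.law s) = (obsLaw F).withDensity fun o => ENNReal.ofReal (r s o) := by
  set P : ℝ → Measure (ObsData 𝒰 𝒵) := fun s =>
    (obsLaw F).withDensity fun o => ENNReal.ofReal (r s o) with hP
  -- The uniform Lipschitz bound confines the density to `[0, 2]` for small `s`. The lower end makes
  -- it a density; the upper end controls the second moment of the outcome by twice that under `F`.
  have hsmall : ∀ᶠ s in 𝓝 (0 : ℝ), ∀ o, |r s o - 1| ≤ 1 := by
    have : Tendsto (fun s : ℝ => C * |s|) (𝓝 0) (𝓝 0) := by
      have := (continuous_abs.tendsto (0 : ℝ)).const_mul C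
      simpa using this
    filter_upwards [hC, this.eventually (gt_mem_nhds one_pos)] with s h1 h2 o
    exact (h1 o).trans h2.le
  have hpos : ∀ᶠ s in 𝓝 (0 : ℝ), ∀ o, 0 ≤ r s o := hsmall.mono fun s hs o => by
    linarith [(abs_le.1 (hs o)).1]
  have hle : ∀ᶠ s in 𝓝 (0 : ℝ), ∀ o, r s o ≤ 2 := hsmall.mono fun s hs o => by
    linarith [(abs_le.1 (hs o)).2]
  have hint : ∀ᶠ s in 𝓝 (0 : ℝ), Integrable (r s) (obsLaw F) := by
    filter_upwards [hm, hpos, hle] with s h1 h2 h3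
    refine Integrable.of_bound h1.aestronglyMeasurable 2 (ae_of_all _ fun o => ?_)
    rw [Real.norm_eq_abs, abs_of_nonneg (h2 o)]; exact h3 o
  have hP0 : P 0 = obsLaw F := by simp [hP, hr0]
  have hprob : ∀ᶠ s in 𝓝 (0 : ℝ), IsProbabilityMeasure (P s) := by
    filter_upwards [hpos, hint, hmass] with s h1 h2 h3
    refine ⟨?_⟩
    simp only [hP]
    rw [withDensity_ofReal_apply h1 h2 MeasurableSet.univ, setIntegral_univ, h3,
      ENNReal.ofReal_one]
  have hSC : ∀ o, |S o| ≤ C := fun o => by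
    have h1 := (hasDerivAt_iff_tendsto_slope_zero.1 (hd o)).abs
    refine le_of_tendsto h1 ?_
    filter_upwards [hC.filter_mono nhdsWithin_le_nhds, self_mem_nhdsWithin] with s hs hs0
    have hs0 : s ≠ 0 := hs0
    rw [zero_add, hr0, smul_eq_mul, abs_mul, abs_inv, inv_mul_le_iff₀ (abs_pos.2 hs0), mul_comm]
    exact hs o
  have hSL : MemLp S 2 (obsLaw F) := MemLp.of_bound hS.aestronglyMeasurable C (ae_of_all _ hSC)
  have hscore : HasScore P S := hasScore_of_density (μ := obsLaw F)
    (Eventually.of_forall fun s => rfl) hm hS hr0 hpos hC hd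
  have hpath := H.eventually_path hpar0 hder
  have hres' : ∀ᶠ s in 𝓝 (0 : ℝ), ResidMeanZero (fun y u => π y u (par s)) (P s) := by
    filter_upwards [hm, hpos, hres] with s h1 h2 h3 A hA
    simp only [hP]
    rw [setIntegral_withDensity_ofReal h1 h2 (measurable_obs_cov hA)]
    exact h3 A hA
  have hmom : ∃ C : ℝ≥0, ∀ᶠ s in 𝓝 (0 : ℝ), ∫⁻ o, ‖o.2.1‖ₑ ^ 2 ∂(P s) ≤ C := by
    have hfin : ∫⁻ o : ObsData 𝒰 𝒵, ‖o.2.1‖ₑ ^ 2 ∂(obsLaw F) ≠ ∞ := by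
      have := lintegral_rpow_enorm_lt_top_of_eLpNorm_lt_top (by norm_num) (by norm_num) hY.2
      simpa using this.ne
    refine ⟨(2 * ∫⁻ o : ObsData 𝒰 𝒵, ‖o.2.1‖ₑ ^ 2 ∂(obsLaw F)).toNNReal, ?_⟩
    rw [ENNReal.coe_toNNReal (ENNReal.mul_ne_top (by simp) hfin)]
    filter_upwards [hm, hle] with s h1 h2
    simp only [hP]
    rw [lintegral_withDensity_eq_lintegral_mul _ h1.ennreal_ofReal
      (measurable_outcome.enorm.pow_const 2), ← lintegral_const_mul _
      (measurable_outcome.enorm.pow_const 2)]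
    refine lintegral_mono fun o => ?_
    simp only [Pi.mul_apply]
    gcongr
    rw [← ENNReal.ofReal_ofNat]
    exact ENNReal.ofReal_le_ofReal (h2 o)
  obtain ⟨m, m1, m2, m3⟩ := exists_regularSubmodel H.prop hF hP0 hprob hpar0
    (hpath.mono fun s h => h.1) hder hres' hSL hscore hmom
  exact ⟨m, m1, m2, hpos.and (hint.and m3)⟩

/-- Every bounded function with mean zero and `E(ρ S | X) = 0` is a score of a regular submodel in
which `θ` is held fixed. -/
theorem exists_regularSubmodel_of_bounded (H : SmoothModel π Θ θ₀ c K) (hF : InModel π Θ F θ₀)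
    (hY : MemLp (fun o : ObsData 𝒰 𝒵 => o.2.1) 2 (obsLaw F)) {S : ObsData 𝒰 𝒵 → ℝ}
    (hS : Measurable S) {C : ℝ} (hC : ∀ o, |S o| ≤ C) (h0 : ∫ o, S o ∂(obsLaw F) = 0)
    (hρ : (obsLaw F)[fun o => ratio π θ₀ o * S o | covSigma 𝒰 𝒵] =ᵐ[obsLaw F] fun _ => 0) :
    ∃ m : RegularSubmodel π Θ F θ₀, (∀ᶠ s in 𝓝 (0 : ℝ), m.par s = θ₀) ∧ m.score = S := by
  have hSi : Integrable S (obsLaw F) :=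
    Integrable.of_bound hS.aestronglyMeasurable C (ae_of_all _ hC)
  have hSL : MemLp S 2 (obsLaw F) := MemLp.of_bound hS.aestronglyMeasurable C (ae_of_all _ hC)
  have hi := (H.memLp_ratio_mul hSL).integrable one_le_two
  -- The linear path with density `1 + s S` works: the parameter is constant, `E(S) = 0` preserves
  -- mass and `E(ρ S | X) = 0` preserves the moment restriction.
  obtain ⟨m, m1, m2, -⟩ := exists_regularSubmodel_of_density H hF hY (par := fun _ => θ₀) rfl
    (hasDerivAt_const (0 : ℝ) θ₀) (r := fun s o => 1 + s * S o) (S := S) (C := C)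
    (Eventually.of_forall fun s => (hS.const_mul s).const_add 1) hS (fun o => by simp)
    (Eventually.of_forall fun s o => by
      rw [add_sub_cancel_left, abs_mul, mul_comm]
      exact mul_le_mul_of_nonneg_right (hC o) (abs_nonneg s))
    (fun o => by simpa using ((hasDerivAt_id (0 : ℝ)).mul_const (S o)).const_add 1)
    (Eventually.of_forall fun s => by
      rw [integral_add (integrable_const 1) (hSi.const_mul s), integral_const_mul, h0]; simp)
    (Eventually.of_forall fun s A hA => by
      have e1 : ∫ o in (fun o : ObsData 𝒰 𝒵 => o.2.2) ⁻¹' A, ratio π θ₀ o * S o ∂(obsLaw F) = 0 := by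
        rw [← setIntegral_condExp covSigma_le hi ⟨A, hA, rfl⟩,
          setIntegral_congr_ae (g := fun _ => (0 : ℝ)) (measurable_obs_cov hA)
            (hρ.mono fun _ h _ => h), integral_zero]
      have e2 := integral_resid_mul_indicator H.prop₀ hF.2.2 hA
      have e3 : ∀ o, (1 + s * S o) * resid (fun y u => π y u θ₀) o =
          resid (fun y u => π y u θ₀) o + s * (ratio π θ₀ o * S o) := fun o => by
        rw [show ratio π θ₀ o = resid (fun y u => π y u θ₀) o from rfl]; ring
      simp_rw [e3]
      rw [integral_add (integrable_resid H.prop₀ _).integrableOn (hi.const_mul s).integrableOn,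
        integral_const_mul, e1, e2]; simp)
  exact ⟨m, Eventually.of_forall fun s => by rw [m1], m2⟩

end Scores

/-! ### The submodel that moves `θ` alone, and its score -/

section ThetaScore

variable {𝒰 𝒵 : Type*} [MeasurableSpace 𝒰] [MeasurableSpace 𝒵] {d : ℕ}
  {π : ℝ → 𝒰 → EuclideanSpace ℝ (Fin d) → ℝ} {Θ : Set (EuclideanSpace ℝ (Fin d))}
  {θ₀ : EuclideanSpace ℝ (Fin d)} {c K : ℝ}
  {F : Measure (FullData 𝒰 𝒵)} [IsProbabilityMeasure F]

/-- The conditional odds of treatment given the covariates when the propensity has parameter `θ`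
and the untreated have the conditional outcome law of `F`. -/
noncomputable def covOdds (π : ℝ → 𝒰 → EuclideanSpace ℝ (Fin d) → ℝ)
    (F : Measure (FullData 𝒰 𝒵)) (θ : EuclideanSpace ℝ (Fin d)) (x : 𝒰 × 𝒵) : ℝ :=
  E0untreated F (fun y => odds (fun y u => π y u θ) y x.1) x

/-- The gradient of `covOdds` with respect to the parameter. -/
noncomputable def covOddsGrad (π : ℝ → 𝒰 → EuclideanSpace ℝ (Fin d) → ℝ)
    (F : Measure (FullData 𝒰 𝒵)) (θ : EuclideanSpace ℝ (Fin d)) (x : 𝒰 × 𝒵) :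
    EuclideanSpace ℝ (Fin d) :=
  ∫ y, ((1 - π y x.1 θ)⁻¹ * (1 - π y x.1 θ)⁻¹) • piDot π θ y x.1
    ∂(condDistrib y0 cov (F[|{ω | trt ω = false}]) x)

/-- The score for `θ`. -/
noncomputable def thetaScore (π : ℝ → 𝒰 → EuclideanSpace ℝ (Fin d) → ℝ)
    (F : Measure (FullData 𝒰 𝒵)) (θ : EuclideanSpace ℝ (Fin d)) (o : ObsData 𝒰 𝒵) :
    EuclideanSpace ℝ (Fin d) :=
  (tval o.1 / covOdds π F θ o.2.2 - 1 / (1 + covOdds π F θ o.2.2)) • covOddsGrad π F θ o.2.2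

/-- The deviation is `-(b - a) / (1 + b)` for the untreated and `(b - a) / (a (1 + b))` for the
treated. The factors `1` and `c⁻¹` that bound these are added to cover both arms. -/
lemma abs_density_sub_one_le {a b c L : ℝ} (hc : 0 < c) (ha : c ≤ a) (hb : c ≤ b)
    (hab : |b - a| ≤ L) (t : Bool) :
    |(tval t * (b / a) + (1 - tval t)) * ((1 + a) / (1 + b)) - 1| ≤ (1 + c⁻¹) * L := by
  have ha0 : 0 < a := hc.trans_le ha
  have hb0 : 0 < b := hc.trans_le hb
  have hL : 0 ≤ L := (abs_nonneg _).trans hab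
  have h1 : |(1 + b)⁻¹| ≤ 1 := by
    rw [abs_of_pos (by positivity)]; exact inv_le_one_of_one_le₀ (by linarith)
  have hc' : 0 ≤ c⁻¹ := inv_nonneg.2 hc.le
  cases t
  · have e : (tval false * (b / a) + (1 - tval false)) * ((1 + a) / (1 + b)) - 1
        = - ((1 + b)⁻¹ * (b - a)) := by
      rw [tval_false]; field_simp; ring
    rw [e, abs_neg, abs_mul]
    calc |(1 + b)⁻¹| * |b - a| ≤ 1 * L := mul_le_mul h1 hab (abs_nonneg _) zero_le_one
      _ ≤ _ := by nlinarith
  · have e : (tval true * (b / a) + (1 - tval true)) * ((1 + a) / (1 + b)) - 1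
        = (1 + b)⁻¹ * (a⁻¹ * (b - a)) := by
      rw [tval_true]; field_simp; ring
    have h2 : |a⁻¹| ≤ c⁻¹ := by
      rw [abs_of_pos (by positivity)]; exact inv_anti₀ hc ha
    rw [e, abs_mul, abs_mul]
    calc |(1 + b)⁻¹| * (|a⁻¹| * |b - a|) ≤ 1 * (c⁻¹ * L) := by gcongr
      _ ≤ _ := by nlinarith

namespace SmoothModel

variable (H : SmoothModel π Θ θ₀ c K)
include H

omit [IsProbabilityMeasure F] in
lemma measurable_covOdds {θ : EuclideanSpace ℝ (Fin d)} (hθ : θ ∈ Θ) :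
    Measurable (covOdds π F θ : 𝒰 × 𝒵 → ℝ) :=
  measurable_E0untreated (F := F) (h := fun z => odds (fun y u => π y u θ) z.2 z.1.1)
    ((H.prop θ hθ).measurable_odds.comp measurable_swap)

omit [MeasurableSpace 𝒵] in
lemma integrable_odds_kernel {θ : EuclideanSpace ℝ (Fin d)} (hθ : θ ∈ Θ) (u : 𝒰)
    (μ : Measure ℝ) [IsFiniteMeasure μ] :
    Integrable (fun y => odds (fun y u => π y u θ) y u) μ := by
  have hm : Measurable fun y : ℝ => odds (fun y u => π y u θ) y u :=
    ((H.prop θ hθ).measurable_odds (𝒵 := 𝒰)).comp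
      (measurable_id.prodMk measurable_const : Measurable fun y : ℝ => (y, (u, u)))
  exact Integrable.of_bound hm.aestronglyMeasurable c⁻¹
    (ae_of_all _ fun y => (H.prop θ hθ).abs_odds_le y u)

omit [IsProbabilityMeasure F] in
lemma le_covOdds {θ : EuclideanSpace ℝ (Fin d)} (hθ : θ ∈ Θ) (x : 𝒰 × 𝒵) :
    c ≤ covOdds π F θ x := by
  have := integral_mono (μ := condDistrib y0 cov (F[|{ω | trt ω = false}]) x) (integrable_const c)
    (H.integrable_odds_kernel hθ x.1 _) fun y => (H.prop θ hθ).le_odds y x.1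
  simpa [covOdds, E0untreated] using this

omit [IsProbabilityMeasure F] in
lemma covOdds_pos {θ : EuclideanSpace ℝ (Fin d)} (hθ : θ ∈ Θ) (x : 𝒰 × 𝒵) :
    0 < covOdds π F θ x := H.prop₀.pos.trans_le (H.le_covOdds hθ x)

omit [IsProbabilityMeasure F] in
lemma covOdds_le {θ : EuclideanSpace ℝ (Fin d)} (hθ : θ ∈ Θ) (x : 𝒰 × 𝒵) :
    covOdds π F θ x ≤ c⁻¹ := by
  have := integral_mono (μ := condDistrib y0 cov (F[|{ω | trt ω = false}]) x)
    (H.integrable_odds_kernel hθ x.1 _) (integrable_const c⁻¹)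
    fun y => (H.prop θ hθ).odds_le y x.1
  simpa [covOdds, E0untreated] using this

omit [IsProbabilityMeasure F] in
lemma inner_covOddsGrad (v : EuclideanSpace ℝ (Fin d)) (x : 𝒰 × 𝒵) :
    inner ℝ v (covOddsGrad π F θ₀ x) = E0untreated F (fun y => oddsDeriv π θ₀ v y x.1) x := by
  have hc : 0 ≤ c⁻¹ := inv_nonneg.2 H.prop₀.pos.le
  have hm : Measurable fun y : ℝ =>
      ((1 - π y x.1 θ₀)⁻¹ * (1 - π y x.1 θ₀)⁻¹) • piDot π θ₀ y x.1 := by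
    have h1 : Measurable fun z : ℝ × 𝒰 => (1 - π z.1 z.2 θ₀)⁻¹ :=
      (measurable_const.sub H.prop₀.meas).inv
    have h2 : Measurable fun z : ℝ × 𝒰 =>
        ((1 - π z.1 z.2 θ₀)⁻¹ * (1 - π z.1 z.2 θ₀)⁻¹) • piDot π θ₀ z.1 z.2 :=
      (h1.mul h1).smul H.measurable_piDot
    exact h2.comp (measurable_id.prodMk measurable_const : Measurable fun y : ℝ => (y, x.1))
  have hi : Integrable (fun y => ((1 - π y x.1 θ₀)⁻¹ * (1 - π y x.1 θ₀)⁻¹) • piDot π θ₀ y x.1)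
      (condDistrib y0 cov (F[|{ω | trt ω = false}]) x) := by
    refine Integrable.of_bound hm.aestronglyMeasurable (c⁻¹ * c⁻¹ * K) (ae_of_all _ fun y => ?_)
    rw [norm_smul, norm_mul, Real.norm_eq_abs]
    have h1 := H.prop₀.abs_inv_le y x.1
    have h2 := H.norm_piDot_le y x.1
    gcongr
  rw [covOddsGrad, E0untreated, ← integral_inner hi]
  simp_rw [inner_smul_right, oddsDeriv, mul_assoc]

omit [IsProbabilityMeasure F] in
lemma measurable_inner_covOddsGrad (v : EuclideanSpace ℝ (Fin d)) :
    Measurable fun x : 𝒰 × 𝒵 => inner ℝ v (covOddsGrad π F θ₀ x) := by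
  simp_rw [H.inner_covOddsGrad]
  exact measurable_E0untreated (h := fun z => oddsDeriv π θ₀ v z.2 z.1.1)
    ((H.measurable_oddsDeriv v).comp measurable_swap)

variable {par : ℝ → EuclideanSpace ℝ (Fin d)} {v : EuclideanSpace ℝ (Fin d)}

omit [IsProbabilityMeasure F] in
lemma eventually_covOdds (h0 : par 0 = θ₀) (hv : HasDerivAt par v 0) :
    ∀ᶠ s in 𝓝 (0 : ℝ), par s ∈ Θ ∧ ∀ x : 𝒰 × 𝒵, |covOdds π F (par s) x - covOdds π F θ₀ x|
      ≤ c⁻¹ * (c⁻¹ * (K * (‖v‖ + 1))) * |s| := by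
  filter_upwards [H.eventually_path h0 hv] with s hs
  refine ⟨hs.1, fun x => ?_⟩
  rw [covOdds, covOdds, E0untreated, E0untreated, ← integral_sub
    (H.integrable_odds_kernel hs.1 x.1 _) (H.integrable_odds_kernel H.mem' x.1 _)]
  refine (norm_integral_le_of_norm_le_const
    (μ := condDistrib y0 cov (F[|{ω | trt ω = false}]) x)
    (f := fun y => odds (fun y u => π y u (par s)) y x.1 - odds (fun y u => π y u θ₀) y x.1)
    (C := c⁻¹ * (c⁻¹ * (K * (‖v‖ + 1))) * |s|) (ae_of_all _ fun y => hs.2 y x.1)).trans ?_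
  simp

omit [IsProbabilityMeasure F] in
-- Differentiation under the integral over `Y₀`, dominated by the uniform Lipschitz constant of the
-- odds.
lemma hasDerivAt_covOdds (h0 : par 0 = θ₀) (hv : HasDerivAt par v 0) (x : 𝒰 × 𝒵) :
    HasDerivAt (fun s => covOdds π F (par s) x) (inner ℝ v (covOddsGrad π F θ₀ x)) 0 := by
  set κ := condDistrib y0 cov (F[|{ω | trt ω = false}]) x with hκ
  set L := c⁻¹ * (c⁻¹ * (K * (‖v‖ + 1))) with hL
  have hpath := (H.eventually_path h0 hv).filter_mono (nhdsWithin_le_nhds (s := {0}ᶜ))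
  rw [hasDerivAt_iff_tendsto_slope_zero, H.inner_covOddsGrad]
  have key : Tendsto (fun s => ∫ y, s⁻¹ * (odds (fun y u => π y u (par s)) y x.1 -
      odds (fun y u => π y u θ₀) y x.1) ∂κ) (𝓝[≠] 0) (𝓝 (∫ y, oddsDeriv π θ₀ v y x.1 ∂κ)) := by
    refine tendsto_integral_filter_of_dominated_convergence (fun _ => L) ?_ ?_
      (integrable_const L) (ae_of_all _ fun y => ?_)
    · filter_upwards [hpath] with s hs
      exact (((H.integrable_odds_kernel hs.1 x.1 κ).sub
        (H.integrable_odds_kernel H.mem' x.1 κ)).const_mul s⁻¹).aestronglyMeasurable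
    · filter_upwards [hpath, self_mem_nhdsWithin] with s hs hs0
      have hs0 : s ≠ 0 := hs0
      refine ae_of_all _ fun y => ?_
      rw [Real.norm_eq_abs, abs_mul, abs_inv, inv_mul_le_iff₀ (abs_pos.2 hs0), mul_comm]
      exact hs.2 y x.1
    · have := hasDerivAt_iff_tendsto_slope_zero.1 (H.hasDerivAt_odds h0 hv y x.1)
      simpa [h0] using this
  refine key.congr' ?_
  filter_upwards [hpath] with s hs
  rw [zero_add, h0, integral_const_mul, integral_sub (H.integrable_odds_kernel hs.1 x.1 _)
    (H.integrable_odds_kernel H.mem' x.1 _), smul_eq_mul]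
  rfl

lemma condExp_untreated_odds {θ : EuclideanSpace ℝ (Fin d)} (hθ : θ ∈ Θ) :
    Integrable (fun o : ObsData 𝒰 𝒵 => (1 - tval o.1) *
      odds (fun y u => π y u θ) o.2.1 o.2.2.1) (obsLaw F) ∧
    (obsLaw F)[fun o => (1 - tval o.1) * odds (fun y u => π y u θ) o.2.1 o.2.2.1 | covSigma 𝒰 𝒵]
      =ᵐ[obsLaw F] fun o => (1 - wfun F o.2.2) * covOdds π F θ o.2.2 := by
  have hi : Integrable (fun o : ObsData 𝒰 𝒵 => (1 - tval o.1) *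
      odds (fun y u => π y u θ) o.2.1 o.2.2.1) (obsLaw F) := by
    refine Integrable.of_bound ((measurable_const.sub measurable_tval_fst).mul
      ((H.prop θ hθ).measurable_odds.comp measurable_snd)).aestronglyMeasurable (1 * c⁻¹)
      (ae_of_all _ fun o => ?_)
    rw [Real.norm_eq_abs, abs_mul]
    exact mul_le_mul (abs_one_sub_tval_le _) ((H.prop θ hθ).abs_odds_le _ _) (abs_nonneg _)
      zero_le_one
  exact ⟨hi, condExp_untreated (F := F) (h := fun z => odds (fun y u => π y u θ) z.2 z.1.1)
    ((H.prop θ hθ).measurable_odds.comp measurable_swap) hi⟩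

/-- This is `E(ρ | X) = 0` rewritten: at the true parameter, the mean odds among the untreated are
the conditional odds `w / (1 - w)`. -/
lemma wfun_eq (hF : HasPropensity F fun y u => π y u θ₀) :
    ∀ᵐ o ∂(obsLaw F), wfun F o.2.2 = (1 - wfun F o.2.2) * covOdds π F θ₀ o.2.2 := by
  obtain ⟨hi, h1⟩ := H.condExp_untreated_odds (F := F) H.mem'
  have h2 := condExp_sub (integrable_tval_obs (F := F)) hi (covSigma 𝒰 𝒵)
  have h3 := H.condExp_ratio hF
  rw [show (ratio π θ₀ : ObsData 𝒰 𝒵 → ℝ) = (fun o => tval o.1) - fun o => (1 - tval o.1) *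
    odds (fun y u => π y u θ₀) o.2.1 o.2.2.1 from funext fun o => H.ratio_eq o] at h3
  filter_upwards [h1, h2, h3, condExp_tval (F := F)] with o e1 e2 e3 e4
  rw [e3, Pi.sub_apply, e1, e4] at e2
  linarith

/-- The submodel that moves `θ` and holds the nuisance parts fixed. -/
theorem exists_theta_submodel (hF : InModel π Θ F θ₀)
    (hY : MemLp (fun o : ObsData 𝒰 𝒵 => o.2.1) 2 (obsLaw F)) (v : EuclideanSpace ℝ (Fin d)) :
    ∃ m : RegularSubmodel π Θ F θ₀, m.par = (fun s => θ₀ + s • v) ∧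
      (∀ᶠ s in 𝓝 (0 : ℝ), SameNuisance (obsLaw F) (obsLaw (m.law s))) ∧
      m.score = fun o => inner ℝ v (thetaScore π F θ₀ o) := by
  set par : ℝ → EuclideanSpace ℝ (Fin d) := fun s => θ₀ + s • v with hpardef
  have hpar0 : par 0 = θ₀ := by simp [hpardef]
  have hder : HasDerivAt par v 0 := by
    have h := ((hasDerivAt_id (0 : ℝ)).smul_const v).const_add θ₀
    rwa [one_smul] at h
  set b : ℝ → 𝒰 × 𝒵 → ℝ := fun s => covOdds π F (par s) with hb
  have hb0 : b 0 = covOdds π F θ₀ := by simp only [hb, hpar0]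
  -- With the outcome laws given `(X, T)` fixed, the moment restriction at `par s` forces the
  -- conditional odds of treatment to be `b s`. Hence `pr(T = 1 | x)` is `b s / (1 + b s)`, and `r
  -- s` is the ratio of the new to the old treatment probabilities in each arm.
  set r : ℝ → ObsData 𝒰 𝒵 → ℝ := fun s o =>
    (tval o.1 * (b s o.2.2 / b 0 o.2.2) + (1 - tval o.1)) * ((1 + b 0 o.2.2) / (1 + b s o.2.2))
    with hr
  set L := c⁻¹ * (c⁻¹ * (K * (‖v‖ + 1))) with hL
  have hpath := H.eventually_covOdds (F := F) hpar0 hder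
  have hpar : ∀ᶠ s in 𝓝 (0 : ℝ), par s ∈ Θ := hpath.mono fun s h => h.1
  have hb0m : Measurable (b 0) := by rw [hb0]; exact H.measurable_covOdds H.mem'
  have hb0pos : ∀ x, 0 < b 0 x := fun x => by rw [hb0]; exact H.covOdds_pos H.mem' x
  have hbpos : ∀ s, par s ∈ Θ → ∀ x, 0 < b s x := fun s hs x => H.covOdds_pos hs x
  have hbm : ∀ s, par s ∈ Θ → Measurable (b s) := fun s hs => H.measurable_covOdds hs
  have hrm' : ∀ s, par s ∈ Θ → Measurable fun z : Bool × (𝒰 × 𝒵) =>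
      (tval z.1 * (b s z.2 / b 0 z.2) + (1 - tval z.1)) * ((1 + b 0 z.2) / (1 + b s z.2)) :=
      fun s hs => by
    have h1 : Measurable fun z : Bool × (𝒰 × 𝒵) => b s z.2 := (hbm s hs).comp measurable_snd
    have h2 : Measurable fun z : Bool × (𝒰 × 𝒵) => b 0 z.2 := hb0m.comp measurable_snd
    have h3 : Measurable fun z : Bool × (𝒰 × 𝒵) => tval z.1 := measurable_tval.comp measurable_fst
    exact ((h3.mul (h1.div h2)).add (measurable_const.sub h3)).mul
      ((h2.const_add 1).div (h1.const_add 1))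
  have hrm : ∀ s, par s ∈ Θ → Measurable (r s) := fun s hs =>
    (hrm' s hs).comp (measurable_fst.prodMk measurable_obs_cov)
  -- conditional moments of the densities
  have hw := H.wfun_eq (F := F) hF.2.2
  have hg : ∀ s, par s ∈ Θ → ∀ x, |(1 + b 0 x) / (1 + b s x)| ≤ 1 + c⁻¹ ∧
      |b s x / b 0 x * ((1 + b 0 x) / (1 + b s x))| ≤ c⁻¹ * c⁻¹ * (1 + c⁻¹) := fun s hs x => by
    have h1 := hb0pos x
    have h2 := hbpos s hs x
    have h3 : b 0 x ≤ c⁻¹ := by rw [hb0]; exact H.covOdds_le H.mem' x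
    have h4 : b s x ≤ c⁻¹ := H.covOdds_le hs x
    have h5 : (b 0 x)⁻¹ ≤ c⁻¹ := by
      rw [hb0]; exact inv_anti₀ H.prop₀.pos (H.le_covOdds H.mem' x)
    have h6 : (1 + b s x)⁻¹ ≤ 1 := inv_le_one_of_one_le₀ (by linarith)
    have hc : 0 ≤ c⁻¹ := inv_nonneg.2 H.prop₀.pos.le
    have h7 : |(1 + b 0 x) / (1 + b s x)| ≤ 1 + c⁻¹ := by
      rw [abs_of_pos (by positivity), div_le_iff₀ (by positivity)]
      nlinarith
    refine ⟨h7, ?_⟩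
    rw [abs_mul, abs_of_pos (show 0 < b s x / b 0 x by positivity), div_eq_mul_inv]
    gcongr
  have hg1m : ∀ s, par s ∈ Θ → Measurable fun x => b s x / b 0 x * ((1 + b 0 x) / (1 + b s x)) :=
    fun s hs => ((hbm s hs).div hb0m).mul ((hb0m.const_add 1).div ((hbm s hs).const_add 1))
  have hg0m : ∀ s, par s ∈ Θ → Measurable fun x => (1 + b 0 x) / (1 + b s x) :=
    fun s hs => (hb0m.const_add 1).div ((hbm s hs).const_add 1)
  have iT := integrable_tval_obs (F := F)
  have iT1 : ∀ s, par s ∈ Θ → Integrable (fun o : ObsData 𝒰 𝒵 => tval o.1 *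
      (b s o.2.2 / b 0 o.2.2 * ((1 + b 0 o.2.2) / (1 + b s o.2.2)))) (obsLaw F) := fun s hs =>
    (iT.bdd_mul (c := c⁻¹ * c⁻¹ * (1 + c⁻¹)) ((hg1m s hs).comp
      measurable_obs_cov).aestronglyMeasurable (ae_of_all _ fun o => (hg s hs o.2.2).2)).congr
      (ae_of_all _ fun o => mul_comm _ _)
  have iT0 : ∀ s, par s ∈ Θ → ∀ f : ObsData 𝒰 𝒵 → ℝ, Integrable f (obsLaw F) →
      Integrable (fun o : ObsData 𝒰 𝒵 => f o * ((1 + b 0 o.2.2) / (1 + b s o.2.2))) (obsLaw F) :=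
    fun s hs f hf => (hf.bdd_mul (c := 1 + c⁻¹) ((hg0m s hs).comp
      measurable_obs_cov).aestronglyMeasurable (ae_of_all _ fun o => (hg s hs o.2.2).1)).congr
      (ae_of_all _ fun o => mul_comm _ _)
  have i1T : Integrable (fun o : ObsData 𝒰 𝒵 => 1 - tval o.1) (obsLaw F) :=
    (integrable_const _).sub iT
  -- Conditional mean one says that the law of `X` is unchanged, and in particular that the total
  -- mass is one.
  have hcondr : ∀ s, par s ∈ Θ → Integrable (r s) (obsLaw F) ∧
      (obsLaw F)[r s | covSigma 𝒰 𝒵] =ᵐ[obsLaw F] fun _ => 1 := fun s hs => by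
    have h1 := condExp_mul_cov (P := obsLaw F) iT condExp_tval (hg1m s hs) (iT1 s hs)
    have h2 := condExp_mul_cov (P := obsLaw F) i1T (k := fun x => 1 - wfun F x)
      condExp_one_sub_tval (hg0m s hs) (iT0 s hs _ i1T)
    have h3 := condExp_add (iT1 s hs) (iT0 s hs _ i1T) (covSigma 𝒰 𝒵)
    have e : r s = (fun o : ObsData 𝒰 𝒵 => tval o.1 *
      (b s o.2.2 / b 0 o.2.2 * ((1 + b 0 o.2.2) / (1 + b s o.2.2)))) +
      fun o => (1 - tval o.1) * ((1 + b 0 o.2.2) / (1 + b s o.2.2)) := by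
      ext o; simp only [hr, Pi.add_apply]; ring
    rw [e]
    refine ⟨(iT1 s hs).add (iT0 s hs _ i1T), ?_⟩
    filter_upwards [h1, h2, h3, hw] with o e1 e2 e3 e4
    rw [e3, Pi.add_apply, e1, e2]
    rw [← hb0] at e4
    have p1 := (hb0pos o.2.2).ne'
    have p2 : 1 + b s o.2.2 ≠ 0 := by linarith [hbpos s hs o.2.2]
    have e5 : wfun F o.2.2 / b 0 o.2.2 = 1 - wfun F o.2.2 := by
      rw [div_eq_iff p1]; exact e4
    calc wfun F o.2.2 * (b s o.2.2 / b 0 o.2.2 * ((1 + b 0 o.2.2) / (1 + b s o.2.2))) +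
          (1 - wfun F o.2.2) * ((1 + b 0 o.2.2) / (1 + b s o.2.2))
        = (wfun F o.2.2 / b 0 o.2.2 * b s o.2.2 + (1 - wfun F o.2.2)) *
          ((1 + b 0 o.2.2) / (1 + b s o.2.2)) := by ring
      _ = ((1 - wfun F o.2.2) + (1 - wfun F o.2.2) * b 0 o.2.2) *
          ((1 + b s o.2.2) / (1 + b s o.2.2)) := by rw [e5]; ring
      _ = 1 := by rw [div_self p2, ← e4]; ring
  -- The moment restriction for the tilted law at the moved parameter: given `X`, both arms
  -- contribute `(1 - w) b s (1 + b 0) / (1 + b s)`, with opposite signs.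
  have hcondρ : ∀ s, par s ∈ Θ → Integrable (fun o => r s o * resid (fun y u => π y u (par s)) o)
      (obsLaw F) ∧ (obsLaw F)[fun o => r s o * resid (fun y u => π y u (par s)) o | covSigma 𝒰 𝒵]
        =ᵐ[obsLaw F] fun _ => 0 := fun s hs => by
    obtain ⟨i2, hodd⟩ := H.condExp_untreated_odds (F := F) hs
    have h1 := condExp_mul_cov (P := obsLaw F) iT condExp_tval (hg1m s hs) (iT1 s hs)
    have h2 := condExp_mul_cov (P := obsLaw F) i2 (k := fun x => (1 - wfun F x) * b s x)
      hodd (hg0m s hs) (iT0 s hs _ i2)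
    have h3 := condExp_sub (iT1 s hs) (iT0 s hs _ i2) (covSigma 𝒰 𝒵)
    have e : (fun o => r s o * resid (fun y u => π y u (par s)) o) = (fun o : ObsData 𝒰 𝒵 =>
      tval o.1 * (b s o.2.2 / b 0 o.2.2 * ((1 + b 0 o.2.2) / (1 + b s o.2.2)))) -
      fun o => (1 - tval o.1) * odds (fun y u => π y u (par s)) o.2.1 o.2.2.1 *
        ((1 + b 0 o.2.2) / (1 + b s o.2.2)) := by
      ext ⟨t, y, x⟩
      simp only [hr, Pi.sub_apply, (H.prop _ hs).resid_eq]
      cases t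
      · simp only [tval_false]; ring
      · simp only [tval_true]; ring
    rw [e]
    refine ⟨(iT1 s hs).sub (iT0 s hs _ i2), ?_⟩
    filter_upwards [h1, h2, h3, hw] with o e1 e2 e3 e4
    rw [e3, Pi.sub_apply, e1, e2]
    rw [← hb0] at e4
    have p1 := (hb0pos o.2.2).ne'
    have e5 : wfun F o.2.2 / b 0 o.2.2 = 1 - wfun F o.2.2 := by
      rw [div_eq_iff p1]; exact e4
    calc wfun F o.2.2 * (b s o.2.2 / b 0 o.2.2 * ((1 + b 0 o.2.2) / (1 + b s o.2.2))) -
          (1 - wfun F o.2.2) * b s o.2.2 * ((1 + b 0 o.2.2) / (1 + b s o.2.2))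
        = (wfun F o.2.2 / b 0 o.2.2 - (1 - wfun F o.2.2)) * b s o.2.2 *
          ((1 + b 0 o.2.2) / (1 + b s o.2.2)) := by ring
      _ = 0 := by rw [e5]; ring
  have hsetr : ∀ s, par s ∈ Θ → ∀ A : Set (𝒰 × 𝒵), MeasurableSet A →
      ∫ o in (fun o : ObsData 𝒰 𝒵 => o.2.2) ⁻¹' A, r s o ∂(obsLaw F) =
        (obsLaw F).real ((fun o : ObsData 𝒰 𝒵 => o.2.2) ⁻¹' A) := fun s hs A hA => by
    rw [← setIntegral_condExp covSigma_le (hcondr s hs).1 ⟨A, hA, rfl⟩,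
      setIntegral_congr_ae (g := fun _ => (1 : ℝ)) (measurable_obs_cov hA)
        ((hcondr s hs).2.mono fun _ h _ => h)]
    simp
  have hSm : Measurable fun o : ObsData 𝒰 𝒵 => inner ℝ v (thetaScore π F θ₀ o) := by
    simp only [thetaScore, inner_smul_right, ← hb0]
    exact ((measurable_tval_fst.div (hb0m.comp measurable_obs_cov)).sub
      ((hb0m.comp measurable_obs_cov).const_add 1 |>.const_div 1)).mul
      ((H.measurable_inner_covOddsGrad v).comp measurable_obs_cov)
  obtain ⟨m, m1, m2, m3⟩ := exists_regularSubmodel_of_density H hF hY hpar0 hder (r := r)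
    (S := fun o => inner ℝ v (thetaScore π F θ₀ o)) (C := (1 + c⁻¹) * L)
    (hpar.mono hrm) hSm
    (fun o => by
      have p1 := (hb0pos o.2.2).ne'
      have p2 : 1 + b 0 o.2.2 ≠ 0 := by linarith [hb0pos o.2.2]
      simp only [hr]
      rw [div_self p1, div_self p2]; ring)
    (by
      filter_upwards [hpath] with s hs o
      have h1 := abs_density_sub_one_le H.prop₀.pos (a := b 0 o.2.2) (b := b s o.2.2) (L := L * |s|)
        (by rw [hb0]; exact H.le_covOdds H.mem' _) (H.le_covOdds hs.1 _)
        (by rw [hb0]; exact hs.2 o.2.2) o.1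
      rw [mul_assoc]
      exact h1)
    (fun o => by
      have p1 := (hb0pos o.2.2).ne'
      have p2 : 1 + b 0 o.2.2 ≠ 0 := by linarith [hb0pos o.2.2]
      have h1 : HasDerivAt (fun s => b s o.2.2) (inner ℝ v (covOddsGrad π F θ₀ o.2.2)) 0 :=
        H.hasDerivAt_covOdds hpar0 hder o.2.2
      have h2 := (((h1.div_const (b 0 o.2.2)).const_mul (tval o.1)).add_const (1 - tval o.1)).mul
        (((hasDerivAt_const (0 : ℝ) (1 + b 0 o.2.2))).div (h1.const_add 1) p2)
      refine h2.congr_deriv ?_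
      simp only [thetaScore, inner_smul_right, ← hb0, Pi.div_apply]
      field_simp
      ring)
    (by
      filter_upwards [hpar] with s hs
      have := hsetr s hs Set.univ MeasurableSet.univ
      simpa using this)
    (by
      filter_upwards [hpar] with s hs A hA
      rw [← setIntegral_condExp covSigma_le (hcondρ s hs).1 ⟨A, hA, rfl⟩,
        setIntegral_congr_ae (g := fun _ => (0 : ℝ)) (measurable_obs_cov hA)
          ((hcondρ s hs).2.mono fun _ h _ => h), integral_zero])
  refine ⟨m, m1, ?_, m2⟩
  filter_upwards [m3, hpar] with s hs hs'
  -- The density depends on `(t, x)` only, so the outcome laws given `(X, T)` are retained; the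
  -- marginal of `X` remains to be compared.
  refine ⟨?_, _, (hrm' s hs').ennreal_ofReal, hs.2.2⟩
  ext A hA
  rw [Measure.map_apply measurable_obs_cov hA, Measure.map_apply measurable_obs_cov hA, hs.2.2,
    withDensity_ofReal_apply hs.1 hs.2.1 (measurable_obs_cov hA), hsetr s hs' A hA,
    ofReal_measureReal]

end SmoothModel

end ThetaScore

/-! ### Orthogonality in `L²` -/

section Orthogonality

lemma inner_toLp {Ω : Type*} [MeasurableSpace Ω] {μ : Measure Ω} {f g : Ω → ℝ}
    (hf : MemLp f 2 μ) (hg : MemLp g 2 μ) :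
    inner ℝ (hf.toLp f) (hg.toLp g) = ∫ o, f o * g o ∂μ := by
  rw [L2.inner_def]
  refine integral_congr_ae ?_
  filter_upwards [hf.coeFn_toLp, hg.coeFn_toLp] with o e1 e2
  rw [e1, e2, RCLike.inner_apply, conj_trivial, mul_comm]

lemma mem_orthogonal_closure_span {E : Type*} [NormedAddCommGroup E] [InnerProductSpace ℝ E]
    {s : Set E} {x : E} (h : ∀ y ∈ s, inner ℝ y x = 0) :
    x ∈ ((Submodule.span ℝ s).topologicalClosure)ᗮ := by
  rw [Submodule.orthogonal_closure, Submodule.mem_orthogonal]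
  intro u hu
  have : Submodule.span ℝ s ≤ (Submodule.span ℝ {x})ᗮ :=
    Submodule.span_le.2 fun y hy => Submodule.mem_orthogonal_singleton_iff_inner_left.2 (h y hy)
  exact Submodule.mem_orthogonal_singleton_iff_inner_left.1 (this hu)

end Orthogonality

/-! ### Characterisation of the nuisance tangent space by duality -/

section NuisanceTangentSpace

variable {𝒰 𝒵 : Type*} [MeasurableSpace 𝒰] [MeasurableSpace 𝒵] {d : ℕ}
  {π : ℝ → 𝒰 → EuclideanSpace ℝ (Fin d) → ℝ} {Θ : Set (EuclideanSpace ℝ (Fin d))}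
  {θ₀ : EuclideanSpace ℝ (Fin d)} {c K : ℝ}
  {F : Measure (FullData 𝒰 𝒵)}

lemma exists_condExp_eq_comp_cov (P : Measure (ObsData 𝒰 𝒵)) (f : ObsData 𝒰 𝒵 → ℝ) :
    ∃ k : 𝒰 × 𝒵 → ℝ, Measurable k ∧ P[f | covSigma 𝒰 𝒵] = fun o => k o.2.2 := by
  obtain ⟨k, hk, h⟩ := (stronglyMeasurable_condExp (m := covSigma 𝒰 𝒵) (f := f)
    (μ := P)).exists_eq_measurable_comp
  exact ⟨k, hk.measurable, h⟩

/-- A conditional mean of a bounded function is bounded almost everywhere only. Clipping gives a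
version bounded everywhere, as is needed for `1 + s S` to be a nonnegative density. -/
lemma exists_bounded_condExp (f : ObsData 𝒰 𝒵 → ℝ) {R : ℝ} (hR : 0 ≤ R) (hf : ∀ o, |f o| ≤ R) :
    ∃ k : 𝒰 × 𝒵 → ℝ, Measurable k ∧ (∀ x, |k x| ≤ R) ∧
      (obsLaw F)[f | covSigma 𝒰 𝒵] =ᵐ[obsLaw F] fun o => k o.2.2 := by
  obtain ⟨k, hk, hfk⟩ := exists_condExp_eq_comp_cov (obsLaw F) f
  refine ⟨fun x => max (-R) (min R (k x)), measurable_const.max (measurable_const.min hk),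
    fun x => abs_le.2 ⟨le_max_left _ _, max_le (by linarith) (min_le_left _ _)⟩, ?_⟩
  have hb := ae_bdd_abs_condExp_of_ae_bdd_abs (m := covSigma 𝒰 𝒵) (μ := obsLaw F)
    (ae_of_all _ hf)
  rw [hfk] at hb ⊢
  filter_upwards [hb] with o ho
  have h2 := abs_le.1 ho
  rw [min_eq_right h2.2, max_eq_right h2.1]

namespace SmoothModel

variable [IsProbabilityMeasure F] (H : SmoothModel π Θ θ₀ c K)
include H

/-- A function that is orthogonal to the scores of all nuisance submodels is, up to a constant,
the residual ratio times a function of the covariates. -/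
lemma eq_ratio_mul_cov (hF : InModel π Θ F θ₀)
    (hY : MemLp (fun o : ObsData 𝒰 𝒵 => o.2.1) 2 (obsLaw F)) {f : ObsData 𝒰 𝒵 → ℝ}
    (hf : MemLp f 2 (obsLaw F))
    (horth : ∀ m : RegularSubmodel π Θ F θ₀, (∀ᶠ s in 𝓝 (0 : ℝ), m.par s = θ₀) →
      ∫ o, m.score o * f o ∂(obsLaw F) = 0) :
    ∃ k : 𝒰 × 𝒵 → ℝ, Measurable k ∧ MemLp (fun o => k o.2.2) 2 (obsLaw F) ∧
      f =ᵐ[obsLaw F] fun o => (∫ o, f o ∂(obsLaw F)) + ratio π θ₀ o * k o.2.2 := by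
  have hρf := H.memLp_ratio_mul hf
  have hc0 : 0 ≤ c⁻¹ := inv_nonneg.2 H.prop₀.pos.le
  obtain ⟨kf, hkf, hkfe⟩ := exists_condExp_eq_comp_cov (obsLaw F) fun o => ratio π θ₀ o * f o
  have hkf2 : MemLp (fun o : ObsData 𝒰 𝒵 => kf o.2.2) 2 (obsLaw F) := by
    rw [← hkfe]; exact hρf.condExp one_le_two
  have hk : Measurable fun x : 𝒰 × 𝒵 => (Bfun π θ₀ F x)⁻¹ * kf x := H.measurable_Bfun.inv.mul hkf
  have hk2 : MemLp (fun o : ObsData 𝒰 𝒵 => (Bfun π θ₀ F o.2.2)⁻¹ * kf o.2.2) 2 (obsLaw F) :=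
    MemLp.of_le_mul (c := c⁻¹) hkf2 (hk.comp measurable_obs_cov).aestronglyMeasurable
      (ae_of_all _ fun o => by
        rw [norm_mul]
        exact mul_le_mul_of_nonneg_right (H.inv_Bfun_le _) (norm_nonneg _))
  refine ⟨fun x => (Bfun π θ₀ F x)⁻¹ * kf x, hk, hk2, ?_⟩
  set a := ∫ o, f o ∂(obsLaw F) with ha
  have hfi : Integrable f (obsLaw F) := hf.integrable one_le_two
  have hρk := H.memLp_ratio_mul hk2
  have hρki := hρk.integrable one_le_two
  suffices h : (fun o => f o - a - ratio π θ₀ o * ((Bfun π θ₀ F o.2.2)⁻¹ * kf o.2.2))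
      =ᵐ[obsLaw F] 0 by
    filter_upwards [h] with o ho
    simp only [Pi.zero_apply] at ho
    linarith
  refine Integrable.ae_eq_zero_of_forall_setIntegral_eq_zero
    ((hfi.sub (integrable_const a)).sub hρki) fun A hA _ => ?_
  set χ : ObsData 𝒰 𝒵 → ℝ := A.indicator 1 with hχ
  have hχm : Measurable χ := measurable_one.indicator hA
  have hχ1 : ∀ o, |χ o| ≤ 1 := fun o => by
    by_cases h : o ∈ A <;> simp [hχ, h]
  have hχ2 : MemLp χ 2 (obsLaw F) := MemLp.of_bound hχm.aestronglyMeasurable 1 (ae_of_all _ hχ1)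
  have hρχ := H.memLp_ratio_mul hχ2
  have hρχi := hρχ.integrable one_le_two
  obtain ⟨kh, hkh, hkhb, hkhe⟩ := exists_bounded_condExp (F := F)
    (fun o => ratio π θ₀ o * χ o) hc0 (fun o => by
      rw [abs_mul]
      exact (mul_le_mul (H.abs_ratio_le o) (hχ1 o) (abs_nonneg _) hc0).trans_eq (mul_one _))
  have hg : Measurable fun x : 𝒰 × 𝒵 => (Bfun π θ₀ F x)⁻¹ * kh x := H.measurable_Bfun.inv.mul hkh
  have hgb : ∀ x : 𝒰 × 𝒵, |(Bfun π θ₀ F x)⁻¹ * kh x| ≤ c⁻¹ * c⁻¹ := fun x => by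
    rw [abs_mul]; exact mul_le_mul (H.inv_Bfun_le x) (hkhb x) (abs_nonneg _) hc0
  have hg2 : MemLp (fun o : ObsData 𝒰 𝒵 => (Bfun π θ₀ F o.2.2)⁻¹ * kh o.2.2) 2 (obsLaw F) :=
    MemLp.of_bound (hg.comp measurable_obs_cov).aestronglyMeasurable _
      (ae_of_all _ fun o => hgb o.2.2)
  have hρg := H.memLp_ratio_mul hg2
  have hρgi := hρg.integrable one_le_two
  -- The test score is the indicator of `A`, centred and with its component `ρ E(ρ χ | X) / B`
  -- removed. It is bounded, has mean zero and satisfies `E(ρ S | X) = 0` because `E(ρ² | X) = B`.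
  set S : ObsData 𝒰 𝒵 → ℝ := fun o => χ o - (obsLaw F).real A
    - ratio π θ₀ o * ((Bfun π θ₀ F o.2.2)⁻¹ * kh o.2.2) with hS
  have hSm : Measurable S :=
    (hχm.sub_const _).sub (H.measurable_ratio.mul (hg.comp measurable_obs_cov))
  have hSb : ∀ o, |S o| ≤ 1 + 1 + c⁻¹ * (c⁻¹ * c⁻¹) := fun o => by
    refine (abs_sub _ _).trans (add_le_add ((abs_sub _ _).trans (add_le_add (hχ1 o) ?_)) ?_)
    · rw [abs_of_nonneg measureReal_nonneg]; exact measureReal_le_one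
    · rw [abs_mul]; exact mul_le_mul (H.abs_ratio_le o) (hgb _) (abs_nonneg _) hc0
  have hχint : ∫ o, χ o ∂(obsLaw F) = (obsLaw F).real A := integral_indicator_one hA
  have hχi := hχ2.integrable one_le_two
  have hS0 : ∫ o, S o ∂(obsLaw F) = 0 := by
    have i1 : Integrable (fun o => χ o - (obsLaw F).real A) (obsLaw F) :=
      hχi.sub (integrable_const _)
    simp only [hS]
    rw [integral_sub i1 hρgi, integral_sub hχi (integrable_const _),
      hχint, H.integral_ratio_mul_cov hF.2.2 hg hρgi]
    simp
  have hρρ := (H.memLp_ratio_mul (f := ratio π θ₀) (μ := obsLaw F)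
    (MemLp.of_bound H.measurable_ratio.aestronglyMeasurable c⁻¹
      (ae_of_all _ H.abs_ratio_le))).integrable one_le_two
  have hρρg : Integrable (fun o => ratio π θ₀ o * ratio π θ₀ o *
      ((Bfun π θ₀ F o.2.2)⁻¹ * kh o.2.2)) (obsLaw F) :=
    ((H.memLp_ratio_mul hρg).integrable one_le_two).congr
      (ae_of_all _ fun o => (mul_assoc _ _ _).symm)
  have hSc : (obsLaw F)[fun o => ratio π θ₀ o * S o | covSigma 𝒰 𝒵] =ᵐ[obsLaw F] fun _ => 0 := by
    have e : (fun o => ratio π θ₀ o * S o) = ((fun o => ratio π θ₀ o * χ o)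
        - (obsLaw F).real A • ratio π θ₀) - fun o => ratio π θ₀ o * ratio π θ₀ o *
          ((Bfun π θ₀ F o.2.2)⁻¹ * kh o.2.2) := by
      ext o
      simp only [hS, Pi.sub_apply, Pi.smul_apply, smul_eq_mul]
      ring
    have hρi := H.integrable_ratio (F := F)
    have h1 := condExp_sub (hρχi.sub (hρi.smul ((obsLaw F).real A))) hρρg (covSigma 𝒰 𝒵)
    have h2 := condExp_sub hρχi (hρi.smul ((obsLaw F).real A)) (covSigma 𝒰 𝒵)
    have h3 := condExp_smul ((obsLaw F).real A) (μ := obsLaw F) (ratio π θ₀) (covSigma 𝒰 𝒵)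
    have h4 := condExp_mul_cov hρρ (H.condExp_ratio_sq hF.2.2) hg hρρg
    rw [e]
    filter_upwards [h1, h2, h3, h4, hkhe, H.condExp_ratio hF.2.2] with o e1 e2 e3 e4 e5 e6
    rw [e1, Pi.sub_apply, e2, Pi.sub_apply, e3, Pi.smul_apply, e4, e5, e6, ← mul_assoc,
      mul_inv_cancel₀ (H.Bfun_pos o.2.2).ne']
    simp
  obtain ⟨m, hm, hmS⟩ := exists_regularSubmodel_of_bounded H hF hY hSm hSb hS0 hSc
  have h0 := horth m hm
  rw [hmS] at h0
  have hχf := integrable_mul_of_memLp hχ2 hf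
  have hgf : Integrable (fun o => ratio π θ₀ o * f o * ((Bfun π θ₀ F o.2.2)⁻¹ * kh o.2.2))
      (obsLaw F) := integrable_mul_of_memLp hρf hg2
  have hkχ : Integrable (fun o => ratio π θ₀ o * χ o * ((Bfun π θ₀ F o.2.2)⁻¹ * kf o.2.2))
      (obsLaw F) := integrable_mul_of_memLp hρχ hk2
  have i1 := (integral_mul_cov (hρf.integrable one_le_two) (EventuallyEq.of_eq hkfe) hg hgf).2
  have i2 := (integral_mul_cov hρχi hkhe hk hkχ).2
  have i3 : ∫ o, S o * f o ∂(obsLaw F) = ∫ o, χ o * f o ∂(obsLaw F)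
      - (obsLaw F).real A * a - ∫ o, ratio π θ₀ o * f o *
        ((Bfun π θ₀ F o.2.2)⁻¹ * kh o.2.2) ∂(obsLaw F) := by
    have j : Integrable (fun o => χ o * f o - (obsLaw F).real A * f o) (obsLaw F) :=
      hχf.sub (hfi.const_mul _)
    rw [ha, ← integral_const_mul, ← integral_sub hχf (hfi.const_mul _), ← integral_sub j hgf]
    refine integral_congr_ae (ae_of_all _ fun o => ?_)
    simp only [hS]; ring
  have i4 : ∫ o in A, (f o - a - ratio π θ₀ o * ((Bfun π θ₀ F o.2.2)⁻¹ * kf o.2.2)) ∂(obsLaw F)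
      = ∫ o, χ o * f o ∂(obsLaw F) - (obsLaw F).real A * a
        - ∫ o, ratio π θ₀ o * χ o * ((Bfun π θ₀ F o.2.2)⁻¹ * kf o.2.2) ∂(obsLaw F) := by
    have j : Integrable (fun o => χ o * f o - χ o * a) (obsLaw F) := hχf.sub (hχi.mul_const _)
    rw [← hχint, ← integral_mul_const, ← integral_sub hχf (hχi.mul_const _),
      ← integral_sub j hkχ, ← integral_indicator hA]
    refine integral_congr_ae (ae_of_all _ fun o => ?_)
    by_cases h : o ∈ A <;> simp [hχ, h]
  -- The map `f ↦ ρ E(ρ f | X) / B` is self-adjoint. Orthogonality of `f` to the projected indicator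
  -- is therefore the vanishing of the integral over `A` of the projected `f`.
  have i5 : ∫ o, kf o.2.2 * ((Bfun π θ₀ F o.2.2)⁻¹ * kh o.2.2) ∂(obsLaw F)
      = ∫ o, kh o.2.2 * ((Bfun π θ₀ F o.2.2)⁻¹ * kf o.2.2) ∂(obsLaw F) :=
    integral_congr_ae (ae_of_all _ fun o => by simp only; ring)
  rw [i4]
  linarith

/-- The nuisance tangent space contains every square-integrable function with mean zero whose
product with the residual ratio has conditional mean zero given the covariates. -/
theorem toLp_mem_nuisanceTangentSpace (hF : InModel π Θ F θ₀)
    (hY : MemLp (fun o : ObsData 𝒰 𝒵 => o.2.1) 2 (obsLaw F)) {S : ObsData 𝒰 𝒵 → ℝ}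
    (hS : MemLp S 2 (obsLaw F)) (h0 : ∫ o, S o ∂(obsLaw F) = 0)
    (hρ : (obsLaw F)[fun o => ratio π θ₀ o * S o | covSigma 𝒰 𝒵] =ᵐ[obsLaw F] fun _ => 0) :
    hS.toLp S ∈ nuisanceTangentSpace π Θ F θ₀ := by
  have hcl : IsClosed (nuisanceTangentSpace π Θ F θ₀ : Set (Lp ℝ 2 (obsLaw F))) :=
    Submodule.isClosed_topologicalClosure _
  have : CompleteSpace (nuisanceTangentSpace π Θ F θ₀) := hcl.completeSpace_coe
  -- The space is closed, so it equals its double orthogonal complement. Elements of the complement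
  -- have the form `a + ρ k(X)`, and `S` is orthogonal to each of the two summands.
  rw [← Submodule.orthogonal_orthogonal (nuisanceTangentSpace π Θ F θ₀), Submodule.mem_orthogonal]
  intro u hu
  obtain ⟨f, hf, rfl⟩ : ∃ (f : ObsData 𝒰 𝒵 → ℝ) (hf : MemLp f 2 (obsLaw F)), hf.toLp f = u :=
    ⟨u, Lp.memLp u, Lp.toLp_coeFn u _⟩
  obtain ⟨k, hk, hk2, hfk⟩ := H.eq_ratio_mul_cov hF hY hf fun m hm => by
    rw [← inner_toLp m.score_memLp hf]
    exact (Submodule.mem_orthogonal _ _).1 hu _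
      (Submodule.le_topologicalClosure _ (Submodule.subset_span ⟨m, hm, rfl⟩))
  set a := ∫ o, f o ∂(obsLaw F)
  have hρS := H.memLp_ratio_mul hS
  have hi : Integrable (fun o => ratio π θ₀ o * S o * k o.2.2) (obsLaw F) :=
    integrable_mul_of_memLp hρS hk2
  have h1 := (integral_mul_cov (k := fun _ => 0) (hρS.integrable one_le_two) hρ hk hi).2
  rw [inner_toLp, integral_congr_ae (g := fun o => a * S o + ratio π θ₀ o * S o * k o.2.2)
    (by filter_upwards [hfk] with o ho; rw [ho]; ring),
    integral_add ((hS.integrable one_le_two).const_mul a) hi, integral_const_mul, h0, h1]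
  simp

end SmoothModel

end NuisanceTangentSpace

/-! ### The efficient score and the efficient influence function -/

section EfficientInfluence

variable {𝒰 𝒵 : Type*} [MeasurableSpace 𝒰] [MeasurableSpace 𝒵] {d : ℕ}
  {π : ℝ → 𝒰 → EuclideanSpace ℝ (Fin d) → ℝ} {Θ : Set (EuclideanSpace ℝ (Fin d))}
  {θ₀ : EuclideanSpace ℝ (Fin d)} {c K : ℝ}
  {F : Measure (FullData 𝒰 𝒵)} [IsProbabilityMeasure F]

omit [IsProbabilityMeasure F] in
lemma RegularSubmodel.dir_eq (m : RegularSubmodel π Θ F θ₀) {v : EuclideanSpace ℝ (Fin d)}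
    (h : ∀ᶠ s in 𝓝 (0 : ℝ), m.par s = θ₀ + s • v) : m.dir = v := by
  have h1 := ((hasDerivAt_id (0 : ℝ)).smul_const v).const_add θ₀
  rw [one_smul] at h1
  exact m.par_deriv.unique (h1.congr_of_eventuallyEq h)

lemma memLp_tval : MemLp (fun o : ObsData 𝒰 𝒵 => tval o.1) 2 (obsLaw F) :=
  MemLp.of_bound measurable_tval_fst.aestronglyMeasurable 1 (ae_of_all _ fun o => by
    rw [Real.norm_eq_abs, abs_of_nonneg (tval_nonneg _)]; exact tval_le_one _)

lemma inner_Seff (v : EuclideanSpace ℝ (Fin d)) (o : ObsData 𝒰 𝒵) :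
    inner ℝ v (Seff π θ₀ F o) =
      ratio π θ₀ o * ((Bfun π θ₀ F o.2.2)⁻¹ * inner ℝ v (Afun π θ₀ F o.2.2)) := by
  rw [Seff, inner_smul_right, mul_assoc]

lemma phi_eq (o : ObsData 𝒰 𝒵) : phi π θ₀ F o = (pTreat F)⁻¹ * (ratio π θ₀ o * o.2.1
    - att F * tval o.1 - ratio π θ₀ o * ((Bfun π θ₀ F o.2.2)⁻¹ * Vfun π θ₀ F o.2.2)) := by
  rw [phi, Vfun]; ring

omit [IsProbabilityMeasure F] in
lemma nuisanceTangentSpace_le : nuisanceTangentSpace π Θ F θ₀ ≤ tangentSpace π Θ F θ₀ :=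
  Submodule.topologicalClosure_mono
    (Submodule.span_mono fun _ ⟨m, _, h⟩ => ⟨m, h⟩)

omit [IsProbabilityMeasure F] in
lemma toLp_score_mem_tangentSpace (m : RegularSubmodel π Θ F θ₀) :
    m.score_memLp.toLp m.score ∈ tangentSpace π Θ F θ₀ :=
  Submodule.le_topologicalClosure _ (Submodule.subset_span ⟨m, rfl⟩)

omit [IsProbabilityMeasure F] in
/-- The efficient influence function is unique. -/
theorem IsEIF.ae_eq {ψ ψ' : ObsData 𝒰 𝒵 → ℝ} (h : IsEIF π Θ F θ₀ ψ) (h' : IsEIF π Θ F θ₀ ψ') :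
    ψ =ᵐ[obsLaw F] ψ' := by
  obtain ⟨-, ⟨hψ, hψT⟩, hd⟩ := h
  obtain ⟨-, ⟨hψ', hψT'⟩, hd'⟩ := h'
  -- Both functions represent the same derivative along every submodel, so their difference is
  -- orthogonal to all scores. It also lies in the tangent space, hence it is zero.
  have horth : hψ.toLp ψ - hψ'.toLp ψ' ∈ (tangentSpace π Θ F θ₀)ᗮ := by
    refine mem_orthogonal_closure_span ?_
    rintro _ ⟨m, rfl⟩
    rw [inner_sub_right, real_inner_comm, real_inner_comm (hψ'.toLp ψ'), inner_toLp, inner_toLp,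
      (hd m).unique (hd' m), sub_self]
  have h0 := (Submodule.mem_orthogonal _ _).1 horth _ (Submodule.sub_mem _ hψT hψT')
  exact (MemLp.toLp_eq_toLp_iff hψ hψ').1 (sub_eq_zero.1 (inner_self_eq_zero.1 h0))

namespace SmoothModel

variable (H : SmoothModel π Θ θ₀ c K)
include H

lemma memLp_inner_Seff (v : EuclideanSpace ℝ (Fin d)) :
    MemLp (fun o => inner ℝ v (Seff π θ₀ F o)) 2 (obsLaw F) := by
  simp only [inner_Seff]
  exact H.memLp_ratio_mul (H.memLp_inner_div v)

lemma memLp_ratio : MemLp (ratio π θ₀) 2 (obsLaw F) :=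
  MemLp.of_bound H.measurable_ratio.aestronglyMeasurable c⁻¹ (ae_of_all _ H.abs_ratio_le)

lemma memLp_inv_Bfun_mul_Vfun (hY : MemLp (fun o : ObsData 𝒰 𝒵 => o.2.1) 2 (obsLaw F)) :
    MemLp (fun o => (Bfun π θ₀ F o.2.2)⁻¹ * Vfun π θ₀ F o.2.2) 2 (obsLaw F) :=
  MemLp.of_le_mul (c := c⁻¹) (H.memLp_Vfun hY)
    ((H.measurable_Bfun.inv.mul H.measurable_Vfun).comp measurable_obs_cov).aestronglyMeasurable
    (ae_of_all _ fun o => by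
      rw [norm_mul]
      exact mul_le_mul_of_nonneg_right (H.inv_Bfun_le _) (norm_nonneg _))

/-- For a function `g` of the covariates, `E(ρ² g / B | X) = g`. -/
lemma condExp_ratio_mul_ratio_mul_cov (hF : InModel π Θ F θ₀) {g : 𝒰 × 𝒵 → ℝ} (hg : Measurable g)
    (hg2 : MemLp (fun o : ObsData 𝒰 𝒵 => (Bfun π θ₀ F o.2.2)⁻¹ * g o.2.2) 2 (obsLaw F)) :
    (obsLaw F)[fun o => ratio π θ₀ o * (ratio π θ₀ o * ((Bfun π θ₀ F o.2.2)⁻¹ * g o.2.2)) |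
      covSigma 𝒰 𝒵] =ᵐ[obsLaw F] fun o => g o.2.2 := by
  have hρ := H.memLp_ratio (F := F)
  have e : (fun o => ratio π θ₀ o * (ratio π θ₀ o * ((Bfun π θ₀ F o.2.2)⁻¹ * g o.2.2))) =
      fun o => ratio π θ₀ o * ratio π θ₀ o * ((Bfun π θ₀ F o.2.2)⁻¹ * g o.2.2) := by
    ext o; ring
  have hi := (H.memLp_ratio_mul (H.memLp_ratio_mul hg2)).integrable one_le_two
  rw [e] at hi ⊢
  have h := condExp_mul_cov (g := fun x => (Bfun π θ₀ F x)⁻¹ * g x)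
    ((H.memLp_ratio_mul hρ).integrable one_le_two) (H.condExp_ratio_sq hF.2.2)
    (H.measurable_Bfun.inv.mul hg) hi
  filter_upwards [h] with o ho
  rw [ho, ← mul_assoc, mul_inv_cancel₀ (H.Bfun_pos o.2.2).ne', one_mul]

lemma integral_inner_Seff (hF : InModel π Θ F θ₀) (v : EuclideanSpace ℝ (Fin d)) :
    ∫ o, inner ℝ v (Seff π θ₀ F o) ∂(obsLaw F) = 0 := by
  have h := (H.memLp_inner_Seff (F := F) v).integrable one_le_two
  simp only [inner_Seff] at h ⊢
  exact H.integral_ratio_mul_cov hF.2.2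
    (H.measurable_Bfun.inv.mul (H.measurable_inner_Afun v)) h

lemma integral_inner_Seff_mul_score (m : RegularSubmodel π Θ F θ₀)
    (v : EuclideanSpace ℝ (Fin d)) :
    ∫ o, inner ℝ v (Seff π θ₀ F o) * m.score o ∂(obsLaw F) =
      ∫ o, inner ℝ m.dir (Afun π θ₀ F o.2.2) *
        ((Bfun π θ₀ F o.2.2)⁻¹ * inner ℝ v (Afun π θ₀ F o.2.2)) ∂(obsLaw F) := by
  rw [← m.integral_ratio_mul_score_mul_cov H
    (g := fun x => (Bfun π θ₀ F x)⁻¹ * inner ℝ v (Afun π θ₀ F x))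
    (H.measurable_Bfun.inv.mul (H.measurable_inner_Afun v)) (H.memLp_inner_div v)]
  refine integral_congr_ae (ae_of_all _ fun o => ?_)
  simp only [inner_Seff]; ring

/-- A nuisance submodel has direction zero, so its score satisfies `E(ρ S | X) = 0` and is
orthogonal to `ρ` times any square-integrable function of `X`. -/
lemma toLp_inner_Seff_mem_orthogonal (v : EuclideanSpace ℝ (Fin d)) :
    (H.memLp_inner_Seff (F := F) v).toLp _ ∈ (nuisanceTangentSpace π Θ F θ₀)ᗮ := by
  refine mem_orthogonal_closure_span ?_
  rintro _ ⟨m, hm, rfl⟩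
  have hdir : m.dir = 0 := m.dir_eq (by simpa using hm)
  rw [real_inner_comm, inner_toLp, H.integral_inner_Seff_mul_score m v, hdir]
  simp

/-- The score and `vᵀ S_eff`, with `v` the direction of the submodel, have mean zero, and multiplied
by `ρ` both have conditional mean `vᵀ A`. Hence modulo `Λ` a score depends only on its direction. -/
lemma toLp_score_sub_inner_Seff_mem (hF : InModel π Θ F θ₀)
    (hY : MemLp (fun o : ObsData 𝒰 𝒵 => o.2.1) 2 (obsLaw F)) (m : RegularSubmodel π Θ F θ₀) :
    m.score_memLp.toLp m.score - (H.memLp_inner_Seff (F := F) m.dir).toLp _ ∈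
      nuisanceTangentSpace π Θ F θ₀ := by
  rw [← MemLp.toLp_sub]
  refine H.toLp_mem_nuisanceTangentSpace hF hY _ ?_ ?_
  · have h1 := m.score_memLp.integrable one_le_two
    have h2 := (H.memLp_inner_Seff (F := F) m.dir).integrable one_le_two
    rw [integral_sub' h1 h2, m.integral_score, H.integral_inner_Seff hF, sub_zero]
  · have e : (fun o => ratio π θ₀ o * (m.score - fun o => inner ℝ m.dir (Seff π θ₀ F o)) o) =
        (fun o => ratio π θ₀ o * m.score o) - fun o => ratio π θ₀ o * (ratio π θ₀ o *
          ((Bfun π θ₀ F o.2.2)⁻¹ * inner ℝ m.dir (Afun π θ₀ F o.2.2))) := by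
      ext o; simp only [Pi.sub_apply, inner_Seff]; ring
    have h1 := condExp_sub (m.integrable_ratio_mul_score H)
      ((H.memLp_ratio_mul (H.memLp_ratio_mul (H.memLp_inner_div (F := F) m.dir))).integrable
        one_le_two) (covSigma 𝒰 𝒵)
    rw [e]
    filter_upwards [h1, m.condExp_ratio_mul_score H, H.condExp_ratio_mul_ratio_mul_cov hF
      (H.measurable_inner_Afun m.dir) (H.memLp_inner_div m.dir)] with o e1 e2 e3
    rw [e1, Pi.sub_apply, e2, e3, sub_self]

/-- `Seff` is the efficient score. -/
theorem isEfficientScore (hF : InModel π Θ F θ₀)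
    (hY : MemLp (fun o : ObsData 𝒰 𝒵 => o.2.1) 2 (obsLaw F)) :
    IsEfficientScore π Θ F θ₀ (Seff π θ₀ F) := by
  have hcoord : ∀ (j : Fin d) (x : EuclideanSpace ℝ (Fin d)),
      x j = inner ℝ (EuclideanSpace.single j (1 : ℝ)) x := fun j x => by
    simp [EuclideanSpace.inner_single_left]
  refine ⟨thetaScore π F θ₀, fun v => ?_, fun j => ?_⟩
  · obtain ⟨m, h1, h2, h3⟩ := H.exists_theta_submodel hF hY v
    refine ⟨m, h2.mono fun s hs => ⟨by rw [h1], hs⟩, by rw [h3]⟩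
  -- The `j`th component of the score for `θ` is the score in the coordinate direction `e_j`.
  · obtain ⟨m, h1, -, h3⟩ := H.exists_theta_submodel hF hY (EuclideanSpace.single j (1 : ℝ))
    have hdir : m.dir = EuclideanSpace.single j (1 : ℝ) :=
      m.dir_eq (Eventually.of_forall fun s => by rw [h1])
    have hmem := H.toLp_score_sub_inner_Seff_mem hF hY m
    have hS := m.score_memLp
    simp only [hcoord j]
    refine ⟨by rwa [h3] at hS, H.memLp_inner_Seff _, H.toLp_inner_Seff_mem_orthogonal _, ?_⟩
    simpa only [h3, hdir] using hmem

/-- It is the score of the submodel moving `θ` along `v`, minus an element of the nuisance tangent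
space. -/
lemma toLp_inner_Seff_mem_tangentSpace (hF : InModel π Θ F θ₀)
    (hY : MemLp (fun o : ObsData 𝒰 𝒵 => o.2.1) 2 (obsLaw F)) (v : EuclideanSpace ℝ (Fin d)) :
    (H.memLp_inner_Seff (F := F) v).toLp _ ∈ tangentSpace π Θ F θ₀ := by
  obtain ⟨m, h1, -, -⟩ := H.exists_theta_submodel hF hY v
  obtain rfl : m.dir = v := m.dir_eq (Eventually.of_forall fun s => by rw [h1])
  have h := Submodule.sub_mem _ (toLp_score_mem_tangentSpace m)
    (nuisanceTangentSpace_le (H.toLp_score_sub_inner_Seff_mem hF hY m))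
  rwa [sub_sub_cancel] at h

lemma memLp_phi (hY : MemLp (fun o : ObsData 𝒰 𝒵 => o.2.1) 2 (obsLaw F)) :
    MemLp (phi π θ₀ F) 2 (obsLaw F) := by
  have e : phi π θ₀ F = fun o => (pTreat F)⁻¹ * (ratio π θ₀ o * o.2.1
    - att F * tval o.1 - ratio π θ₀ o * ((Bfun π θ₀ F o.2.2)⁻¹ * Vfun π θ₀ F o.2.2)) :=
    funext phi_eq
  rw [e]
  exact (((H.memLp_ratio_mul hY).sub (memLp_tval.const_mul _)).sub
    (H.memLp_ratio_mul (H.memLp_inv_Bfun_mul_Vfun hY))).const_mul _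

/-- The terms `E(ρ Y)` and `Δ E(T)` cancel by the formula for `Δ`, and `ρ` times a function of `X`
has mean zero. -/
lemma integral_phi (hF : InModel π Θ F θ₀)
    (hY : MemLp (fun o : ObsData 𝒰 𝒵 => o.2.1) 2 (obsLaw F)) :
    ∫ o, phi π θ₀ F o ∂(obsLaw F) = 0 := by
  have i1 := (H.memLp_ratio_mul hY).integrable one_le_two
  have i2 := (integrable_tval_obs (F := F)).const_mul (att F)
  have i3 := (H.memLp_ratio_mul (H.memLp_inv_Bfun_mul_Vfun hY)).integrable one_le_two
  have i12 : Integrable (fun o : ObsData 𝒰 𝒵 => ratio π θ₀ o * o.2.1 - att F * tval o.1)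
    (obsLaw F) := i1.sub i2
  have hp := (H.pTreat_pos hF.2.2).ne'
  simp only [phi_eq]
  rw [integral_const_mul, integral_sub i12 i3, integral_sub i1 i2, integral_const_mul,
    H.integral_ratio_mul_cov hF.2.2 (g := fun x => (Bfun π θ₀ F x)⁻¹ * Vfun π θ₀ F x)
      (H.measurable_Bfun.inv.mul H.measurable_Vfun) i3,
    ← pTreat_eq, H.att_eq hF.2.2 hY, div_mul_cancel₀ _ hp]
  simp

/-- `φ` lies in the nuisance tangent space. -/
theorem toLp_phi_mem (hF : InModel π Θ F θ₀)
    (hY : MemLp (fun o : ObsData 𝒰 𝒵 => o.2.1) 2 (obsLaw F)) :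
    (H.memLp_phi hY).toLp (phi π θ₀ F) ∈ nuisanceTangentSpace π Θ F θ₀ := by
  refine H.toLp_mem_nuisanceTangentSpace hF hY _ (H.integral_phi hF hY) ?_
  -- As `ρ = 1` on the treated, `ρ T = T`. The conditional mean of `p ρ φ` is then the outcome part
  -- minus `Δ w`, which is `V`, minus `B · V / B`.
  have e : (fun o => ratio π θ₀ o * phi π θ₀ F o) = (pTreat F)⁻¹ •
      (((fun o : ObsData 𝒰 𝒵 => ratio π θ₀ o * (ratio π θ₀ o * o.2.1)) -
        att F • fun o : ObsData 𝒰 𝒵 => tval o.1) -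
      fun o => ratio π θ₀ o * (ratio π θ₀ o * ((Bfun π θ₀ F o.2.2)⁻¹ * Vfun π θ₀ F o.2.2))) := by
    ext o
    have hT : ratio π θ₀ o * tval o.1 = tval o.1 := by
      rw [H.ratio_eq]
      cases o.1 <;> simp [tval]
    simp only [phi_eq, Pi.smul_apply, Pi.sub_apply, smul_eq_mul]
    linear_combination (-(pTreat F)⁻¹ * att F) * hT
  have hV := H.memLp_inv_Bfun_mul_Vfun hY
  have i1 := (H.memLp_ratio_mul (H.memLp_ratio_mul hY)).integrable one_le_two
  have i2 := (integrable_tval_obs (F := F)).smul (att F)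
  have i3 := (H.memLp_ratio_mul (H.memLp_ratio_mul hV)).integrable one_le_two
  rw [e]
  filter_upwards [condExp_smul (pTreat F)⁻¹ (μ := obsLaw F)
      (((fun o : ObsData 𝒰 𝒵 => ratio π θ₀ o * (ratio π θ₀ o * o.2.1)) -
        att F • fun o : ObsData 𝒰 𝒵 => tval o.1) - fun o => ratio π θ₀ o *
        (ratio π θ₀ o * ((Bfun π θ₀ F o.2.2)⁻¹ * Vfun π θ₀ F o.2.2))) (covSigma 𝒰 𝒵),
    condExp_sub (i1.sub i2) i3 (covSigma 𝒰 𝒵), condExp_sub i1 i2 (covSigma 𝒰 𝒵),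
    condExp_smul (att F) (μ := obsLaw F) (fun o : ObsData 𝒰 𝒵 => tval o.1) (covSigma 𝒰 𝒵),
    H.condExp_ratio_sq_mul_outcome hY, condExp_tval (F := F),
    H.condExp_ratio_mul_ratio_mul_cov hF H.measurable_Vfun hV] with o e1 e2 e3 e4 e5 e6 e7
  rw [e1, Pi.smul_apply, e2, Pi.sub_apply, e3, Pi.sub_apply, e4, Pi.smul_apply, e5, e6, e7, Vfun]
  simp only [smul_eq_mul]
  ring

/-- The restriction `E(ρ S | X) = vᵀ A` turns the covariance of `ρ V / B` with the score into `vᵀ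
D`. The result has the form of the derivative of the estimand, with `D` in place of `Q`. -/
lemma integral_phi_mul_score (hY : MemLp (fun o : ObsData 𝒰 𝒵 => o.2.1) 2 (obsLaw F))
    (m : RegularSubmodel π Θ F θ₀) :
    ∫ o, phi π θ₀ F o * m.score o ∂(obsLaw F) = (pTreat F)⁻¹ *
      (∫ o, ratio π θ₀ o * o.2.1 * m.score o ∂(obsLaw F) - inner ℝ m.dir (Dvec π θ₀ F)
        - att F * ∫ o, tval o.1 * m.score o ∂(obsLaw F)) := by
  have hV := H.memLp_inv_Bfun_mul_Vfun hY
  have hS := m.score_memLp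
  have i1 := integrable_mul_of_memLp (H.memLp_ratio_mul hY) hS
  have i2 := (integrable_mul_of_memLp (memLp_tval (F := F)) hS).const_mul (att F)
  have i3 : Integrable (fun o => ratio π θ₀ o * m.score o *
      ((Bfun π θ₀ F o.2.2)⁻¹ * Vfun π θ₀ F o.2.2)) (obsLaw F) :=
    integrable_mul_of_memLp (H.memLp_ratio_mul hS) hV
  have i13 : Integrable (fun o => ratio π θ₀ o * o.2.1 * m.score o - ratio π θ₀ o * m.score o *
      ((Bfun π θ₀ F o.2.2)⁻¹ * Vfun π θ₀ F o.2.2)) (obsLaw F) := i1.sub i3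
  rw [H.inner_Dvec hY, ← m.integral_ratio_mul_score_mul_cov H
    (g := fun x => (Bfun π θ₀ F x)⁻¹ * Vfun π θ₀ F x)
    (H.measurable_Bfun.inv.mul H.measurable_Vfun) hV, ← integral_const_mul,
    ← integral_sub i1 i3, ← integral_sub i13 i2, ← integral_const_mul]
  refine integral_congr_ae (ae_of_all _ fun o => ?_)
  simp only [phi_eq]; ring

/-- `φ + Hᵀ Seff` is the efficient influence function of the effect on the treated. -/
theorem isEIF (hF : InModel π Θ F θ₀)
    (hY : MemLp (fun o : ObsData 𝒰 𝒵 => o.2.1) 2 (obsLaw F)) (hM : IsUnit (Mmat π θ₀ F)) :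
    IsEIF π Θ F θ₀ fun o => phi π θ₀ F o + inner ℝ (Hvec π θ₀ F) (Seff π θ₀ F o) := by
  have hφ := H.memLp_phi hY
  have hE := H.memLp_inner_Seff (F := F) (Hvec π θ₀ F)
  refine ⟨?_, ⟨hφ.add hE, ?_⟩, fun m => ?_⟩
  · rw [integral_add (hφ.integrable one_le_two) (hE.integrable one_le_two), H.integral_phi hF hY,
      H.integral_inner_Seff hF, add_zero]
  · have h := Submodule.add_mem _ (nuisanceTangentSpace_le (H.toLp_phi_mem hF hY))
      (H.toLp_inner_Seff_mem_tangentSpace hF hY (Hvec π θ₀ F))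
    rwa [← MemLp.toLp_add] at h
  -- `Hᵀ S_eff` has covariance `vᵀ M H` with a score of direction `v`; the choice of `H` makes this
  -- `p⁻¹ vᵀ (D - Q)`, the missing difference.
  · have hMH : WithLp.toLp 2 ((Mmat π θ₀ F).mulVec (Hvec π θ₀ F).ofLp) =
        (pTreat F)⁻¹ • (Dvec π θ₀ F - Qvec π θ₀ F) := by
      rw [Hvec, WithLp.ofLp_smul, Matrix.mulVec_smul, Matrix.mulVec_mulVec,
        Matrix.mul_nonsing_inv _ ((Matrix.isUnit_iff_isUnit_det _).1 hM), Matrix.one_mulVec,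
        WithLp.toLp_smul]
    refine (m.hasDerivAt_att H).congr_deriv ?_
    have e : (fun o => (phi π θ₀ F o + inner ℝ (Hvec π θ₀ F) (Seff π θ₀ F o)) * m.score o) =
        fun o => phi π θ₀ F o * m.score o +
          inner ℝ (Hvec π θ₀ F) (Seff π θ₀ F o) * m.score o := by
      ext o; ring
    rw [e, integral_add (integrable_mul_of_memLp hφ m.score_memLp)
      (integrable_mul_of_memLp hE m.score_memLp), H.integral_phi_mul_score hY m,
      H.integral_inner_Seff_mul_score m, ← H.inner_Mmat, hMH, inner_smul_right, inner_sub_right]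
    ring

end SmoothModel

end EfficientInfluence

end ATT

theorem proposition2 {𝒰 𝒵 : Type*} [MeasurableSpace 𝒰] [MeasurableSpace 𝒵] {d : ℕ}
    (π : ℝ → 𝒰 → EuclideanSpace ℝ (Fin d) → ℝ)
    (Θ : Set (EuclideanSpace ℝ (Fin d))) (θ₀ : EuclideanSpace ℝ (Fin d))
    (F : MeasureTheory.Measure (ATT.FullData 𝒰 𝒵)) [MeasureTheory.IsProbabilityMeasure F]
    (hθ₀ : θ₀ ∈ interior Θ)
    (hmeas : ∀ θ ∈ Θ, Measurable fun q : ℝ × 𝒰 => π q.1 q.2 θ)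
    (hoverlap : ∃ c : ℝ, 0 < c ∧ ∀ θ ∈ Θ, ∀ y u, c ≤ π y u θ ∧ π y u θ ≤ 1 - c)
    (hdiff : ∃ K : ℝ, ∀ θ ∈ interior Θ, ∀ y u,
      DifferentiableAt ℝ (π y u) θ ∧ ‖gradient (π y u) θ‖ ≤ K)
    (hF : ATT.InModel π Θ F θ₀)
    (hY : MeasureTheory.MemLp (fun o : ATT.ObsData 𝒰 𝒵 => o.2.1) 2 (ATT.obsLaw F))
    (hM : IsUnit (ATT.Mmat π θ₀ F)) :
    -- `S_eff` is the efficient score for `θ`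
    ATT.IsEfficientScore π Θ F θ₀ (ATT.Seff π θ₀ F) ∧
    -- `φ` is the part of the efficient influence function in the nuisance tangent space
    (∃ hφ : MeasureTheory.MemLp (ATT.phi π θ₀ F) 2 (ATT.obsLaw F),
      hφ.toLp (ATT.phi π θ₀ F) ∈ ATT.nuisanceTangentSpace π Θ F θ₀) ∧
    -- `φ + Hᵀ S_eff` is the efficient influence function of `Δ`, and the only one
    ATT.IsEIF π Θ F θ₀ (fun o => ATT.phi π θ₀ F o +
      inner ℝ (ATT.Hvec π θ₀ F) (ATT.Seff π θ₀ F o)) ∧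
    ∀ ψ : ATT.ObsData 𝒰 𝒵 → ℝ, ATT.IsEIF π Θ F θ₀ ψ →
      ψ =ᵐ[ATT.obsLaw F] fun o => ATT.phi π θ₀ F o +
        inner ℝ (ATT.Hvec π θ₀ F) (ATT.Seff π θ₀ F o) := by
  obtain ⟨c, hc, hov⟩ := hoverlap
  obtain ⟨K, hK⟩ := hdiff
  -- The maximum ensures nonnegativity of the bound, which the hypothesis does not give when `𝒰` is
  -- empty.
  have H : ATT.SmoothModel π Θ θ₀ c (max K 0) :=
    { mem := hθ₀
      prop := fun θ hθ => ⟨hc, hmeas θ hθ, fun y u => (hov θ hθ y u).1, fun y u => (hov θ hθ y u).2⟩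
      nonneg := le_max_right _ _
      diff := fun θ hθ y u => ⟨(hK θ hθ y u).1, (hK θ hθ y u).2.trans (le_max_left _ _)⟩ }
  exact ⟨H.isEfficientScore hF hY, ⟨H.memLp_phi hY, H.toLp_phi_mem hF hY⟩, H.isEIF hF hY hM,
    fun _ hψ => hψ.ae_eq (H.isEIF hF hY hM)⟩
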